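/- Let $\gamma>1$, let $\gamma^*=\frac{\gamma}{\gamma-1}$, and put $$M_\gamma=\{(\zeta_1,\zeta_2)\in\mathbb C^2:\operatorname{Im}\zeta_2=|\zeta_1|^\gamma\},\qquad \Omega_\gamma=\{(z_1,z_2)\in\mathbb C^2:\operatorname{Im}z_2>|z_1|^\gamma\}.$$ Parametrize $M_\gamma$ by $\zeta=(\alpha e^{i\theta},s+i\alpha^\gamma)$ with $\alpha\ge 0$, $\theta\in[0,2\pi)$, $s\in\mathbb R$, and let $\sigma=\alpha^{\gamma-1}\,ds\,d\alpha\,d\theta$. Let $$\nu=\frac{\gamma^2}{4\pi^2}\,\alpha^{\gamma-1}\,ds\,d\alpha\,d\theta$$ be the pairing measure on $M_\gamma$. For $c>0$ let $$\widetilde\mu_{M_\gamma}^{(c)}=c\,\frac{\gamma^{4/3}}{4(\gamma-1)^{1/3}}\,\alpha^{\frac{\gamma+1}{3}}\,ds\,d\alpha\,d\theta$$ be the (projectively invariant) preferred measure on $M_\gamma$ with constant $c$. Fix $c_2=(\gamma(\gamma-1))^{2/3}/\pi^2$ and write $\widetilde\mu=\widetilde\mu_{M_\gamma}^{(c_2)}$.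 The projective dual of $M_\gamma$ is represented by $M_{\gamma^*}$ through the bijection $$w:M_\gamma\to M_{\gamma^*},\qquad w(\zeta)=\Big(\bar\zeta_1|\zeta_1|^{\gamma-2},\ \frac{\zeta_2-i\gamma|\zeta_1|^\gamma}{1-\gamma}\Big).$$ On $M_{\gamma^*}$ take the preferred measure $\widetilde\mu_{M_{\gamma^*}}=\widetilde\mu_{M_{\gamma^*}}^{(c_2)}$ with the same constant $c_2=c_2(\gamma)$, and let $\widetilde\mu^*=w^*(\widetilde\mu_{M_{\gamma^*}})$ be its pullback to $M_\gamma$ (the preferred dual measure). For a function $f$ on $M_\gamma$ and $z\in\Omega_\gamma$ the Leray integral is $$\boldsymbol L_\gamma f(z)=\frac{\gamma^2}{4\pi^2}\int_{M_\gamma}\frac{f(\zeta)\,d\sigma(\zeta)}{\big[\gamma\bar\zeta_1|\zeta_1|^{\gamma-2}(\zeta_1-z_1)+i(\zeta_2-z_2)\big]^2}.$$ For every $f\in L^2(M_\gamma,\widetilde\mu)$ this integral converges absolutely at each $z\in\Omega_\gamma$, the functions $\zeta\mapsto \boldsymbol L_\gamma f(\zeta_1,\zeta_2+i\varepsilon)$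 ($\varepsilon>0$) on $M_\gamma$ belong to $L^2(M_\gamma,\widetilde\mu)$, and as $\varepsilon\to0^+$ they converge in $L^2(M_\gamma,\widetilde\mu)$ to a boundary function, again denoted $\boldsymbol L_\gamma f$; the Leray transform $\boldsymbol L_\gamma$ so obtained is a bounded linear operator on $L^2(M_\gamma,\widetilde\mu)$. The same holds for $\boldsymbol L_{\gamma^*}$ on $L^2(M_{\gamma^*},\widetilde\mu_{M_{\gamma^*}})$. Define the Hardy spaces $$H^2(M_\gamma,\widetilde\mu)=\boldsymbol L_\gamma\big(L^2(M_\gamma,\widetilde\mu)\big),\qquad H^2_{\sf dual}(M_\gamma,\widetilde\mu^*)=\Big\{h\circ w: h\in \boldsymbol L_{\gamma^*}\big(L^2(M_{\gamma^*},\widetilde\mu_{M_{\gamma^*}})\big)\Big\},$$ with the norms of $L^2(M_\gamma,\widetilde\mu)$ and $L^2(M_\gamma,\widetilde\mu^*)$ respectively. **Theorem.** For $f\in L^2(M_\gamma,\widetilde\mu)$ and $g\in L^2(M_\gamma,\widetilde\mu^*)$ the integral $\int_{M_\gamma}fg\,d\nu$ converges absolutely, and the bilinear pairing defines a bounded linear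 operator $$\hat\chi_\gamma:H^2_{\sf dual}(M_\gamma,\widetilde\mu^*)\to\big(H^2(M_\gamma,\widetilde\mu)\big)^*,\qquad \hat\chi_\gamma(g)(f)=\int_{M_\gamma}f\,g\,d\nu,$$ which is invertible (bijective with bounded inverse), and $$\big\|\hat\chi_\gamma^{-1}\big\|=\|\boldsymbol L_\gamma\|_{L^2(M_\gamma,\widetilde\mu)\to L^2(M_\gamma,\widetilde\mu)}.$$ -/

import Mathlib

open MeasureTheory Filter Topology Complex ComplexConjugate

noncomputable section

namespace LerayDuality

/-! ### The hypersurface and the domain -/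

/-- The hypersurface `M_γ = {(ζ₁, ζ₂) ∈ ℂ² : Im ζ₂ = |ζ₁| ^ γ}`. -/
def hypersurface (γ : ℝ) : Set (ℂ × ℂ) := {ζ | ζ.2.im = ‖ζ.1‖ ^ γ}

/-- The domain `Ω_γ = {(z₁, z₂) ∈ ℂ² : Im z₂ > |z₁| ^ γ}`. -/
def domain (γ : ℝ) : Set (ℂ × ℂ) := {z | ‖z.1‖ ^ γ < z.2.im}

/-- The parametrization `(ζ₁, s) ↦ (ζ₁, s + i |ζ₁| ^ γ)` of `M_γ` by `ℂ × ℝ`. -/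
def param (γ : ℝ) (p : ℂ × ℝ) : hypersurface γ :=
  ⟨(p.1, (p.2 : ℂ) + ((‖p.1‖ ^ γ : ℝ) : ℂ) * I), by simp [hypersurface]⟩

/-! ### Measures on the hypersurface -/

/-- The measure `μ_r = α ^ r ds dα dθ` on `M_γ`, where `ζ = (α e^{iθ}, s + i α ^ γ)`.
Since `α dα dθ` is the area measure of the `ζ₁`-plane, this is `|ζ₁| ^ (r - 1) dA(ζ₁) ds`,
transported to `M_γ` by the parametrization. -/
def mu (γ r : ℝ) : Measure (hypersurface γ) :=
  ((volume : Measure (ℂ × ℝ)).withDensity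
    fun p => ENNReal.ofReal (‖p.1‖ ^ (r - 1))).map (param γ)

/-- The measure `σ = μ_{γ-1}`. -/
def sigma (γ : ℝ) : Measure (hypersurface γ) := mu γ (γ - 1)

/-- The pairing measure `ν = (γ² / 4π²) α ^ (γ-1) ds dα dθ`. -/
def pairingMeasure (γ : ℝ) : Measure (hypersurface γ) :=
  ENNReal.ofReal (γ ^ 2 / (4 * Real.pi ^ 2)) • sigma γ

/-- The preferred measure on `M_γ`, with dimensional constant `c`: Fefferman's measure divided by
`(1 - β²)^{1/3}`, that is `c γ^{4/3} / (4 (γ-1)^{1/3}) α ^ ((γ+1)/3) ds dα dθ`. -/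
def preferredMeasureWith (c γ : ℝ) : Measure (hypersurface γ) :=
  ENNReal.ofReal (c * γ ^ (4 / 3 : ℝ) / (4 * (γ - 1) ^ (1 / 3 : ℝ))) • mu γ ((γ + 1) / 3)

/-- The normalization `c₂ = (γ(γ-1))^{2/3} / π²` of the dimensional constant belonging to `M_γ`.
The same constant is used on `M_γ` and on its dual hypersurface. -/
def normConst (γ : ℝ) : ℝ := (γ * (γ - 1)) ^ (2 / 3 : ℝ) / Real.pi ^ 2

/-- The preferred measure `μ̃` on `M_γ`,
namely `(γ² (γ-1)^{1/3} / 4π²) α ^ ((γ+1)/3) ds dα dθ`. -/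
def preferredMeasure (γ : ℝ) : Measure (hypersurface γ) :=
  preferredMeasureWith (normConst γ) γ

/-! ### The Leray transform -/

/-- The kernel `[γ ζ̄₁ |ζ₁|^{γ-2} (ζ₁ - z₁) + i (ζ₂ - z₂)]⁻²`. -/
def lerayKernel (γ : ℝ) (z ζ : ℂ × ℂ) : ℂ :=
  1 / ((γ : ℂ) * conj ζ.1 * ((‖ζ.1‖ ^ (γ - 2) : ℝ) : ℂ) * (ζ.1 - z.1) + I * (ζ.2 - z.2)) ^ 2

/-- The Leray integral of a function `f` on `M_γ` at the point `z` of `Ω_γ`. -/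
def lerayIntegral (γ : ℝ) (f : hypersurface γ → ℂ) (z : ℂ × ℂ) : ℂ :=
  ((γ ^ 2 / (4 * Real.pi ^ 2) : ℝ) : ℂ) * ∫ ζ, f ζ * lerayKernel γ z ζ ∂(sigma γ)

/-- `L` is the Leray transform on `L²(M_γ, μ)`: for each `f` the Leray integral converges
absolutely at every point of `Ω_γ`, and `L f` is its boundary value, in the sense that the
functions `ζ ↦ (Leray integral of f)(ζ₁, ζ₂ + iε)` on `M_γ` tend to `L f` in `L²(M_γ, μ)`
as `ε → 0+`.  There is at most one such `L`. -/
def IsLerayTransform (γ : ℝ) (μ : Measure (hypersurface γ))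
    (L : Lp ℂ 2 μ →L[ℂ] Lp ℂ 2 μ) : Prop :=
  ∀ f : Lp ℂ 2 μ,
    (∀ z ∈ domain γ, Integrable (fun ζ : hypersurface γ => f ζ * lerayKernel γ z ζ) (sigma γ)) ∧
    (∀ ε : ℝ, 0 < ε → MemLp (fun ζ : hypersurface γ =>
        lerayIntegral γ f (ζ.1.1, ζ.1.2 + (ε : ℂ) * I)) 2 μ) ∧
    Tendsto (fun ε : ℝ => eLpNorm (fun ζ : hypersurface γ =>
        lerayIntegral γ f (ζ.1.1, ζ.1.2 + (ε : ℂ) * I) - L f ζ) 2 μ) (𝓝[>] 0) (𝓝 0)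

open Classical in
/-- The Leray transform as a bounded operator on `L²(M_γ, μ)` (and `0` if there is none). -/
def leray (γ : ℝ) (μ : Measure (hypersurface γ)) : Lp ℂ 2 μ →L[ℂ] Lp ℂ 2 μ :=
  if h : ∃ L, IsLerayTransform γ μ L then h.choose else 0

/-- The Hardy space `H²(M_γ, μ) = L(L²(M_γ, μ))`, as a subspace of `L²(M_γ, μ)`. -/
def hardySubspace (γ : ℝ) (μ : Measure (hypersurface γ)) : Submodule ℂ (Lp ℂ 2 μ) :=
  LinearMap.range (leray γ μ).toLinearMap

/-- The Hardy space `H²(M_γ, μ)` as a normed space of its own, with the norm of `L²(M_γ, μ)`. -/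
def HardySpace (γ : ℝ) (μ : Measure (hypersurface γ)) : Type := hardySubspace γ μ

instance (γ : ℝ) (μ : Measure (hypersurface γ)) : NormedAddCommGroup (HardySpace γ μ) :=
  inferInstanceAs (NormedAddCommGroup (hardySubspace γ μ))

instance (γ : ℝ) (μ : Measure (hypersurface γ)) : NormedSpace ℂ (HardySpace γ μ) :=
  inferInstanceAs (NormedSpace ℂ (hardySubspace γ μ))

/-- The inclusion of `H²(M_γ, μ)` in `L²(M_γ, μ)`. -/
def HardySpace.toLp {γ : ℝ} {μ : Measure (hypersurface γ)} (f : HardySpace γ μ) : Lp ℂ 2 μ :=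
  Subtype.val (p := fun f => f ∈ hardySubspace γ μ) f

/-! ### Projective duality -/

/-- The formula `(w₁, w₂) = (ζ̄₁ |ζ₁|^{γ-2}, (ζ₂ - iγ |ζ₁|^γ) / (1 - γ))`.  For `ζ ∈ M_γ` the
complex tangent line of `M_γ` at `ζ` is `{z : γ w₁ z₁ + i z₂ + i (γ-1) w₂ = 0}`. -/
def dualPoint (γ : ℝ) (ζ : ℂ × ℂ) : ℂ × ℂ :=
  (conj ζ.1 * ((‖ζ.1‖ ^ (γ - 2) : ℝ) : ℂ),
    (ζ.2 - I * (γ : ℂ) * ((‖ζ.1‖ ^ γ : ℝ) : ℂ)) / (1 - (γ : ℂ)))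

theorem norm_dualPoint_fst {γ : ℝ} (hγ : 1 < γ) (ζ : ℂ × ℂ) :
    ‖(dualPoint γ ζ).1‖ = ‖ζ.1‖ ^ (γ - 1) := by
  have h0 := norm_nonneg ζ.1
  simp only [dualPoint, norm_mul, RCLike.norm_conj, norm_real, Real.norm_eq_abs,
    abs_of_nonneg (Real.rpow_nonneg h0 _)]
  rcases h0.eq_or_lt with h | h
  · rw [← h, zero_mul, Real.zero_rpow (by linarith)]
  · rw [mul_comm, ← Real.rpow_add_one h.ne']
    congr 1
    ring

theorem dualPoint_mem {γ : ℝ} (hγ : 1 < γ) {ζ : ℂ × ℂ} (hζ : ζ ∈ hypersurface γ) :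
    dualPoint γ ζ ∈ hypersurface γ.conjExponent := by
  have hζ' : ζ.2.im = ‖ζ.1‖ ^ γ := hζ
  have h1 : (1 - (γ : ℂ)) = ((1 - γ : ℝ) : ℂ) := by push_cast; ring
  have hne : (1 - γ) ≠ 0 := by linarith
  have hne' : γ - 1 ≠ 0 := by linarith
  change (dualPoint γ ζ).2.im = _
  rw [norm_dualPoint_fst hγ, ← Real.rpow_mul (norm_nonneg _), Real.conjExponent,
    mul_div_cancel₀ _ hne']
  simp only [dualPoint, h1, div_ofReal_im]
  rw [div_eq_iff hne]
  simp only [sub_im, mul_im, mul_re, I_re, I_im, ofReal_re, ofReal_im, hζ']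
  ring

theorem conjExponent_conjExponent {γ : ℝ} (hγ : 1 < γ) : γ.conjExponent.conjExponent = γ := by
  have : γ - 1 ≠ 0 := by linarith
  simp only [Real.conjExponent]
  field_simp
  ring

theorem one_lt_conjExponent {γ : ℝ} (hγ : 1 < γ) : 1 < γ.conjExponent := by
  rw [Real.conjExponent, lt_div_iff₀ (by linarith)]
  linarith

theorem dualPoint_dualPoint {γ : ℝ} (hγ : 1 < γ) (ζ : ℂ × ℂ) :
    dualPoint γ.conjExponent (dualPoint γ ζ) = ζ := by
  have hne' : γ - 1 ≠ 0 := by linarith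
  have hc : ((γ : ℂ) - 1) ≠ 0 := by exact_mod_cast hne'
  have hc' : (1 - (γ : ℂ)) ≠ 0 := by rw [← neg_sub]; exact neg_ne_zero.mpr hc
  have h0 := norm_nonneg ζ.1
  have hn := norm_dualPoint_fst hγ ζ
  have e1 : (γ - 1) * γ.conjExponent = γ := by rw [Real.conjExponent, mul_div_cancel₀ _ hne']
  have e2 : (γ - 1) * (γ.conjExponent - 2) = -(γ - 2) := by rw [mul_sub, e1]; ring
  refine Prod.ext ?_ ?_
  · change conj (dualPoint γ ζ).1 *
      ((‖(dualPoint γ ζ).1‖ ^ (γ.conjExponent - 2) : ℝ) : ℂ) = ζ.1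
    rw [hn, ← Real.rpow_mul h0, e2]
    simp only [dualPoint, map_mul, conj_conj, conj_ofReal]
    rcases h0.eq_or_lt with h | h
    · have : ζ.1 = 0 := norm_eq_zero.mp h.symm
      simp [this]
    · rw [mul_assoc, ← ofReal_mul, ← Real.rpow_add h]
      simp
  · change ((dualPoint γ ζ).2 - I * (γ.conjExponent : ℂ) *
      ((‖(dualPoint γ ζ).1‖ ^ γ.conjExponent : ℝ) : ℂ)) / (1 - (γ.conjExponent : ℂ)) = ζ.2
    rw [hn, ← Real.rpow_mul h0, e1]
    have e3 : (γ.conjExponent : ℂ) = (γ : ℂ) / ((γ : ℂ) - 1) := by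
      simp [Real.conjExponent]
    have e4 : 1 - (γ.conjExponent : ℂ) = -1 / ((γ : ℂ) - 1) := by
      rw [e3]; field_simp; ring
    rw [e4, e3]
    simp only [dualPoint]
    rw [show (1 - (γ : ℂ)) = -((γ : ℂ) - 1) by ring]
    field_simp
    ring

theorem measurable_dualPoint (γ : ℝ) : Measurable (dualPoint γ) := by
  unfold dualPoint
  have : Measurable fun z : ℂ => conj z := continuous_conj.measurable
  fun_prop

/-- The dualization map `w : M_γ → M_{γ*}`, where `γ* = γ / (γ - 1)`, with its inverse. -/
def dualMap {γ : ℝ} (hγ : 1 < γ) : hypersurface γ ≃ᵐ hypersurface γ.conjExponent where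
  toFun ζ := ⟨dualPoint γ ζ, dualPoint_mem hγ ζ.2⟩
  invFun η := ⟨dualPoint γ.conjExponent η, by
    have h := dualPoint_mem (one_lt_conjExponent hγ) η.2
    rwa [conjExponent_conjExponent hγ] at h⟩
  left_inv ζ := Subtype.ext (dualPoint_dualPoint hγ _)
  right_inv η := Subtype.ext (by
    have h := dualPoint_dualPoint (one_lt_conjExponent hγ) (η : ℂ × ℂ)
    rwa [conjExponent_conjExponent hγ] at h)
  measurable_toFun := ((measurable_dualPoint γ).comp measurable_subtype_coe).subtype_mk
  measurable_invFun :=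
    ((measurable_dualPoint γ.conjExponent).comp measurable_subtype_coe).subtype_mk

/-- The preferred measure on the dual hypersurface `M_{γ*}`, taken with the same dimensional
constant `c₂` as the preferred measure on `M_γ`. -/
def preferredMeasureOnDual (γ : ℝ) : Measure (hypersurface γ.conjExponent) :=
  preferredMeasureWith (normConst γ) γ.conjExponent

/-- The preferred dual measure `μ̃* = w^*(μ̃_{M_{γ*}})` on `M_γ`, the pullback of the preferred
measure of the dual hypersurface. -/
def preferredDualMeasure {γ : ℝ} (hγ : 1 < γ) : Measure (hypersurface γ) :=
  (preferredMeasureOnDual γ).comap (dualMap hγ)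

theorem measurePreserving_dualMap {γ : ℝ} (hγ : 1 < γ) :
    MeasurePreserving (dualMap hγ) (preferredDualMeasure hγ) (preferredMeasureOnDual γ) := by
  refine ⟨(dualMap hγ).measurable, ?_⟩
  rw [preferredDualMeasure, (dualMap hγ).measurableEmbedding.map_comap,
    (dualMap hγ).surjective.range_eq, Measure.restrict_univ]

/-- The pullback `h ↦ h ∘ w`, from `L²(M_{γ*}, μ̃_{M_{γ*}})` to `L²(M_γ, μ̃*)`. -/
def dualPullback {γ : ℝ} (hγ : 1 < γ) :
    Lp ℂ 2 (preferredMeasureOnDual γ) →ₗᵢ[ℂ] Lp ℂ 2 (preferredDualMeasure hγ) :=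
  Lp.compMeasurePreservingₗᵢ ℂ (dualMap hγ) (measurePreserving_dualMap hγ)

/-- The dual Hardy space `H²_dual(M_γ, μ̃*) = w^*(H²(M_{γ*}, μ̃_{M_{γ*}}))`, as a subspace of
`L²(M_γ, μ̃*)`. -/
def dualHardySubspace {γ : ℝ} (hγ : 1 < γ) : Submodule ℂ (Lp ℂ 2 (preferredDualMeasure hγ)) :=
  (hardySubspace γ.conjExponent (preferredMeasureOnDual γ)).map (dualPullback hγ).toLinearMap

/-- The dual Hardy space as a normed space of its own, with the norm of `L²(M_γ, μ̃*)`. -/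
def DualHardySpace {γ : ℝ} (hγ : 1 < γ) : Type := dualHardySubspace hγ

instance {γ : ℝ} (hγ : 1 < γ) : NormedAddCommGroup (DualHardySpace hγ) :=
  inferInstanceAs (NormedAddCommGroup (dualHardySubspace hγ))

instance {γ : ℝ} (hγ : 1 < γ) : NormedSpace ℂ (DualHardySpace hγ) :=
  inferInstanceAs (NormedSpace ℂ (dualHardySubspace hγ))

/-- The inclusion of `H²_dual(M_γ, μ̃*)` in `L²(M_γ, μ̃*)`. -/
def DualHardySpace.toLp {γ : ℝ} {hγ : 1 < γ} (g : DualHardySpace hγ) :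
    Lp ℂ 2 (preferredDualMeasure hγ) :=
  Subtype.val (p := fun g => g ∈ dualHardySubspace hγ) g

/-- The bilinear pairing `⟪f, g⟫ = ∫ f g dν` over `M_γ`. -/
def pairing (γ : ℝ) (f g : hypersurface γ → ℂ) : ℂ := ∫ ζ, f ζ * g ζ ∂(pairingMeasure γ)

end LerayDuality

end

noncomputable section

namespace LerayDuality

/-! ### Plancherel's theorem for functions in `L¹ ∩ L²` -/

open FourierTransform

/-! The duality itself is soft. Let `d` be the density of `ν` with respect to `μ̃*`. Because the
same constant `c₂` is used on both hypersurfaces, `μ̃ = d² μ̃*` and `ν = d μ̃*`, so the pairing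
gives an isometry `J` of `L²(μ̃*)` onto the dual of `L²(μ̃)` (`exists_pairing_isometry`). The
denominator of the Leray kernel is the incidence form between a point and a complex tangent line,
hence symmetric under projective duality up to a factor; therefore the Leray transform of `M_{γ*}`,
pulled back by `w`, is the transpose of `L_γ` (`pairing_leray`).

If moreover `L = L_γ` is a bounded idempotent, then `J` carries the dual Hardy space onto the
functionals `φ` with `φ ∘ L = φ` (`mem_dualHardySubspace_iff`). Restriction to the range of `L` is a
bijection from these onto the dual of the Hardy space, with inverse `φ ↦ J⁻¹(φ ∘ L)`. By Hahn–Banach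
the norm of this inverse is exactly `‖L‖` (`exists_dual_equiv_range`).

The analytic work is to show that `L` exists, is bounded and is idempotent. A Fourier transform in
`s` turns the Leray integral at height `ε` into multiplication by `e^{-2πεξ}`, for `ξ > 0`, of
operators on the plane with kernel `exp(-τ · phase)`, where `τ = 2πξ` (`coordLeray_eq_fourierInv`).
Expanding the exponential writes such a fibre operator as a sum of rank-one operators built on two
orthogonal families of monomials. Its boundedness thus reduces to a bound on a product of Gamma
values that does not involve `τ`, which is Stirling's formula (`exists_Gamma_mul_Gamma_le`,
`exists_lintegral_fiberOp_le`). The same expansion shows that the fibre operators are projections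
(`fiberOp_fiberOp`), so the Leray integrals at positive heights compose by adding heights
(`coordLeray_coordLeray`). Uniform bounds and convergence on a dense set give the strong limit as `ε
→ 0`, and the semigroup law makes the limit idempotent (`leray_leray`). -/

theorem coeFn_fourier_toLp_ae_eq {g : ℝ → ℂ} (h1 : Integrable g) (h2 : MemLp g 2) :
    ((𝓕 (h2.toLp g) : Lp ℂ 2 (volume : Measure ℝ)) : ℝ → ℂ) =ᵐ[volume] 𝓕 g := by
  have hloc : LocallyIntegrable ((𝓕 (h2.toLp g) : Lp ℂ 2 (volume : Measure ℝ)) : ℝ → ℂ) :=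
    (Lp.memLp _).locallyIntegrable (by norm_num)
  have hcont : Continuous (𝓕 g) :=
    VectorFourier.fourierIntegral_continuous Real.continuous_fourierChar (by fun_prop) h1
  refine ae_eq_of_integral_contDiff_smul_eq hloc hcont.locallyIntegrable fun φ hφ hc => ?_
  have hc' : HasCompactSupport fun x => (φ x : ℂ) := hc.comp_left (g := fun y : ℝ => (y : ℂ)) rfl
  let ψ : SchwartzMap ℝ ℂ := hc'.toSchwartzMap (ofRealCLM.contDiff.comp hφ)
  -- Both transforms are tested against `ψ`: the one on `L²` is the distributional transform, and
  -- for the integral one the Fourier kernel can be moved from `ψ` to `g`.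
  have key := congrArg (fun T : TemperedDistribution ℝ ℂ => T ψ)
    (Lp.fourier_toTemperedDistribution_eq (h2.toLp g))
  simp only [TemperedDistribution.fourier_apply, Lp.toTemperedDistribution_apply] at key
  have e1 : ∫ x, (𝓕 ψ) x • (h2.toLp g : ℝ → ℂ) x = ∫ x, (𝓕 ψ) x • g x :=
    integral_congr_ae (h2.coeFn_toLp.mono fun x hx => by simp only [hx])
  have e2 : ∫ x, (𝓕 ψ) x • g x = ∫ x, ψ x • 𝓕 g x :=
    VectorFourier.integral_fourierIntegral_smul_eq_flip Real.continuous_fourierChar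
      (L := innerₗ ℝ) (by fun_prop) ψ.integrable h1 |>.trans (by
        congr 1 with x
        congr 2
        exact flip_innerₗ ℝ)
  rw [e1, e2] at key
  have hψ : ∀ x, ψ x = φ x := fun x => rfl
  simp only [hψ] at key
  simpa using key.symm

/-- Plancherel's theorem for functions in `L¹ ∩ L²`. -/
theorem lintegral_enorm_sq_fourier {g : ℝ → ℂ} (h1 : Integrable g) (h2 : MemLp g 2) :
    ∫⁻ x, ‖𝓕 g x‖ₑ ^ 2 = ∫⁻ x, ‖g x‖ₑ ^ 2 := by
  have key : eLpNorm (𝓕 g) 2 volume = eLpNorm g 2 volume := by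
    rw [← eLpNorm_congr_ae (coeFn_fourier_toLp_ae_eq h1 h2), ← eLpNorm_congr_ae h2.coeFn_toLp,
      ← Lp.enorm_def, ← Lp.enorm_def]
    rw [← ofReal_norm, ← ofReal_norm, Lp.norm_fourier_eq]
  simp only [eLpNorm_eq_lintegral_rpow_enorm_toReal two_ne_zero ENNReal.ofNat_ne_top,
    ENNReal.toReal_ofNat] at key
  have := congrArg (fun x : ENNReal => x ^ (2 : ℝ)) key
  simp only [← ENNReal.rpow_mul] at this
  simpa using this

theorem lintegral_enorm_sq_fourierInv {g : ℝ → ℂ} (h1 : Integrable g) (h2 : MemLp g 2) :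
    ∫⁻ x, ‖𝓕⁻ g x‖ₑ ^ 2 = ∫⁻ x, ‖g x‖ₑ ^ 2 := by
  rw [← lintegral_enorm_sq_fourier h1 h2, ← lintegral_neg_eq_self (fun x => ‖𝓕 g x‖ₑ ^ 2)]
  simp only [Real.fourierInv_eq_fourier_neg]

/-! ### The kernel `(a + it)⁻²` as a Fourier–Laplace transform -/

theorem integrableOn_mul_exp_neg {a : ℂ} (ha : 0 < a.re) :
    IntegrableOn (fun ξ : ℝ => (ξ : ℂ) * exp (-(2 * Real.pi * ξ * a))) (Set.Ioi 0) := by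
  have h := integrableOn_rpow_mul_exp_neg_mul_rpow (s := 1) (p := 1) (b := 2 * Real.pi * a.re)
    (by norm_num) zero_lt_one (by positivity)
  refine (integrable_norm_iff (by fun_prop)).1 ?_
  refine h.congr_fun (fun ξ hξ => ?_) measurableSet_Ioi
  have hξ : 0 < ξ := hξ
  simp [norm_exp, abs_of_pos hξ]
  left
  ring_nf

theorem integral_mul_exp_neg {a : ℂ} (ha : 0 < a.re) :
    ∫ ξ in Set.Ioi (0 : ℝ), (ξ : ℂ) * exp (-(2 * Real.pi * ξ * a))
      = 1 / ((2 * Real.pi) ^ 2 * a ^ 2) := by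
  set b : ℂ := 2 * Real.pi * a with hb
  have hbr : 0 < b.re := by
    have : b.re = 2 * Real.pi * a.re := by simp [hb]
    rw [this]; positivity
  have hb0 : b ≠ 0 := fun h => by simp [h] at hbr
  -- The primitive comes from one integration by parts; it vanishes at infinity and equals `-1 / b²`
  -- at `0`.
  have hd : ∀ ξ : ℝ, HasDerivAt (fun ξ : ℝ => -((ξ : ℂ) / b + 1 / b ^ 2) * exp (-(b * ξ)))
      ((ξ : ℂ) * exp (-(2 * Real.pi * ξ * a))) ξ := by
    intro ξ
    have h1 : HasDerivAt (fun ξ : ℝ => (ξ : ℂ)) 1 ξ := ofRealCLM.hasDerivAt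
    convert! ((h1.div_const b).add_const (1 / b ^ 2)).neg.mul (h1.const_mul b).neg.cexp using 1
    have : -(2 * Real.pi * ξ * a) = -(b * ξ) := by rw [hb]; ring
    rw [this]
    simp only [Pi.neg_apply]
    field_simp
    ring
  have hlim : Tendsto (fun ξ : ℝ => -((ξ : ℂ) / b + 1 / b ^ 2) * exp (-(b * ξ))) atTop (𝓝 0) := by
    have t1 : Tendsto (fun ξ : ℝ => (ξ : ℂ) * exp (-(b * ξ))) atTop (𝓝 0) := by
      rw [tendsto_zero_iff_norm_tendsto_zero]
      have := Real.tendsto_pow_mul_exp_neg_atTop_nhds_zero 1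
      have h2 := (this.comp (tendsto_id.const_mul_atTop hbr)).const_mul b.re⁻¹
      rw [mul_zero] at h2
      refine h2.congr' ((eventually_gt_atTop 0).mono fun ξ hξ => ?_)
      simp [norm_exp, abs_of_pos hξ]
      field_simp
    have t2 : Tendsto (fun ξ : ℝ => exp (-(b * ξ))) atTop (𝓝 0) := by
      rw [tendsto_zero_iff_norm_tendsto_zero]
      refine (Real.tendsto_exp_neg_atTop_nhds_zero.comp
        (tendsto_id.const_mul_atTop hbr)).congr fun ξ => ?_
      simp [norm_exp]
    have := (t1.const_mul (-(1 / b))).sub (t2.const_mul (1 / b ^ 2))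
    simp only [mul_zero, sub_zero] at this
    refine this.congr fun ξ => ?_
    ring
  rw [integral_Ioi_of_hasDerivAt_of_tendsto (hd 0).continuousAt.continuousWithinAt
    (fun ξ _ => hd ξ) (integrableOn_mul_exp_neg ha) hlim]
  simp [hb]
  field_simp

/-- The function `ξ ↦ ξ₊ e^{-2πξa}`. -/
def laplaceFun (a : ℂ) (ξ : ℝ) : ℂ :=
  (Set.Ioi (0 : ℝ)).indicator (fun ξ => (ξ : ℂ) * exp (-(2 * Real.pi * ξ * a))) ξ

theorem laplaceFun_eq_max (a : ℂ) (ξ : ℝ) :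
    laplaceFun a ξ = ((max ξ 0 : ℝ) : ℂ) * exp (-(2 * Real.pi * ξ * a)) := by
  unfold laplaceFun
  by_cases h : 0 < ξ
  · simp [h, h.le]
  · simp [h, not_lt.1 h]

/-- The factor `ξ` vanishes where the cut-off jumps. Continuity lets Fourier inversion hold at every
point, not only almost everywhere. -/
theorem continuous_laplaceFun (a : ℂ) : Continuous (laplaceFun a) := by
  simp only [funext (laplaceFun_eq_max a)]
  fun_prop

theorem integrable_laplaceFun {a : ℂ} (ha : 0 < a.re) : Integrable (laplaceFun a) :=
  (integrable_indicator_iff measurableSet_Ioi).2 (integrableOn_mul_exp_neg ha)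

theorem fourier_laplaceFun {a : ℂ} (ha : 0 < a.re) (t : ℝ) :
    𝓕 (laplaceFun a) t = 1 / ((2 * Real.pi) ^ 2 * (a + I * t) ^ 2) := by
  rw [← integral_mul_exp_neg (by simpa using ha), Real.fourier_real_eq_integral_exp_smul,
    ← integral_indicator measurableSet_Ioi]
  congr 1 with ξ
  by_cases h : 0 < ξ
  · simp only [laplaceFun, Set.mem_Ioi, h, Set.indicator_of_mem, smul_eq_mul]
    rw [mul_left_comm, ← Complex.exp_add]
    congr 2
    push_cast
    ring
  · simp [laplaceFun, h]

theorem normSq_add_I_mul (a : ℂ) (t : ℝ) : ‖a + I * t‖ ^ 2 = a.re ^ 2 + (a.im + t) ^ 2 := by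
  rw [← Complex.normSq_eq_norm_sq, Complex.normSq_apply]
  simp
  ring

theorem integrable_inv_sq_add_sq {c : ℝ} (hc : 0 < c) (b : ℝ) :
    Integrable fun t : ℝ => (c ^ 2 + (b + t) ^ 2)⁻¹ := by
  have h := (((integrable_inv_one_add_sq.const_mul (c ^ 2)⁻¹).comp_div hc.ne').comp_add_left b)
  refine h.congr (Eventually.of_forall fun t => ?_)
  simp only
  field_simp

theorem integral_inv_sq_add_sq {c : ℝ} (hc : 0 < c) (b : ℝ) :
    ∫ t : ℝ, (c ^ 2 + (b + t) ^ 2)⁻¹ = Real.pi / c := by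
  have e : ∀ t : ℝ, (c ^ 2 + (b + t) ^ 2)⁻¹ = (c ^ 2)⁻¹ * (1 + ((b + t) / c) ^ 2)⁻¹ := by
    intro t; field_simp
  simp only [e]
  rw [integral_const_mul,
    integral_add_left_eq_self (fun t => (1 + (t / c) ^ 2)⁻¹) b,
    Measure.integral_comp_div (fun t => (1 + t ^ 2)⁻¹) c, integral_univ_inv_one_add_sq,
    abs_of_pos hc, smul_eq_mul]
  field_simp

theorem norm_one_div_sq (a : ℂ) (t : ℝ) :
    ‖1 / (a + I * t) ^ 2‖ = (a.re ^ 2 + (a.im + t) ^ 2)⁻¹ := by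
  rw [norm_div, norm_pow, normSq_add_I_mul]; simp

theorem integrable_one_div_sq {a : ℂ} (ha : 0 < a.re) :
    Integrable fun t : ℝ => 1 / (a + I * t) ^ 2 := by
  refine (integrable_norm_iff (Measurable.aestronglyMeasurable (by fun_prop))).1 ?_
  simp only [norm_one_div_sq]
  exact integrable_inv_sq_add_sq ha _

/-- The Fourier transform of `t ↦ (a + it)⁻²`. -/
theorem fourierInv_one_div_sq {a : ℂ} (ha : 0 < a.re) (ξ : ℝ) :
    𝓕⁻ (fun t : ℝ => (1 / (a + I * t) ^ 2 : ℂ)) ξ = (2 * Real.pi) ^ 2 * laplaceFun a ξ := by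
  have e : 𝓕 (laplaceFun a) = fun t : ℝ => (1 / (2 * Real.pi) ^ 2 : ℂ) * (1 / (a + I * t) ^ 2) := by
    ext t; rw [fourier_laplaceFun ha]; rw [one_div_mul_one_div]
  have hi := (integrable_one_div_sq ha).const_mul (1 / (2 * Real.pi) ^ 2 : ℂ)
  have h := congrFun ((continuous_laplaceFun a).fourierInv_fourier_eq (integrable_laplaceFun ha)
    (by rw [e]; exact hi)) ξ
  rw [← h, e]
  have hpi : (Real.pi : ℂ) ≠ 0 := by exact_mod_cast Real.pi_ne_zero
  simp only [Real.fourierInv_eq]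
  rw [← integral_const_mul]
  congr 1 with t
  simp only [Circle.smul_def, smul_eq_mul]
  field_simp

/-! ### Stirling bounds for the norms of the rank-one terms -/

/-- The quotient of `Γ(x)` by the main term `x ^ (x - 1/2) e ^ (-x)` of Stirling's formula. -/
def stirlingQuotient (x : ℝ) : ℝ := Real.Gamma x / (x ^ (x - 1 / 2) * Real.exp (-x))

/-- Taking logarithms, the claim becomes `(x + 1/2) log (1 + 1/x) ≥ 1`, which is the bound `log (1 +
t) ≥ 2t / (t + 2)` at `t = 1/x`. -/
theorem stirlingQuotient_add_one_le {x : ℝ} (hx : 0 < x) :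
    stirlingQuotient (x + 1) ≤ stirlingQuotient x := by
  have hG := Real.Gamma_pos_of_pos hx
  have h1 : 0 < x + 1 := by linarith
  unfold stirlingQuotient
  rw [Real.Gamma_add_one hx.ne', div_le_div_iff₀ (by positivity) (by positivity)]
  have key : x * (x ^ (x - 1 / 2) * Real.exp (-x)) ≤
      (x + 1) ^ (x + 1 - 1 / 2) * Real.exp (-(x + 1)) := by
    have e1 : x * x ^ (x - 1 / 2) = Real.exp ((x + 1 / 2) * Real.log x) := by
      rw [mul_comm, ← Real.rpow_add_one hx.ne', Real.rpow_def_of_pos hx]; ring_nf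
    have e2 : (x + 1) ^ (x + 1 - 1 / 2) = Real.exp ((x + 1 / 2) * Real.log (x + 1)) := by
      rw [Real.rpow_def_of_pos h1]; ring_nf
    rw [← mul_assoc, e1, e2, ← Real.exp_add, ← Real.exp_add, Real.exp_le_exp]
    have h2 := Real.le_log_one_add_of_nonneg (x := 1 / x) (by positivity)
    have h3 : Real.log (x + 1) = Real.log x + Real.log (1 + 1 / x) := by
      rw [← Real.log_mul hx.ne' (by positivity)]; congr 1; field_simp
    have h4 : 2 * (1 / x) / (1 / x + 2) = 1 / (x + 1 / 2) := by field_simp; ring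
    rw [h4, div_le_iff₀ (by positivity)] at h2
    rw [h3]
    nlinarith
  calc x * Real.Gamma x * (x ^ (x - 1 / 2) * Real.exp (-x))
      = Real.Gamma x * (x * (x ^ (x - 1 / 2) * Real.exp (-x))) := by ring
    _ ≤ _ := by gcongr

/-- The Stirling quotient is bounded on the compact interval `[a, a + 1]` and does not increase
under unit shifts, so the same bound holds on all of `[a, ∞)`. -/
theorem exists_Gamma_le_stirling {a : ℝ} (ha : 0 < a) :
    ∃ C : ℝ, 0 < C ∧ ∀ x, a ≤ x → Real.Gamma x ≤ C * (x ^ (x - 1 / 2) * Real.exp (-x)) := by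
  have hc : ContinuousOn stirlingQuotient (Set.Icc a (a + 1)) := by
    intro x hx
    have hx0 : 0 < x := ha.trans_le hx.1
    refine ContinuousAt.continuousWithinAt ?_
    unfold stirlingQuotient
    refine ContinuousAt.div ?_ ?_ (by positivity)
    · exact (Real.differentiableAt_Gamma fun m => by
        have : (0 : ℝ) ≤ m := m.cast_nonneg
        linarith).continuousAt
    · exact (continuousAt_id.rpow (by fun_prop) (Or.inl hx0.ne')).mul (by fun_prop)
  obtain ⟨C, hC⟩ := isCompact_Icc.bddAbove_image hc
  have main : ∀ (n : ℕ) (x : ℝ), a ≤ x → x ≤ a + 1 + n → stirlingQuotient x ≤ C := by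
    intro n
    induction n with
    | zero => exact fun x h1 h2 => hC ⟨x, ⟨h1, by simpa using h2⟩, rfl⟩
    | succ n ih =>
      intro x h1 h2
      rcases le_total x (a + 1) with h | h
      · exact hC ⟨x, ⟨h1, h⟩, rfl⟩
      · have h3 := stirlingQuotient_add_one_le (x := x - 1) (by linarith)
        rw [sub_add_cancel] at h3
        push_cast at h2
        exact h3.trans (ih _ (by linarith) (by linarith))
  refine ⟨max C 1, by positivity, fun x hx => ?_⟩
  have hx0 : 0 < x := ha.trans_le hx
  obtain ⟨n, hn⟩ := exists_nat_ge (x - (a + 1))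
  have h := main n x hx (by linarith)
  rw [stirlingQuotient, div_le_iff₀ (by positivity)] at h
  exact h.trans (by gcongr; exact le_max_left _ _)

/-- This is `log u ≤ u - 1` at `u = x / X`. It replaces the base `x` by a nearby `X` for which the
products of powers can be evaluated exactly. -/
theorem rpow_self_le {x X : ℝ} (hx : 0 < x) (hX : 0 < X) :
    x ^ x ≤ X ^ x * Real.exp (x * (x / X - 1)) := by
  have h : (x / X) ^ x ≤ Real.exp (x * (x / X - 1)) := by
    rw [Real.rpow_def_of_pos (by positivity), Real.exp_le_exp, mul_comm]
    exact mul_le_mul_of_nonneg_left (Real.log_le_sub_one_of_pos (by positivity)) hx.le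
  calc x ^ x = X ^ x * (x / X) ^ x := by
        rw [← Real.mul_rpow hX.le (by positivity)]; congr 1; field_simp
    _ ≤ _ := by gcongr

theorem two_pi_mul_le_factorial_sq (k : ℕ) :
    2 * Real.pi * ((k : ℝ) + 1) ^ (2 * k + 2) / ((k : ℝ) + 1) * Real.exp (-(2 * ((k : ℝ) + 1)))
      ≤ (k.factorial : ℝ) ^ 2 := by
  have hn : (0 : ℝ) < (k : ℝ) + 1 := by positivity
  have h := Stirling.le_factorial_stirling (k + 1)
  push_cast [Nat.factorial_succ] at h
  have h2 := pow_le_pow_left₀ (by positivity) h 2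
  rw [mul_pow, mul_pow, Real.sq_sqrt (by positivity), ← pow_mul, div_pow] at h2
  have e : Real.exp 1 ^ ((k + 1) * 2) = Real.exp (2 * ((k : ℝ) + 1)) := by
    rw [← Real.exp_nat_mul]; push_cast; ring_nf
  rw [e] at h2
  have h3 : (k.factorial : ℝ) ^ 2 = ((k : ℝ) + 1) ^ 2 * (k.factorial : ℝ) ^ 2 / ((k : ℝ) + 1) ^ 2 := by
    field_simp
  rw [h3, le_div_iff₀ (by positivity)]
  refine le_trans (le_of_eq ?_) h2
  rw [Real.exp_neg]
  field_simp
  ring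

/-- The left side is the product `‖a k‖² ‖u k‖² ‖v k‖²` for the rank-one terms of the fibre
operators. The two Gamma arguments add up to `2(k + 1)`, so the exponentials and the powers of `k +
1` cancel against those of `(k!)²`, and the powers of `γ` and `γ - 1` cancel as well. -/
theorem exists_Gamma_mul_Gamma_le {γ : ℝ} (hγ : 1 < γ) :
    ∃ C : ℝ, ∀ k : ℕ, γ ^ (2 * k + 2) / ((k.factorial : ℝ) ^ 2 * 2 ^ (2 * k + 2)) *
      (Real.Gamma ((2 * k + (γ - 2) / 3 + 2) / γ) *
        Real.Gamma ((2 * k * (γ - 1) + 5 * (γ - 2) / 3 + 2) / γ)) *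
      (γ - 1) ^ (-((2 * k * (γ - 1) + 5 * (γ - 2) / 3 + 2) / γ)) ≤ C := by
  -- Both Gamma arguments are at least `1/3` for every `k` and every `γ > 1`.
  obtain ⟨C, hC0, hC⟩ := exists_Gamma_le_stirling (a := 1 / 3) (by norm_num)
  have hγ0 : 0 < γ := by linarith
  have hγ1 : 0 < γ - 1 := by linarith
  set d : ℝ := (γ - 2) / (3 * γ) with hd
  -- The three factors come from the Stirling constants, from the lower bound on `√x √y`, and from
  -- the error exponent at its largest value `n = 1`.
  refine ⟨C ^ 2 / (2 * Real.pi) * (γ / √(γ - 1)) * Real.exp (d ^ 2 * (γ ^ 2 / (2 * (γ - 1)))), ?_⟩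
  intro k
  set n : ℝ := (k : ℝ) + 1 with hn
  have hk0 : (0 : ℝ) ≤ k := k.cast_nonneg
  have hn1 : 1 ≤ n := by linarith
  set x : ℝ := (2 * k + (γ - 2) / 3 + 2) / γ with hx
  set y : ℝ := (2 * k * (γ - 1) + 5 * (γ - 2) / 3 + 2) / γ with hy
  -- `X` and `Y` are the Gamma arguments freed of the shift `d`: `x = X + d` and `y = Y - d`.
  set X : ℝ := 2 * n / γ with hX
  set Y : ℝ := 2 * n * (γ - 1) / γ with hY
  have hXpos : 0 < X := by positivity
  have hYpos : 0 < Y := by positivity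
  have hxX : x = X + d := by rw [hx, hX, hd, hn]; field_simp; ring
  have hyY : y = Y - d := by rw [hy, hY, hd, hn]; field_simp; ring
  have hxy : x + y = 2 * n := by rw [hxX, hyY, hX, hY]; field_simp; ring
  have hxn : n / γ ≤ x := by
    rw [hx]; gcongr; linarith
  have hyn : n * (γ - 1) / γ ≤ y := by
    rw [hy]; gcongr; nlinarith
  have hx3 : 1 / 3 ≤ x := by
    rw [hx, div_le_div_iff₀ (by norm_num) hγ0]; linarith
  have hy3 : 1 / 3 ≤ y := by
    rw [hy, div_le_div_iff₀ (by norm_num) hγ0]; nlinarith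
  have hx0 : 0 < x := by linarith
  have hy0 : 0 < y := by linarith
  have hfac := two_pi_mul_le_factorial_sq k
  rw [← hn] at hfac
  have hxe : x ^ (x - 1 / 2) = x ^ x / √x := by
    rw [Real.rpow_sub hx0, ← Real.sqrt_eq_rpow]
  have hye : y ^ (y - 1 / 2) = y ^ y / √y := by
    rw [Real.rpow_sub hy0, ← Real.sqrt_eq_rpow]
  -- The half powers left by Stirling's formula must supply a factor `n`, to balance the division by
  -- `n` in the lower bound for `(k!)²`.
  have hsqrt : n * √(γ - 1) / γ ≤ √x * √y := by
    rw [← Real.sqrt_mul hx0.le]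
    refine Real.le_sqrt_of_sq_le ?_
    calc (n * √(γ - 1) / γ) ^ 2 = n / γ * (n * (γ - 1) / γ) := by
          rw [div_pow, mul_pow, Real.sq_sqrt hγ1.le]; field_simp
      _ ≤ _ := by gcongr
  -- The shifts of `x` and `y` are opposite, so the terms linear in `d` cancel and only a term of
  -- order `d² / n` remains.
  have hexp : x * (x / X - 1) + y * (y / Y - 1) ≤ d ^ 2 * (γ ^ 2 / (2 * (γ - 1))) := by
    have : x * (x / X - 1) + y * (y / Y - 1) = d ^ 2 * (γ ^ 2 / (2 * (γ - 1))) / n := by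
      rw [hxX, hyY, hX, hY]; field_simp; ring
    rw [this]
    exact div_le_self (by positivity) hn1
  have hXY : X ^ x * Y ^ y = (2 * n) ^ (2 * k + 2) / γ ^ (2 * k + 2) * (γ - 1) ^ y := by
    have e2 : ((2 * k + 2 : ℕ) : ℝ) = x + y := by rw [hxy, hn]; push_cast; ring
    rw [← Real.rpow_natCast, ← Real.rpow_natCast γ, e2, hX, hY, Real.div_rpow (by positivity) hγ0.le,
      Real.div_rpow (by positivity) hγ0.le, Real.mul_rpow (by positivity) hγ1.le,
      Real.rpow_add (by positivity), Real.rpow_add hγ0]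
    field_simp
  have hxxyy : x ^ x * y ^ y ≤ (2 * n) ^ (2 * k + 2) / γ ^ (2 * k + 2) * (γ - 1) ^ y *
      Real.exp (d ^ 2 * (γ ^ 2 / (2 * (γ - 1)))) := by
    calc x ^ x * y ^ y ≤ (X ^ x * Real.exp (x * (x / X - 1))) *
          (Y ^ y * Real.exp (y * (y / Y - 1))) := by
          gcongr
          · exact rpow_self_le hx0 hXpos
          · exact rpow_self_le hy0 hYpos
      _ = (X ^ x * Y ^ y) * Real.exp (x * (x / X - 1) + y * (y / Y - 1)) := by
          rw [Real.exp_add]; ring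
      _ ≤ _ := by
          rw [hXY]; gcongr
  have hGG : Real.Gamma x * Real.Gamma y ≤ C ^ 2 * (x ^ x * y ^ y) / (n * √(γ - 1) / γ) *
      Real.exp (-(2 * n)) := by
    have hp : 0 < √(γ - 1) := Real.sqrt_pos.2 hγ1
    calc Real.Gamma x * Real.Gamma y ≤ (C * (x ^ x / √x * Real.exp (-x))) *
          (C * (y ^ y / √y * Real.exp (-y))) := by
          have := (Real.Gamma_pos_of_pos hy0).le
          rw [← hxe, ← hye]
          exact mul_le_mul (hC x hx3) (hC y hy3) this (by positivity)
      _ = C ^ 2 * (x ^ x * y ^ y) / (√x * √y) * Real.exp (-(2 * n)) := by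
          have : Real.exp (-(2 * n)) = Real.exp (-x) * Real.exp (-y) := by
            rw [← Real.exp_add, ← hxy]; ring_nf
          rw [this]; field_simp
      _ ≤ _ := by gcongr
  have hsq : 0 < √(γ - 1) := Real.sqrt_pos.2 hγ1
  calc _ ≤ γ ^ (2 * k + 2) / ((2 * Real.pi * n ^ (2 * k + 2) / n * Real.exp (-(2 * n))) *
          2 ^ (2 * k + 2)) *
        (C ^ 2 * ((2 * n) ^ (2 * k + 2) / γ ^ (2 * k + 2) * (γ - 1) ^ y *
      Real.exp (d ^ 2 * (γ ^ 2 / (2 * (γ - 1))))) / (n * √(γ - 1) / γ) *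
      Real.exp (-(2 * n))) * (γ - 1) ^ (-y) := by
        have h1 := (Real.Gamma_pos_of_pos hx0).le
        have h2 := (Real.Gamma_pos_of_pos hy0).le
        refine mul_le_mul_of_nonneg_right (mul_le_mul (by gcongr) (hGG.trans ?_)
          (by positivity) (by positivity)) (by positivity)
        gcongr
    _ = _ := by
        rw [Real.rpow_neg hγ1.le, mul_pow]
        field_simp

/-! ### Power weights and the Cauchy--Schwarz inequality -/

section PowWeight

variable {X : Type*} [MeasurableSpace X]

/-- The measure `d ^ e • m`. -/
def powWeight (m : Measure X) (d : X → ℝ) (e : ℝ) : Measure X :=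
  m.withDensity fun x => ENNReal.ofReal (d x ^ e)

variable {m : Measure X} {d : X → ℝ}

instance [SigmaFinite m] (e : ℝ) : SigmaFinite (powWeight m d e) :=
  SigmaFinite.withDensity_of_ne_top' fun _ => ENNReal.ofReal_ne_top

theorem powWeight_absolutelyContinuous (e : ℝ) : powWeight m d e ≪ m :=
  withDensity_absolutelyContinuous _ _

theorem absolutelyContinuous_powWeight (hd : Measurable d) (hpos : ∀ᵐ x ∂m, 0 < d x) (e : ℝ) :
    m ≪ powWeight m d e := by
  refine withDensity_absolutelyContinuous' (by fun_prop) (hpos.mono fun x hx => ?_)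
  simpa using Real.rpow_pos_of_pos hx e

theorem powWeight_absolutelyContinuous_powWeight (hd : Measurable d) (hpos : ∀ᵐ x ∂m, 0 < d x)
    (e e' : ℝ) : powWeight m d e ≪ powWeight m d e' :=
  (powWeight_absolutelyContinuous e).trans (absolutelyContinuous_powWeight hd hpos e')

theorem lintegral_powWeight (hd : Measurable d) (e : ℝ) {f : X → ENNReal} (hf : AEMeasurable f m) :
    ∫⁻ x, f x ∂(powWeight m d e) = ∫⁻ x, ENNReal.ofReal (d x ^ e) * f x ∂m :=
  lintegral_withDensity_eq_lintegral_mul₀ (by fun_prop) hf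

theorem integral_powWeight (hd : Measurable d) (hpos : ∀ᵐ x ∂m, 0 < d x) (e : ℝ) (f : X → ℂ) :
    ∫ x, f x ∂(powWeight m d e) = ∫ x, ((d x ^ e : ℝ) : ℂ) * f x ∂m := by
  rw [powWeight, integral_withDensity_eq_integral_toReal_smul (by fun_prop) (by simp)]
  refine integral_congr_ae (hpos.mono fun x hx => ?_)
  simp only [ENNReal.toReal_ofReal (Real.rpow_nonneg hx.le e), real_smul]

theorem eLpNorm_two_sq {f : X → ℂ} (μ : Measure X) :
    eLpNorm f 2 μ ^ 2 = ∫⁻ x, ‖f x‖ₑ ^ 2 ∂μ := by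
  rw [eLpNorm_eq_lintegral_rpow_enorm_toReal two_ne_zero ENNReal.ofNat_ne_top]
  simp only [ENNReal.toReal_ofNat, ← ENNReal.rpow_natCast, ← ENNReal.rpow_mul]
  simp

theorem eLpNorm_two_eq {f : X → ℂ} (μ : Measure X) :
    eLpNorm f 2 μ = (∫⁻ x, ‖f x‖ₑ ^ 2 ∂μ) ^ (1 / 2 : ℝ) := by
  rw [eLpNorm_eq_lintegral_rpow_enorm_toReal two_ne_zero ENNReal.ofNat_ne_top]
  simp

theorem memLp_two_iff {f : X → ℂ} {μ : Measure X} (hf : AEStronglyMeasurable f μ) :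
    MemLp f 2 μ ↔ ∫⁻ x, ‖f x‖ₑ ^ 2 ∂μ < ⊤ := by
  rw [← eLpNorm_two_sq, ENNReal.pow_lt_top_iff]
  simp [MemLp, hf]

/-- The Cauchy--Schwarz inequality for power weights. -/
theorem lintegral_mul_powWeight_le (hd : Measurable d) (hpos : ∀ᵐ x ∂m, 0 < d x) {a b c : ℝ}
    (habc : a + b = 2 * c) {f g : X → ENNReal} (hf : AEMeasurable f m) (hg : AEMeasurable g m) :
    ∫⁻ x, f x * g x ∂(powWeight m d c) ≤
      (∫⁻ x, f x ^ 2 ∂(powWeight m d a)) ^ (1 / 2 : ℝ) *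
        (∫⁻ x, g x ^ 2 ∂(powWeight m d b)) ^ (1 / 2 : ℝ) := by
  rw [lintegral_powWeight (f := fun x => f x * g x) hd c (hf.mul hg), lintegral_powWeight (f := fun x => f x ^ 2) hd a (hf.pow_const 2),
    lintegral_powWeight (f := fun x => g x ^ 2) hd b (hg.pow_const 2)]
  have key := ENNReal.lintegral_mul_le_Lp_mul_Lq m Real.HolderConjugate.two_two
    (f := fun x => ENNReal.ofReal (d x ^ (a / 2)) * f x)
    (g := fun x => ENNReal.ofReal (d x ^ (b / 2)) * g x) (by fun_prop) (by fun_prop)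
  have hsq : ∀ (e : ℝ) (h : X → ENNReal),
      ∫⁻ x, (ENNReal.ofReal (d x ^ (e / 2)) * h x) ^ (2 : ℝ) ∂m =
        ∫⁻ x, ENNReal.ofReal (d x ^ e) * h x ^ 2 ∂m := by
    intro e h
    refine lintegral_congr_ae (hpos.mono fun x hx => ?_)
    simp only
    rw [ENNReal.rpow_two, mul_pow, ← ENNReal.ofReal_pow (by positivity), ← Real.rpow_natCast,
      ← Real.rpow_mul hx.le]
    norm_num
  rw [hsq, hsq] at key
  refine le_trans (le_of_eq ?_) key
  refine lintegral_congr_ae (hpos.mono fun x hx => ?_)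
  simp only [Pi.mul_apply]
  have : d x ^ c = d x ^ (a / 2) * d x ^ (b / 2) := by
    rw [← Real.rpow_add hx]; congr 1; linarith
  rw [this, ENNReal.ofReal_mul (by positivity)]
  ring

theorem lintegral_enorm_mul_powWeight_le (hd : Measurable d) (hpos : ∀ᵐ x ∂m, 0 < d x)
    {a b c : ℝ} (habc : a + b = 2 * c) {f g : X → ℂ} (hf : AEStronglyMeasurable f m)
    (hg : AEStronglyMeasurable g m) :
    ∫⁻ x, ‖f x * g x‖ₑ ∂(powWeight m d c) ≤
      eLpNorm f 2 (powWeight m d a) * eLpNorm g 2 (powWeight m d b) := by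
  simp only [enorm_mul]
  rw [eLpNorm_two_eq, eLpNorm_two_eq]
  exact lintegral_mul_powWeight_le hd hpos habc hf.enorm hg.enorm

theorem integrable_mul_powWeight (hd : Measurable d) (hpos : ∀ᵐ x ∂m, 0 < d x) {a b c : ℝ}
    (habc : a + b = 2 * c) {f g : X → ℂ} (hf : MemLp f 2 (powWeight m d a))
    (hg : MemLp g 2 (powWeight m d b)) :
    Integrable (fun x => f x * g x) (powWeight m d c) := by
  have hf' := hf.1.mono_ac (absolutelyContinuous_powWeight hd hpos a)
  have hg' := hg.1.mono_ac (absolutelyContinuous_powWeight hd hpos b)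
  exact ⟨(hf'.mul hg').mono_ac (powWeight_absolutelyContinuous c),
    (lintegral_enorm_mul_powWeight_le hd hpos habc hf' hg').trans_lt
      (ENNReal.mul_lt_top hf.2 hg.2)⟩

/-- Functions in `L² ∩ L¹`, for two power weights, are dense in `L²`. -/
theorem exists_seq_memLp_integrable [SigmaFinite m] (hd : Measurable d)
    (hpos : ∀ᵐ x ∂m, 0 < d x) {a b c : ℝ} (habc : a + b = 2 * c) {f : X → ℂ}
    (hf : MemLp f 2 (powWeight m d a)) (hfm : StronglyMeasurable f) :
    ∃ F : ℕ → X → ℂ, (∀ n, StronglyMeasurable (F n)) ∧ (∀ n, MemLp (F n) 2 (powWeight m d a)) ∧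
      (∀ n, Integrable (F n) (powWeight m d c)) ∧
      Tendsto (fun n => eLpNorm (F n - f) 2 (powWeight m d a)) atTop (𝓝 0) := by
  -- Truncation to sets of finite `d^b m`-measure: their indicators lie in `L²(d^b m)`, so
  -- Cauchy–Schwarz makes the truncated functions integrable for `d^c m`.
  let S : ℕ → Set X := spanningSets (powWeight m d b)
  have hS : ∀ n, MeasurableSet (S n) := measurableSet_spanningSets _
  refine ⟨fun n => (S n).indicator f, fun n => hfm.indicator (hS n),
    fun n => hf.indicator (hS n), fun n => ?_, ?_⟩
  · have h1 : MemLp ((S n).indicator fun _ => (1 : ℂ)) 2 (powWeight m d b) :=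
      memLp_indicator_const 2 (hS n) 1 (Or.inr (measure_spanningSets_lt_top _ n).ne)
    refine (integrable_mul_powWeight hd hpos habc hf h1).congr (Eventually.of_forall fun x => ?_)
    by_cases hx : x ∈ S n <;> simp [hx]
  · have hsq : Tendsto (fun n => ∫⁻ x, ‖((S n).indicator f - f) x‖ₑ ^ 2 ∂(powWeight m d a)) atTop
        (𝓝 (∫⁻ _, 0 ∂(powWeight m d a))) := by
      refine tendsto_lintegral_of_dominated_convergence' (fun x => ‖f x‖ₑ ^ 2)
        (fun n => ?_) (fun n => ?_) ?_ ?_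
      · exact (((hfm.indicator (hS n)).sub hfm).enorm.pow_const 2).aemeasurable
      · refine Eventually.of_forall fun x => ?_
        by_cases hx : x ∈ S n <;> simp [hx]
      · exact ((memLp_two_iff hf.1).1 hf).ne
      · refine Eventually.of_forall fun x => ?_
        refine tendsto_const_nhds.congr' ?_
        obtain ⟨N, hN⟩ := Set.mem_iUnion.1
          ((iUnion_spanningSets (powWeight m d b)).symm ▸ Set.mem_univ x : x ∈ ⋃ n, S n)
        filter_upwards [eventually_ge_atTop N] with n hn
        have : x ∈ S n := monotone_spanningSets _ hn hN
        simp [this]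
    simp only [lintegral_zero, ← eLpNorm_two_sq] at hsq
    have h2 := hsq.ennrpow_const (1 / 2 : ℝ)
    simp only [← ENNReal.rpow_natCast, ← ENNReal.rpow_mul] at h2
    norm_num at h2
    exact h2

end PowWeight

/-! ### Weights on the plane -/

/-- The measure `|ζ| ^ e dA` on the plane. -/
abbrev wt (e : ℝ) : Measure ℂ := powWeight volume (fun z : ℂ => ‖z‖) e

theorem ae_norm_pos : ∀ᵐ z : ℂ, 0 < ‖z‖ := by
  have : ∀ᵐ z : ℂ, z ≠ 0 := by simp [ae_iff]
  exact this.mono fun z hz => norm_pos_iff.2 hz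

/-- The measure `|ζ₁| ^ e dA ds` on `ℂ × ℝ`. -/
abbrev wtProd (e : ℝ) : Measure (ℂ × ℝ) := powWeight volume (fun p : ℂ × ℝ => ‖p.1‖) e

theorem wtProd_eq_prod (e : ℝ) : wtProd e = (wt e).prod volume := by
  have h := prod_withDensity_left (μ := (volume : Measure ℂ)) (ν := (volume : Measure ℝ))
    (f := fun z : ℂ => ENNReal.ofReal (‖z‖ ^ e)) (by fun_prop)
  rw [wtProd, wt, powWeight, powWeight, h, Measure.volume_eq_prod]

theorem ae_norm_fst_pos : ∀ᵐ p : ℂ × ℝ, 0 < ‖p.1‖ :=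
  Measure.quasiMeasurePreserving_fst.ae ae_norm_pos

theorem integrable_norm_rpow_mul_exp {γ q b : ℝ} (hγ : 1 < γ) (hq : -2 < q) (hb : 0 < b) :
    Integrable fun z : ℂ => ‖z‖ ^ q * Real.exp (-b * ‖z‖ ^ γ) := by
  refine Integrable.of_integral_ne_zero ?_
  rw [Complex.integral_rpow_mul_exp_neg_mul_rpow hγ.le hq hb]
  have : 0 < Real.Gamma ((q + 2) / γ) := Real.Gamma_pos_of_pos (div_pos (by linarith) (by linarith))
  have : 0 < γ := by linarith
  positivity

/-- In polar coordinates `-2 < q` is integrability at the origin and `q + 2 < 3γ` is integrability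
at infinity. The cube matches the growth of `∫ |a + it|⁻⁴ dt`, which is of order `(re a)⁻³`. -/
theorem integrable_norm_rpow_mul_inv_one_add {γ q : ℝ} (hq : -2 < q)
    (hq' : q + 2 < 3 * γ) :
    Integrable fun z : ℂ => ‖z‖ ^ q * ((1 + ‖z‖ ^ γ) ^ 3)⁻¹ := by
  rw [integrable_fun_norm_addHaar volume (f := fun y : ℝ => y ^ q * ((1 + y ^ γ) ^ 3)⁻¹),
    Complex.finrank_real_complex, ← Set.Ioc_union_Ioi_eq_Ioi zero_le_one, integrableOn_union]
  have hmeas : Measurable fun y : ℝ => y ^ (2 - 1) • (y ^ q * ((1 + y ^ γ) ^ 3)⁻¹) := by fun_prop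
  constructor
  · have h1 : IntegrableOn (fun y : ℝ => y ^ (q + 1)) (Set.Ioc 0 1) :=
      (intervalIntegrable_iff_integrableOn_Ioc_of_le zero_le_one).1
        (intervalIntegral.intervalIntegrable_rpow' (by linarith))
    refine Integrable.mono' h1 hmeas.aestronglyMeasurable
      (ae_restrict_of_forall_mem measurableSet_Ioc fun y hy => ?_)
    have hy0 : 0 < y := hy.1
    rw [Real.norm_of_nonneg (by positivity), Real.rpow_add_one hy0.ne', smul_eq_mul]
    have : ((1 + y ^ γ) ^ 3)⁻¹ ≤ 1 :=
      inv_le_one_of_one_le₀ (one_le_pow₀ (by linarith [Real.rpow_nonneg hy0.le γ]))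
    calc y ^ (2 - 1) * (y ^ q * ((1 + y ^ γ) ^ 3)⁻¹) ≤ y ^ (2 - 1) * (y ^ q * 1) := by gcongr
      _ = _ := by norm_num; ring
  · have h1 : IntegrableOn (fun y : ℝ => y ^ (q + 1 - 3 * γ)) (Set.Ioi 1) :=
      integrableOn_Ioi_rpow_of_lt (by linarith) one_pos
    refine Integrable.mono' h1 hmeas.aestronglyMeasurable
      (ae_restrict_of_forall_mem measurableSet_Ioi fun y hy => ?_)
    have hy0 : 0 < y := one_pos.trans hy
    rw [Real.norm_of_nonneg (by positivity), smul_eq_mul, Real.rpow_sub hy0,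
      Real.rpow_add_one hy0.ne', div_eq_mul_inv]
    have e3 : y ^ (3 * γ) = (y ^ γ) ^ 3 := by
      rw [mul_comm, Real.rpow_mul hy0.le]; norm_cast
    rw [e3]
    calc y ^ (2 - 1) * (y ^ q * ((1 + y ^ γ) ^ 3)⁻¹) = y ^ q * y * ((1 + y ^ γ) ^ 3)⁻¹ := by
          norm_num; ring
      _ ≤ _ := by gcongr; linarith

/-! ### The phase of the Leray kernel -/

/-- The part `(γ-1)|ζ|^γ + |z|^γ - γ ζ̄|ζ|^{γ-2} z` of the denominator of the Leray kernel. -/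
def phase (γ : ℝ) (z ζ : ℂ) : ℂ :=
  (((γ - 1) * ‖ζ‖ ^ γ + ‖z‖ ^ γ : ℝ) : ℂ) - γ * (conj ζ * ((‖ζ‖ ^ (γ - 2) : ℝ) : ℂ)) * z

theorem norm_conj_mul_rpow {γ : ℝ} (hγ : 1 < γ) (ζ : ℂ) :
    ‖conj ζ * ((‖ζ‖ ^ (γ - 2) : ℝ) : ℂ)‖ = ‖ζ‖ ^ (γ - 1) :=
  norm_dualPoint_fst hγ (ζ, 0)

theorem measurable_phase (γ : ℝ) : Measurable fun p : ℂ × ℂ => phase γ p.1 p.2 := by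
  have : Measurable fun z : ℂ => conj z := continuous_conj.measurable
  unfold phase
  fun_prop

theorem le_re_phase {γ : ℝ} (hγ : 1 < γ) (z ζ : ℂ) :
    (γ - 1) * ‖ζ‖ ^ γ + ‖z‖ ^ γ - γ * (‖ζ‖ ^ (γ - 1) * ‖z‖) ≤ (phase γ z ζ).re := by
  have h := (le_abs_self _).trans
    (Complex.abs_re_le_norm (γ * (conj ζ * ((‖ζ‖ ^ (γ - 2) : ℝ) : ℂ)) * z))
  rw [norm_mul, norm_mul, norm_conj_mul_rpow hγ, norm_real, Real.norm_of_nonneg (by linarith)] at h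
  simp only [phase, sub_re, ofReal_re]
  linarith

/-- Young's inequality for the conjugate exponents `γ` and `γ*`, multiplied by `γ`. It is what makes
the real part of the phase nonnegative. -/
theorem young_rpow {γ : ℝ} (hγ : 1 < γ) {a b : ℝ} (ha : 0 ≤ a) (hb : 0 ≤ b) :
    γ * (a ^ (γ - 1) * b) ≤ (γ - 1) * a ^ γ + b ^ γ := by
  have h := Real.young_inequality_of_nonneg hb (Real.rpow_nonneg ha (γ - 1))
    (Real.HolderConjugate.conjExponent hγ)
  have h1 : γ - 1 ≠ 0 := by linarith
  have h2 : γ ≠ 0 := by linarith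
  rw [← Real.rpow_mul ha, Real.conjExponent, mul_div_cancel₀ _ h1] at h
  have h3 := mul_le_mul_of_nonneg_left h (by linarith : 0 ≤ γ)
  have h4 : γ * (b ^ γ / γ + a ^ γ / (γ / (γ - 1))) = (γ - 1) * a ^ γ + b ^ γ := by
    field_simp; ring
  linarith

theorem re_phase_nonneg {γ : ℝ} (hγ : 1 < γ) (z ζ : ℂ) : 0 ≤ (phase γ z ζ).re := by
  linarith [le_re_phase hγ z ζ, young_rpow hγ (norm_nonneg ζ) (norm_nonneg z)]

/-- Young's inequality for `t‖ζ‖` and `t^{1-γ}‖z‖` leaves the mixed term unchanged. With `t^γ = 1/2`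
it uses only half of `(γ - 1)‖ζ‖^γ`, at the price of a larger multiple of `‖z‖^γ`. -/
theorem exists_le_young_sub {γ : ℝ} (hγ : 1 < γ) :
    ∃ K : ℝ, 0 ≤ K ∧ ∀ z ζ : ℂ, (γ - 1) / 2 * ‖ζ‖ ^ γ - K * ‖z‖ ^ γ ≤
      (γ - 1) * ‖ζ‖ ^ γ + ‖z‖ ^ γ - γ * (‖ζ‖ ^ (γ - 1) * ‖z‖) := by
  set t : ℝ := (1 / 2 : ℝ) ^ (1 / γ) with ht
  have ht0 : 0 < t := by positivity
  have hg : γ ≠ 0 := by linarith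
  have htγ : t ^ γ = 1 / 2 := by
    rw [ht, ← Real.rpow_mul (by norm_num), one_div_mul_cancel hg, Real.rpow_one]
  refine ⟨(t ^ (1 - γ)) ^ γ, by positivity, fun z ζ => ?_⟩
  have h1 := young_rpow hγ (a := t * ‖ζ‖) (b := t ^ (1 - γ) * ‖z‖) (by positivity) (by positivity)
  rw [Real.mul_rpow ht0.le (norm_nonneg _), Real.mul_rpow ht0.le (norm_nonneg _),
    Real.mul_rpow (by positivity) (norm_nonneg _), htγ] at h1
  have h2 : t ^ (γ - 1) * ‖ζ‖ ^ (γ - 1) * (t ^ (1 - γ) * ‖z‖) = ‖ζ‖ ^ (γ - 1) * ‖z‖ := by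
    have : t ^ (γ - 1) * t ^ (1 - γ) = 1 := by rw [← Real.rpow_add ht0]; simp
    linear_combination (‖ζ‖ ^ (γ - 1) * ‖z‖) * this
  rw [h2] at h1
  have h4 : 0 ≤ ‖z‖ ^ γ := by positivity
  linarith

theorem exists_mul_one_add_le_re_phase {γ : ℝ} (hγ : 1 < γ) (z : ℂ) {ε : ℝ} (hε : 0 < ε) :
    ∃ c : ℝ, 0 < c ∧ ∀ ζ, c * (1 + ‖ζ‖ ^ γ) ≤ (phase γ z ζ).re + ε := by
  obtain ⟨K, hK0, hK⟩ := exists_le_young_sub hγ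
  have hγ1 : 0 < γ - 1 := by linarith
  have hM : 0 ≤ K * ‖z‖ ^ γ := by positivity
  set M := K * ‖z‖ ^ γ
  -- The coercive bound is used with weight `l` and nonnegativity of the phase with weight `1 - l`;
  -- `l` is small enough that the loss `l M` takes at most half of `ε`.
  set l : ℝ := ε / (2 * (M + ε)) with hl
  have hl0 : 0 < l := by positivity
  have hl1 : l ≤ 1 := by rw [hl, div_le_one (by positivity)]; linarith
  have hlM : l * M ≤ ε / 2 := by
    rw [hl, div_mul_eq_mul_div, div_le_div_iff₀ (by positivity) (by norm_num)]
    nlinarith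
  refine ⟨min (ε / 2) (l * ((γ - 1) / 2)), by positivity, fun ζ => ?_⟩
  have h1 := (hK z ζ).trans (le_re_phase hγ z ζ)
  have h2 := re_phase_nonneg hγ z ζ
  have h3 : 0 ≤ ‖ζ‖ ^ γ := by positivity
  calc min (ε / 2) (l * ((γ - 1) / 2)) * (1 + ‖ζ‖ ^ γ)
      = min (ε / 2) (l * ((γ - 1) / 2)) + min (ε / 2) (l * ((γ - 1) / 2)) * ‖ζ‖ ^ γ := by ring
    _ ≤ ε / 2 + l * ((γ - 1) / 2) * ‖ζ‖ ^ γ := by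
        gcongr
        · exact min_le_left _ _
        · exact min_le_right _ _
    _ ≤ ε - l * M + l * ((γ - 1) / 2 * ‖ζ‖ ^ γ) := by nlinarith
    _ ≤ _ := by nlinarith

/-- The integrand is `(re² + (im + t)²)⁻²`; one factor is at most `re⁻²` and the other integrates to
`π / re`. -/
theorem lintegral_enorm_sq_one_div_sq_le {a : ℂ} (ha : 0 < a.re) :
    ∫⁻ t : ℝ, ‖1 / (a + I * t) ^ 2‖ₑ ^ 2 ≤ ENNReal.ofReal (Real.pi * (a.re ^ 3)⁻¹) := by
  have e : Real.pi * (a.re ^ 3)⁻¹ = ∫ t : ℝ, (a.re ^ 2)⁻¹ * (a.re ^ 2 + (a.im + t) ^ 2)⁻¹ := by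
    rw [integral_const_mul, integral_inv_sq_add_sq ha]; field_simp
  rw [e, ofReal_integral_eq_lintegral_ofReal ((integrable_inv_sq_add_sq ha _).const_mul _)
    (Eventually.of_forall fun t => by positivity)]
  refine lintegral_mono fun t => ?_
  rw [← ofReal_norm, ← ENNReal.ofReal_pow (norm_nonneg _), norm_one_div_sq]
  refine ENNReal.ofReal_le_ofReal ?_
  rw [pow_two]
  gcongr
  nlinarith [sq_nonneg (a.im + t)]

theorem memLp_two_one_div_sq {a : ℂ} (ha : 0 < a.re) :
    MemLp (fun t : ℝ => 1 / (a + I * t) ^ 2) 2 :=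
  (memLp_two_iff (integrable_one_div_sq ha).1).2
    ((lintegral_enorm_sq_one_div_sq_le ha).trans_lt ENNReal.ofReal_lt_top)

theorem lintegral_enorm_sq_laplaceFun_le {a : ℂ} (ha : 0 < a.re) :
    ∫⁻ ξ : ℝ, ‖(2 * Real.pi) ^ 2 * laplaceFun a ξ‖ₑ ^ 2 ≤
      ENNReal.ofReal (Real.pi * (a.re ^ 3)⁻¹) := by
  simp only [← fourierInv_one_div_sq ha]
  rw [lintegral_enorm_sq_fourierInv (integrable_one_div_sq ha) (memLp_two_one_div_sq ha)]
  exact lintegral_enorm_sq_one_div_sq_le ha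

theorem measurable_phase_right (γ : ℝ) (z : ℂ) : Measurable fun ζ => phase γ z ζ := by
  have : Measurable fun z : ℂ => conj z := continuous_conj.measurable
  unfold phase
  fun_prop

/-- The weight `5(γ-2)/3` is complementary to `(γ-2)/3`: their mean is the weight `γ - 2` of `σ`.
This finiteness puts the Leray kernel at positive height in the `L²` space that pairs with the
preferred one. -/
theorem lintegral_inv_re_phase_lt_top {γ : ℝ} (hγ : 1 < γ) (z : ℂ) {ε : ℝ} (hε : 0 < ε) :
    ∫⁻ ζ, ENNReal.ofReal (Real.pi * (((phase γ z ζ).re + ε) ^ 3)⁻¹) ∂(wt (5 * (γ - 2) / 3)) < ⊤ := by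
  obtain ⟨e, he⟩ : ∃ e, e = 5 * (γ - 2) / 3 := ⟨_, rfl⟩
  rw [← he]
  obtain ⟨c, hc, h⟩ := exists_mul_one_add_le_re_phase hγ z hε
  have hm : Measurable fun ζ => phase γ z ζ := measurable_phase_right γ z
  have hm' : AEMeasurable (fun ζ => ENNReal.ofReal (Real.pi * (((phase γ z ζ).re + ε) ^ 3)⁻¹)) := by
    fun_prop
  rw [lintegral_powWeight measurable_norm _ hm']
  have hi := (integrable_norm_rpow_mul_inv_one_add (γ := γ) (q := e)
    (by linarith) (by linarith)).const_mul (Real.pi * (c ^ 3)⁻¹)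
  refine lt_of_le_of_lt (lintegral_mono fun ζ => ?_) hi.lintegral_lt_top
  rw [← ENNReal.ofReal_mul (by positivity)]
  refine ENNReal.ofReal_le_ofReal ?_
  have h0 : 0 < c * (1 + ‖ζ‖ ^ γ) := by positivity
  calc ‖ζ‖ ^ (e) * (Real.pi * (((phase γ z ζ).re + ε) ^ 3)⁻¹)
      ≤ ‖ζ‖ ^ (e) * (Real.pi * ((c * (1 + ‖ζ‖ ^ γ)) ^ 3)⁻¹) := by
        gcongr; exact h ζ
    _ = _ := by rw [mul_pow, mul_inv]; ring

/-! ### Orthogonality of monomials with radial weights -/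

/-- The rotation by the angle `π / (k - l)` preserves area and multiplies the integrand by `-1`. -/
theorem integral_pow_mul_conj_pow_mul_radial {k l : ℕ} (hkl : k ≠ l) (φ : ℝ → ℂ) :
    ∫ z : ℂ, z ^ k * conj z ^ l * φ ‖z‖ = 0 := by
  set J := ∫ z : ℂ, z ^ k * conj z ^ l * φ ‖z‖ with hJ
  set d : ℝ := (k : ℝ) - l with hd
  have hd0 : d ≠ 0 := by
    rw [hd, sub_ne_zero]; exact_mod_cast hkl
  set a : Circle := Circle.exp (Real.pi / d) with ha
  have hrot : J = ∫ z : ℂ, (rotation a z) ^ k * conj (rotation a z) ^ l * φ ‖rotation a z‖ :=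
    ((rotation a).measurePreserving.integral_comp
      (rotation a).toHomeomorph.measurableEmbedding
      (fun z : ℂ => z ^ k * conj z ^ l * φ ‖z‖)).symm
  have hfac : (a : ℂ) ^ k * conj (a : ℂ) ^ l = -1 := by
    rw [ha, Circle.coe_exp, ← Complex.exp_conj, ← Complex.exp_nat_mul, ← Complex.exp_nat_mul,
      ← Complex.exp_add, ← Complex.exp_pi_mul_I]
    congr 1
    have hdc : (d : ℂ) ≠ 0 := by exact_mod_cast hd0
    simp only [map_mul, conj_ofReal, conj_I]
    push_cast
    have : (d : ℂ) = k - l := by rw [hd]; push_cast; ring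
    field_simp
    rw [this]
    ring
  have h2 : J = -J := by
    conv_lhs => rw [hrot]
    rw [hJ, ← integral_neg]
    congr 1 with z
    rw [LinearIsometryEquiv.norm_map, rotation_apply, map_mul, mul_pow, mul_pow]
    linear_combination (z ^ k * conj z ^ l * φ ‖z‖) * hfac
  exact self_eq_neg.1 h2

/-- The monomial `z ^ k |z| ^ s` with an exponential weight. -/
def radMono (γ : ℝ) (k : ℕ) (s b : ℝ) (z : ℂ) : ℂ :=
  z ^ k * ((‖z‖ ^ s * Real.exp (-b * ‖z‖ ^ γ) : ℝ) : ℂ)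

theorem measurable_radMono (γ : ℝ) (k : ℕ) (s b : ℝ) : Measurable (radMono γ k s b) := by
  unfold radMono; fun_prop

theorem norm_radMono_sq_mul {z : ℂ} (hz : 0 < ‖z‖) (γ : ℝ) (k : ℕ) (s b e : ℝ) :
    ‖z‖ ^ e * ‖radMono γ k s b z‖ ^ 2 =
      ‖z‖ ^ (2 * k + 2 * s + e) * Real.exp (-(2 * b) * ‖z‖ ^ γ) := by
  rw [radMono, norm_mul, norm_pow, norm_real, Real.norm_of_nonneg (by positivity), mul_pow,
    mul_pow, ← Real.exp_nat_mul]
  have e1 : (‖z‖ ^ k) ^ 2 = ‖z‖ ^ (2 * (k : ℝ)) := by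
    rw [mul_comm, Real.rpow_mul hz.le]; norm_cast
  have e2 : (‖z‖ ^ s) ^ 2 = ‖z‖ ^ (2 * s) := by
    rw [mul_comm, Real.rpow_mul hz.le]; norm_cast
  rw [e1, e2, Real.rpow_add hz, Real.rpow_add hz]
  push_cast
  ring_nf

theorem lintegral_radMono_sq {γ : ℝ} (hγ : 1 < γ) (k : ℕ) {s b e : ℝ} (hb : 0 < b)
    (hq : -2 < 2 * k + 2 * s + e) :
    ∫⁻ z, ‖radMono γ k s b z‖ₑ ^ 2 ∂(wt e) = ENNReal.ofReal (2 * Real.pi / γ *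
      (2 * b) ^ (-((2 * k + 2 * s + e + 2) / γ)) * Real.Gamma ((2 * k + 2 * s + e + 2) / γ)) := by
  have hm := measurable_radMono γ k s b
  rw [lintegral_powWeight measurable_norm e (by fun_prop), ← neg_div,
    ← Complex.integral_rpow_mul_exp_neg_mul_rpow hγ.le hq (by positivity),
    ofReal_integral_eq_lintegral_ofReal (integrable_norm_rpow_mul_exp hγ hq (by positivity))
      (Eventually.of_forall fun z => by positivity)]
  refine lintegral_congr_ae (ae_norm_pos.mono fun z hz => ?_)
  simp only
  rw [← norm_radMono_sq_mul hz, ENNReal.ofReal_mul (by positivity),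
    ENNReal.ofReal_pow (norm_nonneg _), ofReal_norm]

theorem memLp_radMono {γ : ℝ} (hγ : 1 < γ) (k : ℕ) {s b e : ℝ} (hb : 0 < b)
    (hq : -2 < 2 * k + 2 * s + e) : MemLp (radMono γ k s b) 2 (wt e) := by
  rw [memLp_two_iff (measurable_radMono γ k s b).aestronglyMeasurable,
    lintegral_radMono_sq hγ k hb hq]
  exact ENNReal.ofReal_lt_top

theorem norm_sq_toLp {X : Type*} [MeasurableSpace X] {μ : Measure X} {f : X → ℂ}
    (hf : MemLp f 2 μ) : ENNReal.ofReal (‖hf.toLp f‖ ^ 2) = ∫⁻ x, ‖f x‖ₑ ^ 2 ∂μ := by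
  rw [Lp.norm_toLp, ← ENNReal.toReal_pow, ENNReal.ofReal_toReal (ENNReal.pow_ne_top hf.2.ne),
    eLpNorm_two_sq]

theorem norm_sq_toLp_radMono {γ : ℝ} (hγ : 1 < γ) (k : ℕ) {s b e : ℝ} (hb : 0 < b)
    (hq : -2 < 2 * k + 2 * s + e) :
    ‖(memLp_radMono hγ k hb hq).toLp _‖ ^ 2 = 2 * Real.pi / γ *
      (2 * b) ^ (-((2 * k + 2 * s + e + 2) / γ)) * Real.Gamma ((2 * k + 2 * s + e + 2) / γ) := by
  have h := (norm_sq_toLp (memLp_radMono hγ k hb hq)).trans (lintegral_radMono_sq hγ k hb hq)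
  have hG : 0 < Real.Gamma ((2 * k + 2 * s + e + 2) / γ) :=
    Real.Gamma_pos_of_pos (div_pos (by linarith) (by linarith))
  have hγ0 : 0 < γ := by linarith
  rwa [ENNReal.ofReal_eq_ofReal_iff (by positivity) (by positivity)] at h

theorem inner_toLp {X : Type*} [MeasurableSpace X] {μ : Measure X} {f g : X → ℂ}
    (hf : MemLp f 2 μ) (hg : MemLp g 2 μ) :
    inner ℂ (hf.toLp f) (hg.toLp g) = ∫ x, conj (f x) * g x ∂μ := by
  rw [L2.inner_def]
  refine integral_congr_ae ?_
  filter_upwards [hf.coeFn_toLp, hg.coeFn_toLp] with x h1 h2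
  rw [h1, h2, RCLike.inner_apply, mul_comm]

theorem inner_radMono_eq_zero {γ : ℝ} (hγ : 1 < γ) {k l : ℕ} (hkl : k ≠ l) {s t b e : ℝ}
    (hb : 0 < b) (hq : -2 < 2 * k + 2 * s + e) (hq' : -2 < 2 * l + 2 * t + e) :
    inner ℂ ((memLp_radMono hγ k hb hq).toLp _) ((memLp_radMono hγ l hb hq').toLp _) = 0 := by
  rw [inner_toLp, integral_powWeight measurable_norm ae_norm_pos,
    ← integral_pow_mul_conj_pow_mul_radial hkl.symm (fun r : ℝ =>
      ((r ^ e * (r ^ s * Real.exp (-b * r ^ γ)) * (r ^ t * Real.exp (-b * r ^ γ)) : ℝ) : ℂ))]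
  congr 1 with z
  simp only [radMono, map_mul, map_pow, conj_ofReal]
  push_cast
  ring

/-! ### Sums of operators of rank one -/

theorem norm_sum_sq_of_orthogonal {H : Type*} [NormedAddCommGroup H] [InnerProductSpace ℂ H]
    {u : ℕ → H} (hu : Pairwise fun k l => inner ℂ (u k) (u l) = 0) (c : ℕ → ℂ) (n : ℕ) :
    ‖∑ k ∈ Finset.range n, c k • u k‖ ^ 2 = ∑ k ∈ Finset.range n, ‖c k‖ ^ 2 * ‖u k‖ ^ 2 := by
  induction n with
  | zero => simp
  | succ n ih =>
    have h0 : inner ℂ (∑ k ∈ Finset.range n, c k • u k) (c n • u n) = 0 := by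
      rw [sum_inner]
      refine Finset.sum_eq_zero fun k hk => ?_
      rw [inner_smul_left, inner_smul_right, hu (Finset.mem_range.1 hk).ne]
      simp
    have := norm_add_sq_eq_norm_sq_add_norm_sq_of_inner_eq_zero _ _ h0
    rw [Finset.sum_range_succ, Finset.sum_range_succ, ← ih, ← mul_pow, ← norm_smul, pow_two,
      this]
    ring

/-- Orthogonality of the `u k` turns the norm of the sum into a sum of squares, and Bessel's
inequality for the normalized `v k` bounds that sum. -/
theorem norm_sum_rank_one_sq_le {H : Type*} [NormedAddCommGroup H] [InnerProductSpace ℂ H]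
    {u v : ℕ → H} (hu : Pairwise fun k l => inner ℂ (u k) (u l) = 0)
    (hv : Pairwise fun k l => inner ℂ (v k) (v l) = 0) (hv0 : ∀ k, v k ≠ 0) {a : ℕ → ℂ} {C : ℝ}
    (hC : ∀ k, ‖a k‖ ^ 2 * ‖u k‖ ^ 2 * ‖v k‖ ^ 2 ≤ C) (f : H) (n : ℕ) :
    ‖∑ k ∈ Finset.range n, (a k * inner ℂ (v k) f) • u k‖ ^ 2 ≤ C * ‖f‖ ^ 2 := by
  have hon : Orthonormal ℂ fun k => ((‖v k‖ : ℂ)⁻¹) • v k := by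
    refine ⟨fun k => ?_, fun k l hkl => ?_⟩
    · exact norm_smul_inv_norm (hv0 k)
    · change inner ℂ _ _ = _
      rw [inner_smul_left, inner_smul_right, hv hkl]
      simp
  have hC0 : 0 ≤ C := le_trans (by positivity) (hC 0)
  have hb := hon.sum_inner_products_le f (s := Finset.range n)
  rw [norm_sum_sq_of_orthogonal hu]
  calc ∑ k ∈ Finset.range n, ‖a k * inner ℂ (v k) f‖ ^ 2 * ‖u k‖ ^ 2
      ≤ ∑ k ∈ Finset.range n, C * ‖inner ℂ (((‖v k‖ : ℂ)⁻¹) • v k) f‖ ^ 2 := by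
        refine Finset.sum_le_sum fun k _ => ?_
        have hvk : 0 < ‖v k‖ := norm_pos_iff.2 (hv0 k)
        rw [inner_smul_left, norm_mul, norm_mul, RCLike.norm_conj, norm_inv, norm_real, norm_norm]
        calc (‖a k‖ * ‖inner ℂ (v k) f‖) ^ 2 * ‖u k‖ ^ 2
            = ‖a k‖ ^ 2 * ‖u k‖ ^ 2 * ‖v k‖ ^ 2 * (‖v k‖⁻¹ * ‖inner ℂ (v k) f‖) ^ 2 := by
              field_simp
          _ ≤ _ := by gcongr; exact hC k
    _ = C * ∑ k ∈ Finset.range n, ‖inner ℂ (((‖v k‖ : ℂ)⁻¹) • v k) f‖ ^ 2 := by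
        rw [Finset.mul_sum]
    _ ≤ _ := by gcongr

/-! ### The fibre operators -/

/-- The operator induced by the Leray transform on the functions of the frequency `τ` in the
variable `s`. -/
def fiberOp (γ τ : ℝ) (f : ℂ → ℂ) (z : ℂ) : ℂ :=
  ((γ ^ 2 * τ / (2 * Real.pi) : ℝ) : ℂ) * ∫ ζ, f ζ * exp (-(τ * phase γ z ζ)) ∂(wt (γ - 2))

theorem norm_exp_neg_mul_phase_le {γ τ : ℝ} (hγ : 1 < γ) (hτ : 0 ≤ τ) (z ζ : ℂ) :
    ‖exp (-(τ * phase γ z ζ))‖ ≤ 1 := by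
  rw [norm_exp, Real.exp_le_one_iff]
  simpa using mul_nonneg hτ (re_phase_nonneg hγ z ζ)

/-- The terms of the expansion of `exp (-τ phase)` in powers of `z`. -/
def phaseTerm (γ τ : ℝ) (z ζ : ℂ) (k : ℕ) : ℂ :=
  (((γ * τ) ^ k / k.factorial : ℝ) : ℂ) * radMono γ k 0 τ z *
    conj (radMono γ k (k * (γ - 2)) (τ * (γ - 1)) ζ)

theorem phaseTerm_eq (γ τ : ℝ) (z ζ : ℂ) (k : ℕ) :
    phaseTerm γ τ z ζ k = exp (-(τ * (((γ - 1) * ‖ζ‖ ^ γ + ‖z‖ ^ γ : ℝ) : ℂ))) *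
      ((τ * (γ * (conj ζ * ((‖ζ‖ ^ (γ - 2) : ℝ) : ℂ)) * z)) ^ k / k.factorial) := by
  have e1 : ‖ζ‖ ^ (k * (γ - 2)) = (‖ζ‖ ^ (γ - 2)) ^ k := by
    rw [mul_comm, Real.rpow_mul (norm_nonneg _), Real.rpow_natCast]
  have e2 : exp (-(τ * (((γ - 1) * ‖ζ‖ ^ γ + ‖z‖ ^ γ : ℝ) : ℂ))) =
      exp (-τ * ((‖z‖ ^ γ : ℝ) : ℂ)) * exp (-(τ * (γ - 1)) * ((‖ζ‖ ^ γ : ℝ) : ℂ)) := by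
    rw [← Complex.exp_add]; congr 1; push_cast; ring
  rw [e2, phaseTerm, radMono, radMono, e1]
  simp only [map_mul, map_pow, conj_ofReal, Real.rpow_zero, one_mul]
  push_cast
  ring

theorem hasSum_phaseTerm (γ τ : ℝ) (z ζ : ℂ) :
    HasSum (phaseTerm γ τ z ζ) (exp (-(τ * phase γ z ζ))) := by
  have h := (NormedSpace.expSeries_div_hasSum_exp
    (τ * (γ * (conj ζ * ((‖ζ‖ ^ (γ - 2) : ℝ) : ℂ)) * z))).mul_left
      (exp (-(τ * (((γ - 1) * ‖ζ‖ ^ γ + ‖z‖ ^ γ : ℝ) : ℂ))))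
  rw [← Complex.exp_eq_exp_ℂ, ← Complex.exp_add] at h
  convert! h using 1
  · ext k; exact phaseTerm_eq γ τ z ζ k
  · rw [phase]; congr 1; ring

/-- The sum of the norms of the terms in the expansion of `exp (-τ phase)`. -/
def phaseMajorant (γ τ : ℝ) (z ζ : ℂ) : ℝ :=
  Real.exp (-(τ * ((γ - 1) * ‖ζ‖ ^ γ + ‖z‖ ^ γ - γ * (‖ζ‖ ^ (γ - 1) * ‖z‖))))

theorem hasSum_norm_phaseTerm {γ τ : ℝ} (hγ : 1 < γ) (hτ : 0 ≤ τ) (z ζ : ℂ) :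
    HasSum (fun k => ‖phaseTerm γ τ z ζ k‖) (phaseMajorant γ τ z ζ) := by
  have h := (NormedSpace.expSeries_div_hasSum_exp
    (τ * (γ * ‖ζ‖ ^ (γ - 1) * ‖z‖))).mul_left
      (Real.exp (-(τ * ((γ - 1) * ‖ζ‖ ^ γ + ‖z‖ ^ γ))))
  rw [← Real.exp_eq_exp_ℝ, ← Real.exp_add] at h
  convert! h using 1
  · ext k
    rw [phaseTerm_eq, norm_mul, norm_div, norm_pow, norm_mul, norm_mul, norm_mul,
      norm_conj_mul_rpow hγ, norm_exp, norm_real, norm_real, norm_natCast,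
      Real.norm_of_nonneg hτ, Real.norm_of_nonneg (by linarith)]
    congr 2
    simp [mul_add]
  · rw [phaseMajorant]; congr 1; ring

theorem measurable_phaseTerm (γ τ : ℝ) (z : ℂ) (k : ℕ) :
    Measurable fun ζ => phaseTerm γ τ z ζ k := by
  have : Measurable fun z : ℂ => conj z := continuous_conj.measurable
  have h := measurable_radMono γ k (k * (γ - 2)) (τ * (γ - 1))
  unfold phaseTerm
  fun_prop

/-- For fixed `z` the majorant decays exponentially in `‖ζ‖^γ`; the integrability needed to expand
the kernel under the integral sign rests on this. -/
theorem exists_phaseMajorant_le {γ τ : ℝ} (hγ : 1 < γ) (hτ : 0 ≤ τ) (z : ℂ) :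
    ∃ A : ℝ, 0 ≤ A ∧
      ∀ ζ, phaseMajorant γ τ z ζ ≤ A * Real.exp (-(τ * ((γ - 1) / 2)) * ‖ζ‖ ^ γ) := by
  obtain ⟨K, -, hK⟩ := exists_le_young_sub hγ
  refine ⟨Real.exp (τ * (K * ‖z‖ ^ γ)), by positivity, fun ζ => ?_⟩
  rw [phaseMajorant, ← Real.exp_add, Real.exp_le_exp]
  have := mul_le_mul_of_nonneg_left (hK z ζ) hτ
  linarith

theorem memLp_phaseMajorant {γ τ : ℝ} (hγ : 1 < γ) (hτ : 0 < τ) (z : ℂ) {e : ℝ} (he : -2 < e) :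
    MemLp (fun ζ => ((phaseMajorant γ τ z ζ : ℝ) : ℂ)) 2 (wt e) := by
  obtain ⟨A, hA0, hA⟩ := exists_phaseMajorant_le hγ hτ.le z
  have hγ1 : 0 < γ - 1 := by linarith
  have h := (memLp_radMono (γ := γ) hγ 0 (s := 0) (b := τ * ((γ - 1) / 2)) (e := e) (by positivity)
    (by simpa using he)).const_mul (A : ℂ)
  refine h.mono (Measurable.aestronglyMeasurable ?_) (Eventually.of_forall fun ζ => ?_)
  · unfold phaseMajorant; fun_prop
  · rw [norm_real, Real.norm_of_nonneg (show 0 ≤ phaseMajorant γ τ z ζ from (Real.exp_pos _).le)]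
    refine (hA ζ).trans (le_of_eq ?_)
    simp [radMono, norm_exp, abs_of_nonneg hA0]

theorem integrable_phaseMajorant {γ τ : ℝ} (hγ : 1 < γ) (hτ : 0 < τ) (z : ℂ) :
    Integrable (phaseMajorant γ τ z) (wt (γ - 2)) := by
  obtain ⟨A, hA0, hA⟩ := exists_phaseMajorant_le hγ hτ.le z
  have hγ1 : 0 < γ - 1 := by linarith
  have h := (integrable_norm_rpow_mul_exp (γ := γ) (q := γ - 2) (b := τ * ((γ - 1) / 2)) hγ
    (by linarith) (by positivity)).const_mul A
  rw [wt, powWeight, integrable_withDensity_iff_integrable_smul' (by fun_prop) (by simp)]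
  refine h.mono (Measurable.aestronglyMeasurable ?_) (Eventually.of_forall fun ζ => ?_)
  · unfold phaseMajorant; fun_prop
  · have h0 : 0 ≤ phaseMajorant γ τ z ζ := (Real.exp_pos _).le
    rw [ENNReal.toReal_ofReal (by positivity), smul_eq_mul, Real.norm_of_nonneg (by positivity),
      Real.norm_of_nonneg (by positivity), mul_left_comm]
    gcongr
    exact hA ζ

theorem hasSum_integral_mul_phaseTerm {γ τ : ℝ} (hγ : 1 < γ) (hτ : 0 < τ) {f : ℂ → ℂ} (z : ℂ)
    (hfm : AEStronglyMeasurable f (wt (γ - 2)))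
    (hf : Integrable (fun ζ => ‖f ζ‖ * phaseMajorant γ τ z ζ) (wt (γ - 2))) :
    HasSum (fun k => ∫ ζ, f ζ * phaseTerm γ τ z ζ k ∂(wt (γ - 2)))
      (∫ ζ, f ζ * exp (-(τ * phase γ z ζ)) ∂(wt (γ - 2))) := by
  have hsum : ∀ ζ, HasSum (fun k => ‖f ζ‖ * ‖phaseTerm γ τ z ζ k‖)
      (‖f ζ‖ * phaseMajorant γ τ z ζ) := fun ζ =>
    (hasSum_norm_phaseTerm hγ hτ.le z ζ).mul_left _
  refine hasSum_integral_of_dominated_convergence (fun k ζ => ‖f ζ‖ * ‖phaseTerm γ τ z ζ k‖)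
    (fun k => hfm.mul (measurable_phaseTerm γ τ z k).aestronglyMeasurable)
    (fun k => Eventually.of_forall fun ζ => (norm_mul _ _).le)
    (Eventually.of_forall fun ζ => (hsum ζ).summable) ?_
    (Eventually.of_forall fun ζ => (hasSum_phaseTerm γ τ z ζ).mul_left _)
  simpa only [fun ζ => (hsum ζ).tsum_eq] using hf

/-- The expansion may be integrated term by term because `f` and the majorant lie in complementary
weighted `L²` spaces. -/
theorem hasSum_fiberOp {γ τ : ℝ} (hγ : 1 < γ) (hτ : 0 < τ) {f : ℂ → ℂ}
    (hf : MemLp f 2 (wt ((γ - 2) / 3))) (z : ℂ) :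
    HasSum (fun k => ((γ ^ 2 * τ / (2 * Real.pi) : ℝ) : ℂ) *
      ∫ ζ, f ζ * phaseTerm γ τ z ζ k ∂(wt (γ - 2))) (fiberOp γ τ f z) := by
  refine HasSum.mul_left _ (hasSum_integral_mul_phaseTerm hγ hτ z
    (hf.1.mono_ac (powWeight_absolutelyContinuous_powWeight measurable_norm ae_norm_pos _ _)) ?_)
  have h := integrable_mul_powWeight measurable_norm ae_norm_pos
    (a := (γ - 2) / 3) (b := 5 * (γ - 2) / 3) (c := γ - 2) (by ring) hf
    (memLp_phaseMajorant hγ hτ z (by linarith))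
  refine h.norm.congr (Eventually.of_forall fun ζ => ?_)
  simp only [norm_mul, norm_real, Real.norm_of_nonneg (Real.exp_pos _).le, phaseMajorant]

/-- The fibre operators are bounded on `L²`, uniformly in the frequency. -/
theorem exists_lintegral_fiberOp_le {γ : ℝ} (hγ : 1 < γ) :
    ∃ C : ENNReal, C ≠ ⊤ ∧ ∀ τ : ℝ, 0 < τ → ∀ f : ℂ → ℂ, MemLp f 2 (wt ((γ - 2) / 3)) →
      ∫⁻ z, ‖fiberOp γ τ f z‖ₑ ^ 2 ∂(wt ((γ - 2) / 3)) ≤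
        C * ∫⁻ z, ‖f z‖ₑ ^ 2 ∂(wt ((γ - 2) / 3)) := by
  obtain ⟨C, hC⟩ := exists_Gamma_mul_Gamma_le hγ
  refine ⟨ENNReal.ofReal C, ENNReal.ofReal_ne_top, fun τ hτ f hf => ?_⟩
  have hγ0 : 0 < γ := by linarith
  have hγ1 : 0 < γ - 1 := by linarith
  have hqu : ∀ k : ℕ, -2 < 2 * (k : ℝ) + 2 * 0 + (γ - 2) / 3 := fun k => by
    have : (0 : ℝ) ≤ k := k.cast_nonneg
    linarith
  -- The extra exponent `2(γ-2)/3` is the quotient of the weights `γ - 2` and `(γ-2)/3`. With it,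
  -- integration against `wt (γ - 2)` becomes an inner product in `L²(wt ((γ-2)/3))`.
  have hqv : ∀ k : ℕ, -2 < 2 * (k : ℝ) + 2 * (k * (γ - 2) + 2 * (γ - 2) / 3) + (γ - 2) / 3 :=
    fun k => by
      have : (0 : ℝ) ≤ k := k.cast_nonneg
      nlinarith
  have hbv : 0 < τ * (γ - 1) := by positivity
  let u : ℕ → Lp ℂ 2 (wt ((γ - 2) / 3)) := fun k => (memLp_radMono hγ k hτ (hqu k)).toLp _
  let v : ℕ → Lp ℂ 2 (wt ((γ - 2) / 3)) := fun k => (memLp_radMono hγ k hbv (hqv k)).toLp _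
  let a : ℕ → ℂ := fun k => ((γ ^ 2 * τ / (2 * Real.pi) * ((γ * τ) ^ k / k.factorial) : ℝ) : ℂ)
  let F : Lp ℂ 2 (wt ((γ - 2) / 3)) := hf.toLp f
  have hnu : ∀ k, ‖u k‖ ^ 2 = _ := fun k => norm_sq_toLp_radMono hγ k hτ (hqu k)
  have hnv : ∀ k, ‖v k‖ ^ 2 = _ := fun k => norm_sq_toLp_radMono hγ k hbv (hqv k)
  have hv0 : ∀ k, v k ≠ 0 := by
    intro k h0
    have h1 := hnv k
    have hG := Real.Gamma_pos_of_pos (div_pos (by linarith [hqv k]) hγ0 :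
      0 < (2 * (k : ℝ) + 2 * (k * (γ - 2) + 2 * (γ - 2) / 3) + (γ - 2) / 3 + 2) / γ)
    rw [h0, norm_zero, zero_pow two_ne_zero] at h1
    have h2 := Real.rpow_pos_of_pos (by positivity : 0 < 2 * (τ * (γ - 1)))
      (-((2 * (k : ℝ) + 2 * (k * (γ - 2) + 2 * (γ - 2) / 3) + (γ - 2) / 3 + 2) / γ))
    have h3 : 0 < 2 * Real.pi / γ := by positivity
    exact absurd h1 (mul_pos (mul_pos h3 h2) hG).ne
  have hbound : ∀ k, ‖a k‖ ^ 2 * ‖u k‖ ^ 2 * ‖v k‖ ^ 2 ≤ C := by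
    intro k
    refine le_trans (le_of_eq ?_) (hC k)
    rw [hnu, hnv, norm_real, Real.norm_of_nonneg (by positivity)]
    have ex : 2 * (k : ℝ) + 2 * 0 + (γ - 2) / 3 + 2 = 2 * k + (γ - 2) / 3 + 2 := by ring
    have ey : 2 * (k : ℝ) + 2 * (k * (γ - 2) + 2 * (γ - 2) / 3) + (γ - 2) / 3 + 2 =
      2 * k * (γ - 1) + 5 * (γ - 2) / 3 + 2 := by ring
    rw [ex, ey]
    set x : ℝ := (2 * k + (γ - 2) / 3 + 2) / γ with hx
    set y : ℝ := (2 * k * (γ - 1) + 5 * (γ - 2) / 3 + 2) / γ with hy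
    -- Since the exponents add up to an integer independent of the weights, all powers of `τ`
    -- cancel; the bound is therefore uniform in the frequency.
    have hxy : -x + -y = -((2 * k + 2 : ℕ) : ℝ) := by
      rw [hx, hy]; push_cast; field_simp; ring
    have e1 : (2 * τ) ^ (-x) * (2 * (τ * (γ - 1))) ^ (-y) =
        ((2 * τ) ^ (2 * k + 2))⁻¹ * (γ - 1) ^ (-y) := by
      rw [← mul_assoc 2 τ, Real.mul_rpow (by positivity) hγ1.le, ← mul_assoc,
        ← Real.rpow_add (by positivity), hxy, Real.rpow_neg (by positivity), Real.rpow_natCast]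
    calc _ = (γ ^ 2 * τ / (2 * Real.pi) * ((γ * τ) ^ k / k.factorial)) ^ 2 *
          (2 * Real.pi / γ) ^ 2 * ((2 * τ) ^ (-x) * (2 * (τ * (γ - 1))) ^ (-y)) *
          (Real.Gamma x * Real.Gamma y) := by ring
      _ = _ := by
        rw [e1]
        have hpi := Real.pi_ne_zero
        field_simp
        ring
  -- Each term of the expansion is the rank-one operator `f ↦ a k ⟨v k, f⟩ u k`.
  have hinner : ∀ k z, ((γ ^ 2 * τ / (2 * Real.pi) : ℝ) : ℂ) *
      ∫ ζ, f ζ * phaseTerm γ τ z ζ k ∂(wt (γ - 2)) =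
        (a k * inner ℂ (v k) F) * radMono γ k 0 τ z := by
    intro k z
    have e1 : inner ℂ (v k) F =
        ∫ ζ, f ζ * conj (radMono γ k (k * (γ - 2)) (τ * (γ - 1)) ζ) ∂(wt (γ - 2)) := by
      rw [inner_toLp, integral_powWeight measurable_norm ae_norm_pos,
        integral_powWeight measurable_norm ae_norm_pos]
      refine integral_congr_ae (ae_norm_pos.mono fun ζ hζ => ?_)
      have e2 : ‖ζ‖ ^ ((γ - 2) / 3) * ‖ζ‖ ^ (k * (γ - 2) + 2 * (γ - 2) / 3) =
          ‖ζ‖ ^ (γ - 2) * ‖ζ‖ ^ (k * (γ - 2)) := by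
        rw [← Real.rpow_add hζ, ← Real.rpow_add hζ]; congr 1; ring
      have e3 : (((‖ζ‖ ^ ((γ - 2) / 3) : ℝ) : ℂ) *
        ((‖ζ‖ ^ (k * (γ - 2) + 2 * (γ - 2) / 3) : ℝ) : ℂ)) =
          ((‖ζ‖ ^ (γ - 2) : ℝ) : ℂ) * ((‖ζ‖ ^ (k * (γ - 2)) : ℝ) : ℂ) := by exact_mod_cast e2
      simp only [radMono, map_mul, map_pow, conj_ofReal, ofReal_mul]
      linear_combination (conj ζ ^ k * (Real.exp (-(τ * (γ - 1)) * ‖ζ‖ ^ γ) : ℝ) * f ζ) * e3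
    rw [e1]
    have e2 : ∀ ζ, f ζ * phaseTerm γ τ z ζ k =
        ((((γ * τ) ^ k / k.factorial : ℝ) : ℂ) * radMono γ k 0 τ z) *
          (f ζ * conj (radMono γ k (k * (γ - 2)) (τ * (γ - 1)) ζ)) := fun ζ => by
      rw [phaseTerm]; ring
    simp only [e2]
    rw [integral_const_mul]
    simp only [a, ofReal_mul]
    ring
  have hsum : ∀ n, ((∑ k ∈ Finset.range n, (a k * inner ℂ (v k) F) • u k :
      Lp ℂ 2 (wt ((γ - 2) / 3))) : ℂ → ℂ) =ᵐ[wt ((γ - 2) / 3)] fun z =>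
        ∑ k ∈ Finset.range n, (a k * inner ℂ (v k) F) * radMono γ k 0 τ z := by
    intro n
    induction n with
    | zero =>
      simp only [Finset.range_zero, Finset.sum_empty]
      exact Lp.coeFn_zero _ _ _
    | succ n ih =>
      simp only [Finset.sum_range_succ]
      filter_upwards [ih, Lp.coeFn_add (∑ k ∈ Finset.range n, (a k * inner ℂ (v k) F) • u k)
        ((a n * inner ℂ (v n) F) • u n), Lp.coeFn_smul (a n * inner ℂ (v n) F) (u n),
        (memLp_radMono hγ n hτ (hqu n)).coeFn_toLp] with z h1 h2 h3 h4
      rw [h2, Pi.add_apply, h1, h3, Pi.smul_apply, h4, smul_eq_mul]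
  have hpartial : ∀ n, ∫⁻ z, ‖∑ k ∈ Finset.range n, (a k * inner ℂ (v k) F) *
      radMono γ k 0 τ z‖ₑ ^ 2 ∂(wt ((γ - 2) / 3)) ≤
        ENNReal.ofReal C * ∫⁻ z, ‖f z‖ₑ ^ 2 ∂(wt ((γ - 2) / 3)) := by
    intro n
    have h1 := norm_sum_rank_one_sq_le (u := u) (v := v)
      (fun k l hkl => inner_radMono_eq_zero hγ hkl hτ (hqu k) (hqu l))
      (fun k l hkl => inner_radMono_eq_zero hγ hkl hbv (hqv k) (hqv l)) hv0 hbound F n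
    have h2 := ENNReal.ofReal_le_ofReal h1
    have hC0 : 0 ≤ C := le_trans (by positivity) (hbound 0)
    rw [ENNReal.ofReal_mul hC0, norm_sq_toLp hf, ← Lp.toLp_coeFn (∑ k ∈ Finset.range n, _ • _)
      (Lp.memLp _), norm_sq_toLp] at h2
    refine le_trans (le_of_eq ?_) h2
    exact lintegral_congr_ae ((hsum n).mono fun z hz => by simp only [hz])
  have hlim : ∀ z, Tendsto (fun n => ∑ k ∈ Finset.range n, (a k * inner ℂ (v k) F) *
      radMono γ k 0 τ z) atTop (𝓝 (fiberOp γ τ f z)) := by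
    intro z
    have h := (hasSum_fiberOp hγ hτ hf z).tendsto_sum_nat
    simpa only [hinner] using h
  -- The partial sums converge pointwise and are bounded in `L²`, so Fatou's lemma passes the bound
  -- to the limit.
  calc ∫⁻ z, ‖fiberOp γ τ f z‖ₑ ^ 2 ∂(wt ((γ - 2) / 3))
      = ∫⁻ z, liminf (fun n => ‖∑ k ∈ Finset.range n, (a k * inner ℂ (v k) F) *
          radMono γ k 0 τ z‖ₑ ^ 2) atTop ∂(wt ((γ - 2) / 3)) := by
        refine lintegral_congr fun z => ?_
        exact (ENNReal.Tendsto.pow (hlim z).enorm).liminf_eq.symm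
    _ ≤ liminf (fun n => ∫⁻ z, ‖∑ k ∈ Finset.range n, (a k * inner ℂ (v k) F) *
          radMono γ k 0 τ z‖ₑ ^ 2 ∂(wt ((γ - 2) / 3))) atTop := by
        refine lintegral_liminf_le fun n => ?_
        have : ∀ k, Measurable (radMono γ k 0 τ) := fun k => measurable_radMono γ k 0 τ
        fun_prop
    _ ≤ _ := liminf_le_of_le (by isBoundedDefault) fun b hb => by
        obtain ⟨n, hn⟩ := hb.exists
        exact hn.trans (hpartial n)

/-! ### The fibre operators are projections -/

theorem phaseMajorant_le_one {γ τ : ℝ} (hγ : 1 < γ) (hτ : 0 ≤ τ) (z ζ : ℂ) :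
    phaseMajorant γ τ z ζ ≤ 1 := by
  rw [phaseMajorant, Real.exp_le_one_iff, neg_nonpos]
  exact mul_nonneg hτ (by linarith [young_rpow hγ (norm_nonneg ζ) (norm_nonneg z)])

theorem norm_phaseTerm_le {γ τ : ℝ} (hγ : 1 < γ) (hτ : 0 ≤ τ) (z ζ : ℂ) (k : ℕ) :
    ‖phaseTerm γ τ z ζ k‖ ≤ phaseMajorant γ τ z ζ :=
  le_hasSum (hasSum_norm_phaseTerm hγ hτ z ζ) k fun _ _ => norm_nonneg _

theorem measurable_phaseTerm_left (γ τ : ℝ) (η : ℂ) (k : ℕ) :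
    Measurable fun ζ => phaseTerm γ τ ζ η k := by
  have h := measurable_radMono γ k 0 τ
  unfold phaseTerm
  fun_prop

theorem measurable_phase_left (γ : ℝ) (ζ : ℂ) : Measurable fun z => phase γ z ζ := by
  unfold phase
  fun_prop

/-- Off the diagonal the angular integral vanishes. On it the integrand is `|ζ|^{lγ+γ-2}
e^{-γτ|ζ|^γ}`, whose Gamma argument is the integer `l + 1`; the resulting factorial cancels the
Taylor coefficient in `phaseTerm`. -/
theorem integral_radMono_mul_conj {γ τ : ℝ} (hγ : 1 < γ) (hτ : 0 < τ) (k l : ℕ) :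
    ∫ ζ, radMono γ l 0 τ ζ * conj (radMono γ k (k * (γ - 2)) (τ * (γ - 1)) ζ) ∂(wt (γ - 2)) =
      if l = k then ((2 * Real.pi / (γ ^ 2 * τ) * (k.factorial / (γ * τ) ^ k) : ℝ) : ℂ) else 0 := by
  rw [integral_powWeight measurable_norm ae_norm_pos]
  have hγ0 : 0 < γ := by linarith
  split_ifs with h
  · subst h
    have hq : -2 < (l : ℝ) * γ + γ - 2 := by
      have : (0 : ℝ) ≤ l := l.cast_nonneg
      nlinarith
    have h := Complex.integral_rpow_mul_exp_neg_mul_rpow hγ.le hq (by positivity : 0 < γ * τ)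
    have e1 : ((l : ℝ) * γ + γ - 2 + 2) / γ = l + 1 := by field_simp; ring
    rw [neg_div, e1, Real.Gamma_nat_eq_factorial, Real.rpow_neg (by positivity)] at h
    have e2 : (γ * τ) ^ ((l : ℝ) + 1) = (γ * τ) ^ (l + 1) := by exact_mod_cast Real.rpow_natCast _ (l + 1)
    rw [e2] at h
    have e3 : 2 * Real.pi / (γ ^ 2 * τ) * (l.factorial / (γ * τ) ^ l) =
        2 * Real.pi / γ * ((γ * τ) ^ (l + 1))⁻¹ * l.factorial := by
      rw [pow_succ]; field_simp; ring
    rw [e3, ← h, ← integral_complex_ofReal]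
    refine integral_congr_ae (ae_norm_pos.mono fun ζ hζ => ?_)
    have e4 : ‖ζ‖ ^ ((l : ℝ) * γ + γ - 2) =
        ‖ζ‖ ^ (γ - 2) * ((‖ζ‖ ^ l) ^ 2 * ‖ζ‖ ^ (l * (γ - 2))) := by
      have : (‖ζ‖ ^ l) ^ 2 = ‖ζ‖ ^ (2 * (l : ℝ)) := by
        rw [mul_comm, Real.rpow_mul hζ.le]; norm_cast
      rw [this, ← Real.rpow_add hζ, ← Real.rpow_add hζ]
      congr 1; ring
    have e5 : Real.exp (-(γ * τ) * ‖ζ‖ ^ γ) =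
        Real.exp (-τ * ‖ζ‖ ^ γ) * Real.exp (-(τ * (γ - 1)) * ‖ζ‖ ^ γ) := by
      rw [← Real.exp_add]; congr 1; ring
    have e6 : (((‖ζ‖ ^ l) ^ 2 : ℝ) : ℂ) = ζ ^ l * conj ζ ^ l := by
      rw [← mul_pow, mul_conj, Complex.normSq_eq_norm_sq]; push_cast; ring
    simp only
    rw [e4, e5, ofReal_mul, ofReal_mul, ofReal_mul, ofReal_mul, e6]
    simp only [radMono, map_mul, map_pow, conj_ofReal, Real.rpow_zero, one_mul, ofReal_mul]
    ring
  · rw [← integral_pow_mul_conj_pow_mul_radial h (fun r : ℝ =>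
      ((r ^ (γ - 2) * Real.exp (-τ * r ^ γ) *
        (r ^ (k * (γ - 2)) * Real.exp (-(τ * (γ - 1)) * r ^ γ)) : ℝ) : ℂ))]
    congr 1 with ζ
    simp only [radMono, map_mul, map_pow, conj_ofReal, Real.rpow_zero, one_mul, ofReal_mul]
    ring

theorem integral_phaseTerm_mul {γ τ : ℝ} (hγ : 1 < γ) (hτ : 0 < τ) (z η : ℂ) (k l : ℕ) :
    ∫ ζ, phaseTerm γ τ z ζ k * phaseTerm γ τ ζ η l ∂(wt (γ - 2)) =
      if l = k then ((2 * Real.pi / (γ ^ 2 * τ) : ℝ) : ℂ) * phaseTerm γ τ z η k else 0 := by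
  have e : ∀ ζ, phaseTerm γ τ z ζ k * phaseTerm γ τ ζ η l =
      ((((γ * τ) ^ k / k.factorial : ℝ) : ℂ) * radMono γ k 0 τ z *
        ((((γ * τ) ^ l / l.factorial : ℝ) : ℂ) *
          conj (radMono γ l (l * (γ - 2)) (τ * (γ - 1)) η))) *
      (radMono γ l 0 τ ζ * conj (radMono γ k (k * (γ - 2)) (τ * (γ - 1)) ζ)) := fun ζ => by
    rw [phaseTerm, phaseTerm]; ring
  simp only [e]
  rw [integral_const_mul, integral_radMono_mul_conj hγ hτ]
  split_ifs with h
  · subst h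
    have h1 : (γ : ℂ) ≠ 0 := by exact_mod_cast (by linarith : γ ≠ 0)
    have h2 : (τ : ℂ) ≠ 0 := by exact_mod_cast hτ.ne'
    have h3 : (l.factorial : ℂ) ≠ 0 := by exact_mod_cast l.factorial_ne_zero
    rw [phaseTerm]
    push_cast
    field_simp
  · simp

/-- The reproducing property of the fibre kernels. -/
theorem integral_exp_phase_mul_exp_phase {γ τ : ℝ} (hγ : 1 < γ) (hτ : 0 < τ) (z η : ℂ) :
    ∫ ζ, exp (-(τ * phase γ ζ η)) * exp (-(τ * phase γ z ζ)) ∂(wt (γ - 2)) =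
      ((2 * Real.pi / (γ ^ 2 * τ) : ℝ) : ℂ) * exp (-(τ * phase γ z η)) := by
  have hi := integrable_phaseMajorant hγ hτ z
  have hmaj0 : ∀ z ζ, 0 ≤ phaseMajorant γ τ z ζ := fun _ _ => (Real.exp_pos _).le
  have hm1 : Measurable fun ζ => exp (-(τ * phase γ ζ η)) := by
    have := measurable_phase_left γ η
    fun_prop
  -- The kernel in `(z, ζ)` is expanded first, then the one in `(ζ, η)`; of the double series only
  -- the diagonal survives, and it sums to the kernel in `(z, η)`.
  have h1 := hasSum_integral_mul_phaseTerm hγ hτ (f := fun ζ => exp (-(τ * phase γ ζ η))) z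
    hm1.aestronglyMeasurable (by
      refine hi.mono' ?_ (Eventually.of_forall fun ζ => ?_)
      · exact (hm1.aestronglyMeasurable.norm).mul hi.1
      · rw [Real.norm_of_nonneg (mul_nonneg (norm_nonneg _) (hmaj0 _ _))]
        exact mul_le_of_le_one_left (hmaj0 _ _) (norm_exp_neg_mul_phase_le hγ hτ.le ζ η))
  have h2 : ∀ k, ∫ ζ, exp (-(τ * phase γ ζ η)) * phaseTerm γ τ z ζ k ∂(wt (γ - 2)) =
      ((2 * Real.pi / (γ ^ 2 * τ) : ℝ) : ℂ) * phaseTerm γ τ z η k := by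
    intro k
    have hs : ∀ ζ, HasSum (fun l => ‖phaseTerm γ τ z ζ k‖ * ‖phaseTerm γ τ ζ η l‖)
        (‖phaseTerm γ τ z ζ k‖ * phaseMajorant γ τ ζ η) := fun ζ =>
      (hasSum_norm_phaseTerm hγ hτ.le ζ η).mul_left _
    have hmk := measurable_phaseTerm γ τ z k
    have h3 : HasSum (fun l => ∫ ζ, phaseTerm γ τ z ζ k * phaseTerm γ τ ζ η l ∂(wt (γ - 2)))
        (∫ ζ, phaseTerm γ τ z ζ k * exp (-(τ * phase γ ζ η)) ∂(wt (γ - 2))) := by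
      refine hasSum_integral_of_dominated_convergence
        (fun l ζ => ‖phaseTerm γ τ z ζ k‖ * ‖phaseTerm γ τ ζ η l‖)
        (fun l => (hmk.mul (measurable_phaseTerm_left γ τ η l)).aestronglyMeasurable)
        (fun l => Eventually.of_forall fun ζ => (norm_mul _ _).le)
        (Eventually.of_forall fun ζ => (hs ζ).summable) ?_
        (Eventually.of_forall fun ζ => (hasSum_phaseTerm γ τ ζ η).mul_left _)
      simp only [fun ζ => (hs ζ).tsum_eq]
      refine hi.mono' (Measurable.aestronglyMeasurable ?_) (Eventually.of_forall fun ζ => ?_)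
      · unfold phaseMajorant; fun_prop
      · rw [Real.norm_of_nonneg (mul_nonneg (norm_nonneg _) (hmaj0 _ _))]
        calc ‖phaseTerm γ τ z ζ k‖ * phaseMajorant γ τ ζ η ≤ phaseMajorant γ τ z ζ * 1 :=
              mul_le_mul (norm_phaseTerm_le hγ hτ.le z ζ k) (phaseMajorant_le_one hγ hτ.le ζ η)
                (hmaj0 _ _) (hmaj0 _ _)
          _ = _ := mul_one _
    simp only [integral_phaseTerm_mul hγ hτ] at h3
    simp only [mul_comm (exp (-(τ * phase γ _ η)))]
    exact h3.unique (hasSum_ite_eq k _)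
  simp only [h2] at h1
  exact h1.unique ((hasSum_phaseTerm γ τ z η).mul_left _)

/-- After Fubini this is the reproducing property of the kernels, the constant in `fiberOp` being
the inverse of `2π / (γ²τ)`. Integrability of `f` makes the double integral absolutely convergent:
one kernel is bounded by `1`, the other by the integrable majorant. -/
theorem fiberOp_fiberOp {γ τ : ℝ} (hγ : 1 < γ) (hτ : 0 < τ) {f : ℂ → ℂ}
    (hf : Integrable f (wt (γ - 2))) (z : ℂ) :
    fiberOp γ τ (fiberOp γ τ f) z = fiberOp γ τ f z := by
  set c : ℂ := ((γ ^ 2 * τ / (2 * Real.pi) : ℝ) : ℂ) with hc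
  have hcc : c * ((2 * Real.pi / (γ ^ 2 * τ) : ℝ) : ℂ) = 1 := by
    have h1 : γ ≠ 0 := by linarith
    have h2 := Real.pi_ne_zero
    rw [hc, ← ofReal_mul, ← ofReal_one]
    congr 1
    field_simp
  have hint : Integrable (Function.uncurry fun ζ η =>
      f η * exp (-(τ * phase γ ζ η)) * exp (-(τ * phase γ z ζ)))
        ((wt (γ - 2)).prod (wt (γ - 2))) := by
    have hb := (integrable_phaseMajorant hγ hτ z).mul_prod hf.norm
    have hph := measurable_phase γ
    have hphz := measurable_phase_right γ z
    refine hb.mono' ?_ (Eventually.of_forall fun p => ?_)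
    · refine (hf.1.comp_snd.mul ?_).mul ?_
      · exact Measurable.aestronglyMeasurable (by fun_prop)
      · exact Measurable.aestronglyMeasurable (by fun_prop)
    · simp only [Function.uncurry, norm_mul]
      have h1 := norm_exp_neg_mul_phase_le hγ hτ.le p.1 p.2
      have h2 : ‖exp (-(τ * phase γ z p.1))‖ ≤ phaseMajorant γ τ z p.1 := by
        rw [norm_exp, phaseMajorant, Real.exp_le_exp]
        simpa using mul_le_mul_of_nonneg_left (le_re_phase hγ z p.1) hτ.le
      calc ‖f p.2‖ * ‖exp (-(τ * phase γ p.1 p.2))‖ * ‖exp (-(τ * phase γ z p.1))‖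
          ≤ ‖f p.2‖ * 1 * phaseMajorant γ τ z p.1 := by gcongr
        _ = _ := by ring
  calc fiberOp γ τ (fiberOp γ τ f) z
      = c * (c * ∫ ζ, ∫ η, f η * exp (-(τ * phase γ ζ η)) * exp (-(τ * phase γ z ζ))
          ∂(wt (γ - 2)) ∂(wt (γ - 2))) := by
        rw [fiberOp, ← hc]
        congr 1
        rw [← integral_const_mul]
        refine integral_congr_ae (Eventually.of_forall fun ζ => ?_)
        simp only
        rw [fiberOp, ← hc, integral_mul_const, mul_assoc]
    _ = c * (c * ∫ η, ∫ ζ, f η * exp (-(τ * phase γ ζ η)) * exp (-(τ * phase γ z ζ))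
          ∂(wt (γ - 2)) ∂(wt (γ - 2))) := by rw [integral_integral_swap hint]
    _ = c * (c * ∫ η, ((2 * Real.pi / (γ ^ 2 * τ) : ℝ) : ℂ) *
          (f η * exp (-(τ * phase γ z η))) ∂(wt (γ - 2))) := by
        congr 2
        refine integral_congr_ae (Eventually.of_forall fun η => ?_)
        simp only [mul_assoc (f η)]
        rw [integral_const_mul, integral_exp_phase_mul_exp_phase hγ hτ]
        ring
    _ = fiberOp γ τ f z := by
        rw [integral_const_mul, ← mul_assoc c ((2 * Real.pi / (γ ^ 2 * τ) : ℝ) : ℂ), hcc, one_mul,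
          fiberOp]

/-! ### The Leray integral in the coordinates of `ℂ × ℝ` -/

/-- The Leray kernel in coordinates, at height `ε` above the hypersurface. -/
def coordKernel (γ ε : ℝ) (p q : ℂ × ℝ) : ℂ :=
  1 / ((phase γ p.1 q.1 + ε - I * p.2) + I * q.2) ^ 2

/-- The Leray integral in coordinates, at height `ε` above the hypersurface. -/
def coordLeray (γ ε : ℝ) (f : ℂ × ℝ → ℂ) (p : ℂ × ℝ) : ℂ :=
  ((γ ^ 2 / (4 * Real.pi ^ 2) : ℝ) : ℂ) * ∫ q, f q * coordKernel γ ε p q ∂(wtProd (γ - 2))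

theorem re_phase_add (γ ε x : ℝ) (z ζ : ℂ) :
    (phase γ z ζ + ε - I * x : ℂ).re = (phase γ z ζ).re + ε := by simp

theorem re_phase_add_pos {γ ε : ℝ} (hγ : 1 < γ) (hε : 0 < ε) (x : ℝ) (z ζ : ℂ) :
    0 < (phase γ z ζ + ε - I * x : ℂ).re := by
  rw [re_phase_add]; linarith [re_phase_nonneg hγ z ζ]

theorem measurable_coordKernel (γ ε : ℝ) :
    Measurable fun r : (ℂ × ℝ) × (ℂ × ℝ) => coordKernel γ ε r.1 r.2 := by
  have := measurable_phase γ
  unfold coordKernel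
  fun_prop

theorem measurable_coordKernel_right (γ ε : ℝ) (p : ℂ × ℝ) : Measurable (coordKernel γ ε p) := by
  have := measurable_phase_right γ p.1
  unfold coordKernel
  fun_prop

theorem memLp_coordKernel {γ ε : ℝ} (hγ : 1 < γ) (hε : 0 < ε) (p : ℂ × ℝ) :
    MemLp (coordKernel γ ε p) 2 (wtProd (5 * (γ - 2) / 3)) := by
  have hm := measurable_coordKernel_right γ ε p
  rw [memLp_two_iff hm.aestronglyMeasurable, wtProd_eq_prod, lintegral_prod _ (by fun_prop)]
  refine lt_of_le_of_lt (lintegral_mono fun ζ => ?_) (lintegral_inv_re_phase_lt_top hγ p.1 hε)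
  have h := lintegral_enorm_sq_one_div_sq_le (re_phase_add_pos hγ hε p.2 p.1 ζ)
  rw [re_phase_add] at h
  exact h

theorem integrable_mul_coordKernel {γ ε : ℝ} (hγ : 1 < γ) (hε : 0 < ε) {f : ℂ × ℝ → ℂ}
    (hf : MemLp f 2 (wtProd ((γ - 2) / 3))) (p : ℂ × ℝ) :
    Integrable (fun q => f q * coordKernel γ ε p q) (wtProd (γ - 2)) :=
  integrable_mul_powWeight (by fun_prop) ae_norm_fst_pos (by ring) hf (memLp_coordKernel hγ hε p)

theorem stronglyMeasurable_coordLeray (γ ε : ℝ) {f : ℂ × ℝ → ℂ} (hf : StronglyMeasurable f) :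
    StronglyMeasurable (coordLeray γ ε f) := by
  have h : StronglyMeasurable fun r : (ℂ × ℝ) × (ℂ × ℝ) => f r.2 * coordKernel γ ε r.1 r.2 :=
    (hf.comp_measurable measurable_snd).mul (measurable_coordKernel γ ε).stronglyMeasurable
  exact (h.integral_prod_right (ν := wtProd (γ - 2))).const_mul _

theorem fourierInv_eq_integral_exp (g : ℝ → ℂ) (x : ℝ) :
    𝓕⁻ g x = ∫ ξ : ℝ, exp (2 * Real.pi * I * ξ * x) * g ξ := by
  rw [Real.fourierInv_eq']
  congr 1 with ξ
  simp only [smul_eq_mul, Real.inner_apply]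
  congr 2
  push_cast
  ring

theorem fourier_eq_integral_exp (g : ℝ → ℂ) (ξ : ℝ) :
    𝓕 g ξ = ∫ t : ℝ, g t * exp (-(2 * Real.pi * I * ξ * t)) := by
  rw [Real.fourier_real_eq_integral_exp_smul]
  congr 1 with t
  simp only [smul_eq_mul]
  rw [mul_comm]
  congr 2
  push_cast
  ring

/-- The partial Fourier transform in the real variable. -/
def partialFourier (f : ℂ × ℝ → ℂ) (ζ : ℂ) (ξ : ℝ) : ℂ := 𝓕 (fun t => f (ζ, t)) ξ

/-- The fibre operators applied to the partial Fourier transform. -/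
def freqPart (γ : ℝ) (f : ℂ × ℝ → ℂ) (z : ℂ) (ξ : ℝ) : ℂ :=
  fiberOp γ (2 * Real.pi * ξ) (fun ζ => partialFourier f ζ ξ) z

/-- The partial Fourier transform of the Leray integral at height `ε`. -/
def freqCut (γ ε : ℝ) (f : ℂ × ℝ → ℂ) (z : ℂ) (ξ : ℝ) : ℂ :=
  (Set.Ioi (0 : ℝ)).indicator (fun ξ => exp (-(2 * Real.pi * ε * ξ)) * freqPart γ f z ξ) ξ

theorem stronglyMeasurable_partialFourier {f : ℂ × ℝ → ℂ} (hf : StronglyMeasurable f) :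
    StronglyMeasurable fun p : ℂ × ℝ => partialFourier f p.1 p.2 := by
  have h : StronglyMeasurable fun r : (ℂ × ℝ) × ℝ =>
      f (r.1.1, r.2) * exp (-(2 * Real.pi * I * r.1.2 * r.2)) :=
    (hf.comp_measurable (by fun_prop)).mul (Measurable.stronglyMeasurable (by fun_prop))
  simp only [partialFourier, fourier_eq_integral_exp]
  exact h.integral_prod_right (ν := volume)

theorem stronglyMeasurable_freqPart (γ : ℝ) {f : ℂ × ℝ → ℂ} (hf : StronglyMeasurable f) :
    StronglyMeasurable fun p : ℂ × ℝ => freqPart γ f p.1 p.2 := by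
  have hph := measurable_phase γ
  have h : StronglyMeasurable fun r : (ℂ × ℝ) × ℂ => partialFourier f r.2 r.1.2 *
      exp (-((2 * Real.pi * r.1.2 : ℝ) * phase γ r.1.1 r.2)) :=
    ((stronglyMeasurable_partialFourier hf).comp_measurable
      (g := fun r : (ℂ × ℝ) × ℂ => (r.2, r.1.2)) (by fun_prop)).mul
      (Measurable.stronglyMeasurable (by fun_prop))
  exact (Measurable.stronglyMeasurable (by fun_prop)).mul
    (h.integral_prod_right (ν := wt (γ - 2)))

theorem stronglyMeasurable_freqCut (γ ε : ℝ) {f : ℂ × ℝ → ℂ} (hf : StronglyMeasurable f) :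
    StronglyMeasurable fun p : ℂ × ℝ => freqCut γ ε f p.1 p.2 := by
  have h : StronglyMeasurable fun p : ℂ × ℝ =>
      exp (-(2 * Real.pi * ε * p.2)) * freqPart γ f p.1 p.2 :=
    (Measurable.stronglyMeasurable (by fun_prop)).mul (stronglyMeasurable_freqPart γ hf)
  exact h.indicator (measurable_snd measurableSet_Ioi)

/-! ### The Leray integral of an integrable function on the Fourier side -/

section Nice

variable {γ : ℝ} {f : ℂ × ℝ → ℂ}

theorem norm_partialFourier_le (f : ℂ × ℝ → ℂ) (ζ : ℂ) (ξ : ℝ) :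
    ‖partialFourier f ζ ξ‖ ≤ ∫ t, ‖f (ζ, t)‖ :=
  VectorFourier.norm_fourierIntegral_le_integral_norm _ _ _ _ _

theorem integrable_partialFourier (hfm : StronglyMeasurable f)
    (hf1 : Integrable f (wtProd (γ - 2))) (ξ : ℝ) :
    Integrable (fun ζ => partialFourier f ζ ξ) (wt (γ - 2)) := by
  rw [wtProd_eq_prod] at hf1
  exact hf1.integral_norm_prod_left.mono'
    ((stronglyMeasurable_partialFourier hfm).comp_measurable
      (g := fun ζ : ℂ => (ζ, ξ)) (by fun_prop)).aestronglyMeasurable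
    (Eventually.of_forall fun ζ => norm_partialFourier_le f ζ ξ)

theorem norm_freqPart_le (hγ : 1 < γ) (hf1 : Integrable f (wtProd (γ - 2))) (z : ℂ) {ξ : ℝ} (hξ : 0 < ξ) :
    ‖freqPart γ f z ξ‖ ≤ γ ^ 2 * (∫ q, ‖f q‖ ∂(wtProd (γ - 2))) * ξ := by
  have h1 : ‖∫ ζ, partialFourier f ζ ξ * exp (-((2 * Real.pi * ξ : ℝ) * phase γ z ζ))
      ∂(wt (γ - 2))‖ ≤ ∫ q, ‖f q‖ ∂(wtProd (γ - 2)) := by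
    rw [wtProd_eq_prod] at hf1 ⊢
    rw [integral_prod _ hf1.norm]
    refine norm_integral_le_of_norm_le hf1.integral_norm_prod_left
      (Eventually.of_forall fun ζ => ?_)
    rw [norm_mul]
    exact (mul_le_of_le_one_right (norm_nonneg _)
      (norm_exp_neg_mul_phase_le hγ (by positivity) z ζ)).trans (norm_partialFourier_le f ζ ξ)
  rw [freqPart, fiberOp, norm_mul, norm_real, Real.norm_of_nonneg (by positivity)]
  have e : γ ^ 2 * (2 * Real.pi * ξ) / (2 * Real.pi) = γ ^ 2 * ξ := by
    have := Real.pi_ne_zero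
    field_simp
  rw [e]
  calc _ ≤ γ ^ 2 * ξ * ∫ q, ‖f q‖ ∂(wtProd (γ - 2)) := by gcongr
    _ = _ := by ring

/-- The fibre operator grows at most linearly in `ξ` on integrable data, so at positive height the
cut-off transform is dominated by a multiple of `laplaceFun ε`, which lies in `L¹ ∩ L²`. -/
theorem norm_freqCut_le {ε : ℝ} (hγ : 1 < γ)
    (hf1 : Integrable f (wtProd (γ - 2))) (z : ℂ) (ξ : ℝ) :
    ‖freqCut γ ε f z ξ‖ ≤ γ ^ 2 * (∫ q, ‖f q‖ ∂(wtProd (γ - 2))) * ‖laplaceFun ε ξ‖ := by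
  by_cases hξ : 0 < ξ
  · have h := norm_freqPart_le hγ hf1 z hξ
    simp only [freqCut, laplaceFun, Set.mem_Ioi, hξ, Set.indicator_of_mem, norm_mul, norm_exp,
      norm_real, Real.norm_of_nonneg hξ.le]
    have e : (-(2 * Real.pi * ε * ξ) : ℂ).re = (-(2 * Real.pi * ξ * ε) : ℂ).re := by
      congr 1; ring
    rw [e]
    calc _ ≤ Real.exp (-(2 * Real.pi * ξ * ε) : ℂ).re *
          (γ ^ 2 * (∫ q, ‖f q‖ ∂(wtProd (γ - 2))) * ξ) := by gcongr
      _ = _ := by ring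
  · simp [freqCut, laplaceFun, hξ]

theorem memLp_laplaceFun {a : ℂ} (ha : 0 < a.re) : MemLp (laplaceFun a) 2 := by
  have hpi : ((2 * Real.pi) ^ 2 : ℂ) ≠ 0 :=
    pow_ne_zero _ (mul_ne_zero two_ne_zero (by exact_mod_cast Real.pi_ne_zero))
  have hc := continuous_laplaceFun a
  have h : MemLp (fun ξ => (2 * Real.pi) ^ 2 * laplaceFun a ξ) 2 :=
    (memLp_two_iff (Continuous.aestronglyMeasurable (by fun_prop))).2
      ((lintegral_enorm_sq_laplaceFun_le ha).trans_lt ENNReal.ofReal_lt_top)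
  have h2 := h.const_mul ((2 * Real.pi) ^ 2 : ℂ)⁻¹
  simpa only [inv_mul_cancel_left₀ hpi] using h2

theorem aestronglyMeasurable_freqCut (γ ε : ℝ) (hfm : StronglyMeasurable f) (z : ℂ) :
    AEStronglyMeasurable (freqCut γ ε f z) :=
  ((stronglyMeasurable_freqCut γ ε hfm).comp_measurable
    (g := fun ξ : ℝ => (z, ξ)) (by fun_prop)).aestronglyMeasurable

theorem integrable_freqCut {ε : ℝ} (hγ : 1 < γ) (hε : 0 < ε) (hfm : StronglyMeasurable f)
    (hf1 : Integrable f (wtProd (γ - 2))) (z : ℂ) : Integrable (freqCut γ ε f z) :=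
  ((integrable_laplaceFun (a := ε) (by simpa using hε)).norm.const_mul _).mono'
    (aestronglyMeasurable_freqCut γ ε hfm z)
    (Eventually.of_forall fun ξ => norm_freqCut_le hγ hf1 z ξ)

theorem memLp_freqCut {ε : ℝ} (hγ : 1 < γ) (hε : 0 < ε) (hfm : StronglyMeasurable f)
    (hf1 : Integrable f (wtProd (γ - 2))) (z : ℂ) : MemLp (freqCut γ ε f z) 2 :=
  MemLp.of_le_mul (memLp_laplaceFun (a := ε) (by simpa using hε))
    (aestronglyMeasurable_freqCut γ ε hfm z)
    (Eventually.of_forall fun ξ => norm_freqCut_le hγ hf1 z ξ)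

/-- The inverse square in the kernel is a Laplace integral over `ξ > 0`. Exchanging the integrals,
the integral in `t` produces the partial Fourier transform, the phase produces the fibre operator,
and the height produces `e^{-2πεξ}`. -/
theorem coordLeray_eq_fourierInv {ε : ℝ} (hγ : 1 < γ) (hε : 0 < ε)
    (hf1 : Integrable f (wtProd (γ - 2))) (z : ℂ) (x : ℝ) :
    coordLeray γ ε f (z, x) = 𝓕⁻ (freqCut γ ε f z) x := by
  have hpi : (Real.pi : ℂ) ≠ 0 := by exact_mod_cast Real.pi_ne_zero
  have hker : ∀ q : ℂ × ℝ, coordKernel γ ε (z, x) q = (2 * Real.pi) ^ 2 *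
      ∫ ξ in Set.Ioi (0 : ℝ), (ξ : ℂ) *
        exp (-(2 * Real.pi * ξ * ((phase γ z q.1 + ε - I * x) + I * q.2))) := by
    intro q
    rw [integral_mul_exp_neg (by simpa using re_phase_add_pos hγ hε x z q.1), coordKernel]
    field_simp
  set E : ℂ × ℝ → ℝ → ℂ := fun q ξ => (ξ : ℂ) *
        exp (-(2 * Real.pi * ξ * ((phase γ z q.1 + ε - I * x) + I * q.2))) with hE
  have hph := measurable_phase_right γ z
  have hEm : Measurable (Function.uncurry E) := by
    simp only [hE, Function.uncurry_def]; fun_prop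
  have hEn : ∀ q, ∀ ξ ∈ Set.Ioi (0 : ℝ), ‖E q ξ‖ ≤ ‖laplaceFun ε ξ‖ := by
    intro q ξ hξ
    have hξ' : 0 < ξ := hξ
    simp only [hE, laplaceFun, hξ, Set.indicator_of_mem, norm_mul, norm_exp]
    refine mul_le_mul_of_nonneg_left (Real.exp_le_exp.2 ?_) (norm_nonneg _)
    have := re_phase_nonneg hγ z q.1
    have h2 : 0 ≤ 2 * Real.pi * ξ * (phase γ z q.1).re := by positivity
    simp
    nlinarith
  have hint : Integrable (Function.uncurry fun (q : ℂ × ℝ) (ξ : ℝ) => f q * E q ξ)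
      ((wtProd (γ - 2)).prod (volume.restrict (Set.Ioi 0))) := by
    have hb := hf1.norm.mul_prod (integrable_laplaceFun (a := ε) (by simpa using hε)).norm.integrableOn
      (ν := volume.restrict (Set.Ioi 0))
    refine hb.mono' ?_ ?_
    · exact (hf1.1.comp_fst).mul hEm.aestronglyMeasurable
    · have h0 : ∀ᵐ r : (ℂ × ℝ) × ℝ ∂((wtProd (γ - 2)).prod (volume.restrict (Set.Ioi 0))),
          r.2 ∈ Set.Ioi (0 : ℝ) :=
        Measure.quasiMeasurePreserving_snd.ae (ae_restrict_mem measurableSet_Ioi)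
      filter_upwards [h0] with r hr
      simp only [Function.uncurry, norm_mul]
      gcongr
      exact hEn _ _ hr
  -- The constants agree because `γ²/(4π²) · (2π)² ξ = γ² (2πξ)/(2π)`, which is the prefactor of
  -- `fiberOp` at `τ = 2πξ`.
  have hinner : ∀ ξ ∈ Set.Ioi (0 : ℝ), ((γ ^ 2 / (4 * Real.pi ^ 2) : ℝ) : ℂ) * (2 * Real.pi) ^ 2 *
      ∫ q, f q * E q ξ ∂(wtProd (γ - 2)) =
        exp (2 * Real.pi * I * ξ * x) * (exp (-(2 * Real.pi * ε * ξ)) * freqPart γ f z ξ) := by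
    intro ξ hξ
    have hi : Integrable (fun q => f q * E q ξ) ((wt (γ - 2)).prod volume) := by
      rw [← wtProd_eq_prod]
      refine (hf1.norm.mul_const ‖laplaceFun ε ξ‖).mono' (hf1.1.mul ?_)
        (Eventually.of_forall fun q => ?_)
      · exact (hEm.comp (measurable_id.prodMk measurable_const)).aestronglyMeasurable
      · rw [norm_mul]; gcongr; exact hEn q ξ hξ
    rw [wtProd_eq_prod, integral_prod _ hi, freqPart, fiberOp]
    have e1 : ∀ ζ, ∫ t, f (ζ, t) * E (ζ, t) ξ = (ξ * exp (2 * Real.pi * I * ξ * x) *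
        exp (-(2 * Real.pi * ε * ξ))) *
          (partialFourier f ζ ξ * exp (-((2 * Real.pi * ξ : ℝ) * phase γ z ζ))) := by
      intro ζ
      rw [partialFourier, fourier_eq_integral_exp, ← integral_mul_const, ← integral_const_mul]
      congr 1 with t
      have : exp (-(2 * Real.pi * ξ * ((phase γ z ζ + ε - I * x) + I * t))) =
          exp (2 * Real.pi * I * ξ * x) * exp (-(2 * Real.pi * ε * ξ)) *
            exp (-(2 * Real.pi * I * ξ * t)) * exp (-((2 * Real.pi * ξ : ℝ) * phase γ z ζ)) := by
        rw [← Complex.exp_add, ← Complex.exp_add, ← Complex.exp_add]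
        congr 1
        push_cast
        ring
      simp only [hE, this]
      ring
    simp only [e1]
    rw [integral_const_mul]
    push_cast
    field_simp
    ring
  rw [fourierInv_eq_integral_exp]
  have e2 : ∀ ξ : ℝ, exp (2 * Real.pi * I * ξ * x) * freqCut γ ε f z ξ =
      (Set.Ioi (0 : ℝ)).indicator (fun ξ : ℝ => exp (2 * Real.pi * I * ξ * x) *
        (exp (-(2 * Real.pi * ε * ξ)) * freqPart γ f z ξ)) ξ := by
    intro ξ
    by_cases h : 0 < ξ <;> simp [freqCut, h]
  simp only [e2]
  rw [integral_indicator measurableSet_Ioi, ← setIntegral_congr_fun measurableSet_Ioi hinner,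
    integral_const_mul, ← integral_integral_swap hint, coordLeray, mul_assoc]
  congr 1
  rw [← integral_const_mul]
  refine integral_congr_ae (Eventually.of_forall fun q => ?_)
  simp only
  rw [integral_const_mul, hker]
  ring

end Nice

/-! ### `L²` estimates by Plancherel's theorem in the real variable -/

section Nice

variable {γ : ℝ} {f : ℂ × ℝ → ℂ}

theorem ae_integrable_section {e : ℝ} (hf1 : Integrable f (wtProd e)) :
    ∀ᵐ ζ : ℂ, Integrable fun t => f (ζ, t) := by
  rw [wtProd_eq_prod] at hf1
  exact (absolutelyContinuous_powWeight measurable_norm ae_norm_pos e).ae_le hf1.prod_right_ae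

theorem lintegral_wtProd (e : ℝ) {g : ℂ × ℝ → ENNReal} (hg : Measurable g) :
    ∫⁻ p, g p ∂(wtProd e) = ∫⁻ z, (∫⁻ x : ℝ, g (z, x)) ∂(wt e) := by
  rw [wtProd_eq_prod, lintegral_prod _ hg.aemeasurable]

theorem lintegral_wtProd_symm (e : ℝ) {g : ℂ × ℝ → ENNReal} (hg : Measurable g) :
    ∫⁻ p, g p ∂(wtProd e) = ∫⁻ x : ℝ, ∫⁻ z, g (z, x) ∂(wt e) := by
  rw [wtProd_eq_prod, lintegral_prod_symm _ hg.aemeasurable]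

theorem ae_memLp_section (hfm : StronglyMeasurable f) {e : ℝ} (hf2 : MemLp f 2 (wtProd e)) :
    ∀ᵐ ζ : ℂ, MemLp (fun t => f (ζ, t)) 2 := by
  have h := (memLp_two_iff hf2.1).1 hf2
  have hm := hfm.measurable
  rw [lintegral_wtProd e (by fun_prop)] at h
  have h2 := ae_lt_top (Measurable.lintegral_prod_right' (f := fun p : ℂ × ℝ => ‖f p‖ₑ ^ 2)
    (by fun_prop)) h.ne
  have h3 := (absolutelyContinuous_powWeight measurable_norm ae_norm_pos e).ae_le h2
  filter_upwards [h3] with ζ hζ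
  exact (memLp_two_iff (hfm.comp_measurable
    (g := fun t : ℝ => (ζ, t)) (by fun_prop)).aestronglyMeasurable).2 hζ

theorem lintegral_partialFourier (hfm : StronglyMeasurable f) {e e' : ℝ}
    (hf1 : Integrable f (wtProd e')) (hf2 : MemLp f 2 (wtProd e)) :
    ∫⁻ p, ‖partialFourier f p.1 p.2‖ₑ ^ 2 ∂(wtProd e) = ∫⁻ p, ‖f p‖ₑ ^ 2 ∂(wtProd e) := by
  have hm := hfm.measurable
  have hm' := (stronglyMeasurable_partialFourier hfm).measurable
  rw [lintegral_wtProd e (by fun_prop), lintegral_wtProd e (by fun_prop)]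
  refine lintegral_congr_ae ((powWeight_absolutelyContinuous e).ae_le ?_)
  filter_upwards [ae_integrable_section hf1, ae_memLp_section hfm hf2] with ζ h1 h2
  exact lintegral_enorm_sq_fourier h1 h2

/-- Plancherel makes almost every frequency slice of the transform square integrable; the fibre
bound holds on each slice with the same `C`, and integrating over `ξ` keeps it. -/
theorem lintegral_freqPart_le {C : ENNReal} (hC : ∀ τ : ℝ, 0 < τ → ∀ f : ℂ → ℂ,
      MemLp f 2 (wt ((γ - 2) / 3)) → ∫⁻ z, ‖fiberOp γ τ f z‖ₑ ^ 2 ∂(wt ((γ - 2) / 3)) ≤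
        C * ∫⁻ z, ‖f z‖ₑ ^ 2 ∂(wt ((γ - 2) / 3))) (hfm : StronglyMeasurable f)
    (hf1 : Integrable f (wtProd (γ - 2))) (hf2 : MemLp f 2 (wtProd ((γ - 2) / 3))) :
    ∫⁻ ξ in Set.Ioi (0 : ℝ), ∫⁻ z, ‖freqPart γ f z ξ‖ₑ ^ 2 ∂(wt ((γ - 2) / 3)) ≤
      C * ∫⁻ p, ‖f p‖ₑ ^ 2 ∂(wtProd ((γ - 2) / 3)) := by
  have hm' := (stronglyMeasurable_partialFourier hfm).measurable
  have hfin := (memLp_two_iff hf2.1).1 hf2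
  rw [← lintegral_partialFourier hfm hf1 hf2, lintegral_wtProd_symm _ (by fun_prop)] at hfin
  rw [← lintegral_partialFourier hfm hf1 hf2, lintegral_wtProd_symm _ (by fun_prop),
    ← lintegral_const_mul _ (Measurable.lintegral_prod_left'
      (f := fun p : ℂ × ℝ => ‖partialFourier f p.1 p.2‖ₑ ^ 2) (by fun_prop))]
  refine le_trans ?_ (setLIntegral_le_lintegral (Set.Ioi 0) _)
  refine lintegral_mono_ae ?_
  have hae := ae_lt_top (Measurable.lintegral_prod_left'
      (f := fun p : ℂ × ℝ => ‖partialFourier f p.1 p.2‖ₑ ^ 2) (by fun_prop)) hfin.ne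
  filter_upwards [ae_restrict_of_ae hae, ae_restrict_mem measurableSet_Ioi] with ξ h1 h2
  have hξ : 0 < ξ := h2
  refine hC (2 * Real.pi * ξ) (by positivity) _ ((memLp_two_iff ?_).2 h1)
  exact ((stronglyMeasurable_partialFourier hfm).comp_measurable
      (g := fun ζ : ℂ => (ζ, ξ)) (by fun_prop)).aestronglyMeasurable

theorem measurable_lintegral_freqPart (γ e : ℝ) (hfm : StronglyMeasurable f) :
    Measurable fun ξ : ℝ => ∫⁻ z, ‖freqPart γ f z ξ‖ₑ ^ 2 ∂(wt e) := by
  have hm := (stronglyMeasurable_freqPart γ hfm).measurable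
  exact Measurable.lintegral_prod_left' (f := fun p : ℂ × ℝ => ‖freqPart γ f p.1 p.2‖ₑ ^ 2)
    (by fun_prop)

theorem enorm_exp_neg_le_one {ε ξ : ℝ} (hε : 0 ≤ ε) (hξ : 0 ≤ ξ) :
    ‖exp (-(2 * Real.pi * ε * ξ))‖ₑ ≤ 1 := by
  have h : ‖exp (-(2 * Real.pi * ε * ξ))‖ ≤ 1 := by
    rw [norm_exp, Real.exp_le_one_iff]
    have : 0 ≤ 2 * Real.pi * ε * ξ := by positivity
    simpa using this
  rw [← ofReal_norm]
  exact ENNReal.ofReal_le_one.2 h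

theorem lintegral_coordLeray {ε e : ℝ} (hγ : 1 < γ) (hε : 0 < ε) (hfm : StronglyMeasurable f)
    (hf1 : Integrable f (wtProd (γ - 2))) :
    ∫⁻ p, ‖coordLeray γ ε f p‖ₑ ^ 2 ∂(wtProd e) =
      ∫⁻ p, ‖freqCut γ ε f p.1 p.2‖ₑ ^ 2 ∂(wtProd e) := by
  have hm := (stronglyMeasurable_coordLeray γ ε hfm).measurable
  have hm' := (stronglyMeasurable_freqCut γ ε hfm).measurable
  rw [lintegral_wtProd e (by fun_prop), lintegral_wtProd e (by fun_prop)]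
  refine lintegral_congr fun z => ?_
  simp only [coordLeray_eq_fourierInv hγ hε hf1]
  exact lintegral_enorm_sq_fourierInv (integrable_freqCut hγ hε hfm hf1 z)
    (memLp_freqCut hγ hε hfm hf1 z)

theorem lintegral_freqCut_le {C : ENNReal} (hC : ∀ τ : ℝ, 0 < τ → ∀ f : ℂ → ℂ,
      MemLp f 2 (wt ((γ - 2) / 3)) → ∫⁻ z, ‖fiberOp γ τ f z‖ₑ ^ 2 ∂(wt ((γ - 2) / 3)) ≤
        C * ∫⁻ z, ‖f z‖ₑ ^ 2 ∂(wt ((γ - 2) / 3))) {ε : ℝ} (hε : 0 < ε)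
    (hfm : StronglyMeasurable f)
    (hf1 : Integrable f (wtProd (γ - 2))) (hf2 : MemLp f 2 (wtProd ((γ - 2) / 3))) :
    ∫⁻ p, ‖freqCut γ ε f p.1 p.2‖ₑ ^ 2 ∂(wtProd ((γ - 2) / 3)) ≤
      C * ∫⁻ p, ‖f p‖ₑ ^ 2 ∂(wtProd ((γ - 2) / 3)) := by
  have hm' := (stronglyMeasurable_freqCut γ ε hfm).measurable
  rw [lintegral_wtProd_symm _ (by fun_prop)]
  refine le_trans ?_ (lintegral_freqPart_le hC hfm hf1 hf2)
  rw [← lintegral_indicator measurableSet_Ioi]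
  refine lintegral_mono fun ξ => ?_
  by_cases hξ : 0 < ξ
  · simp only [freqCut, Set.mem_Ioi, hξ, Set.indicator_of_mem, enorm_mul, mul_pow]
    refine lintegral_mono fun z => ?_
    exact mul_le_of_le_one_left zero_le (pow_le_one₀ zero_le (enorm_exp_neg_le_one hε.le hξ.le))
  · simp [freqCut, hξ]

/-- The Leray integrals of a function in `L¹ ∩ L²` form a Cauchy family in `L²`. -/
theorem tendsto_lintegral_coordLeray_sub (hγ : 1 < γ) (hfm : StronglyMeasurable f)
    (hf1 : Integrable f (wtProd (γ - 2))) (hf2 : MemLp f 2 (wtProd ((γ - 2) / 3))) :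
    Tendsto (fun r : ℝ × ℝ => ∫⁻ p, ‖coordLeray γ r.1 f p - coordLeray γ r.2 f p‖ₑ ^ 2
      ∂(wtProd ((γ - 2) / 3))) (𝓝[>] 0 ×ˢ 𝓝[>] 0) (𝓝 0) := by
  obtain ⟨C, hCt, hC⟩ := exists_lintegral_fiberOp_le hγ
  set N : ℝ → ENNReal := fun ξ => ∫⁻ z, ‖freqPart γ f z ξ‖ₑ ^ 2 ∂(wt ((γ - 2) / 3)) with hN
  have hNm : Measurable N := measurable_lintegral_freqPart γ _ hfm
  have hNfin : ∫⁻ ξ in Set.Ioi (0 : ℝ), N ξ < ⊤ :=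
    (lintegral_freqPart_le hC hfm hf1 hf2).trans_lt
      (ENNReal.mul_lt_top hCt.lt_top ((memLp_two_iff hf2.1).1 hf2))
  -- On the Fourier side the difference of two heights is multiplication of `freqPart` by `D`, which
  -- is at most `2` in norm and tends to `0`; dominated convergence in `ξ` finishes.
  let D : ℝ × ℝ → ℝ → ℂ := fun r ξ =>
    exp (-(2 * Real.pi * r.1 * ξ)) - exp (-(2 * Real.pi * r.2 * ξ))
  have hpos : ∀ᶠ r : ℝ × ℝ in 𝓝[>] 0 ×ˢ 𝓝[>] 0, 0 < r.1 ∧ 0 < r.2 :=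
    (eventually_mem_nhdsWithin (a := (0 : ℝ)) (s := Set.Ioi 0)).prod_mk
      (eventually_mem_nhdsWithin (a := (0 : ℝ)) (s := Set.Ioi 0))
  have heq : ∀ᶠ r : ℝ × ℝ in 𝓝[>] 0 ×ˢ 𝓝[>] 0, ∫⁻ ξ in Set.Ioi (0 : ℝ), ‖D r ξ‖ₑ ^ 2 * N ξ =
      ∫⁻ p, ‖coordLeray γ r.1 f p - coordLeray γ r.2 f p‖ₑ ^ 2 ∂(wtProd ((γ - 2) / 3)) := by
    filter_upwards [hpos] with r ⟨h1, h2⟩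
    have hm1 := (stronglyMeasurable_coordLeray γ r.1 hfm).measurable
    have hm2 := (stronglyMeasurable_coordLeray γ r.2 hfm).measurable
    have hc1 := (stronglyMeasurable_freqCut γ r.1 hfm).measurable
    have hc2 := (stronglyMeasurable_freqCut γ r.2 hfm).measurable
    have hm := (stronglyMeasurable_freqPart γ hfm).measurable
    rw [lintegral_wtProd _ (by fun_prop)]
    have e1 : ∀ z, ∫⁻ x : ℝ, ‖coordLeray γ r.1 f (z, x) - coordLeray γ r.2 f (z, x)‖ₑ ^ 2 =
        ∫⁻ ξ : ℝ, ‖freqCut γ r.1 f z ξ - freqCut γ r.2 f z ξ‖ₑ ^ 2 := by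
      intro z
      have hi1 := integrable_freqCut hγ h1 hfm hf1 z
      have hi2 := integrable_freqCut hγ h2 hfm hf1 z
      have hp := lintegral_enorm_sq_fourierInv (hi1.sub hi2)
        ((memLp_freqCut hγ h1 hfm hf1 z).sub (memLp_freqCut hγ h2 hfm hf1 z))
      simp only [Pi.sub_apply] at hp
      rw [← hp]
      simp only [coordLeray_eq_fourierInv hγ h1 hf1, coordLeray_eq_fourierInv hγ h2 hf1]
      refine lintegral_congr fun x => ?_
      have hb : ∀ {g : ℝ → ℂ}, Integrable g →
          Integrable fun ξ : ℝ => exp (2 * Real.pi * I * ξ * x) * g ξ := fun {g} hg => by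
        refine hg.norm.mono' ((Measurable.aestronglyMeasurable (by fun_prop)).mul hg.1)
          (Eventually.of_forall fun ξ => ?_)
        rw [norm_mul, norm_exp]
        simp
      simp only [fourierInv_eq_integral_exp, Pi.sub_apply, mul_sub]
      rw [integral_sub (hb hi1) (hb hi2)]
    simp only [e1]
    rw [← lintegral_wtProd ((γ - 2) / 3)
      (g := fun p : ℂ × ℝ => ‖freqCut γ r.1 f p.1 p.2 - freqCut γ r.2 f p.1 p.2‖ₑ ^ 2)
      (by fun_prop), lintegral_wtProd_symm _ (by fun_prop), ← lintegral_indicator measurableSet_Ioi]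
    refine lintegral_congr fun ξ => ?_
    by_cases hξ : 0 < ξ
    · simp only [freqCut, Set.mem_Ioi, hξ, Set.indicator_of_mem, hN, D]
      rw [← lintegral_const_mul _ (by fun_prop)]
      refine lintegral_congr fun z => ?_
      rw [← sub_mul, enorm_mul, mul_pow]
    · simp [freqCut, hξ]
  refine Tendsto.congr' heq ?_
  have hlim : Tendsto (fun r : ℝ × ℝ => ∫⁻ ξ in Set.Ioi (0 : ℝ), ‖D r ξ‖ₑ ^ 2 * N ξ)
      (𝓝[>] 0 ×ˢ 𝓝[>] 0) (𝓝 (∫⁻ ξ in Set.Ioi (0 : ℝ), 0)) := by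
    refine tendsto_lintegral_filter_of_dominated_convergence (fun ξ => 4 * N ξ)
      (Eventually.of_forall fun r => by fun_prop) ?_ ?_ ?_
    · filter_upwards [hpos] with r ⟨h1, h2⟩
      filter_upwards [ae_restrict_mem measurableSet_Ioi] with ξ hξ
      have hξ' : 0 < ξ := hξ
      gcongr
      have : ‖D r ξ‖ₑ ≤ 2 := by
        refine (enorm_sub_le).trans ?_
        refine (add_le_add (enorm_exp_neg_le_one h1.le hξ'.le)
          (enorm_exp_neg_le_one h2.le hξ'.le)).trans (by norm_num)
      calc ‖D r ξ‖ₑ ^ 2 ≤ 2 ^ 2 := by gcongr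
        _ = 4 := by norm_num
    · rw [lintegral_const_mul _ hNm]
      exact ENNReal.mul_ne_top (by norm_num) hNfin.ne
    · filter_upwards [ae_lt_top hNm hNfin.ne] with ξ hξ
      have hD : Tendsto (fun r => D r ξ) (𝓝[>] 0 ×ˢ 𝓝[>] 0) (𝓝 0) := by
        have hc : Continuous fun r => D r ξ := by fun_prop
        have h0 := hc.tendsto (0, 0)
        simp only [D, sub_self] at h0
        rw [nhds_prod_eq] at h0
        exact h0.mono_left (Filter.prod_mono nhdsWithin_le_nhds nhdsWithin_le_nhds)
      have h2 := ENNReal.Tendsto.mul_const (b := N ξ) (ENNReal.Tendsto.pow (n := 2) hD.enorm)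
        (Or.inr hξ.ne)
      simpa using h2
  simpa using hlim

end Nice

/-! ### Boundedness and the semigroup property of the Leray integrals -/

theorem coordLeray_sub {γ ε : ℝ} (hγ : 1 < γ) (hε : 0 < ε) {f g : ℂ × ℝ → ℂ}
    (hf : MemLp f 2 (wtProd ((γ - 2) / 3))) (hg : MemLp g 2 (wtProd ((γ - 2) / 3))) (p : ℂ × ℝ) :
    coordLeray γ ε (f - g) p = coordLeray γ ε f p - coordLeray γ ε g p := by
  simp only [coordLeray, Pi.sub_apply, sub_mul]
  rw [integral_sub (integrable_mul_coordKernel hγ hε hf p) (integrable_mul_coordKernel hγ hε hg p),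
    mul_sub]

theorem tendsto_coordLeray {γ ε : ℝ} (hγ : 1 < γ) (hε : 0 < ε) {f : ℂ × ℝ → ℂ}
    {F : ℕ → ℂ × ℝ → ℂ} (hf : MemLp f 2 (wtProd ((γ - 2) / 3)))
    (hF : ∀ n, MemLp (F n) 2 (wtProd ((γ - 2) / 3)))
    (hlim : Tendsto (fun n => eLpNorm (F n - f) 2 (wtProd ((γ - 2) / 3))) atTop (𝓝 0)) (p : ℂ × ℝ) :
    Tendsto (fun n => coordLeray γ ε (F n) p) atTop (𝓝 (coordLeray γ ε f p)) := by
  rw [tendsto_iff_edist_tendsto_0]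
  simp only [edist_eq_enorm_sub, ← coordLeray_sub hγ hε (hF _) hf]
  have hK := memLp_coordKernel hγ hε p
  set c : ℂ := ((γ ^ 2 / (4 * Real.pi ^ 2) : ℝ) : ℂ)
  have hb : ∀ n, ‖coordLeray γ ε (F n - f) p‖ₑ ≤ ‖c‖ₑ *
      (eLpNorm (F n - f) 2 (wtProd ((γ - 2) / 3)) *
        eLpNorm (coordKernel γ ε p) 2 (wtProd (5 * (γ - 2) / 3))) := by
    intro n
    rw [coordLeray, enorm_mul]
    gcongr
    refine (enorm_integral_le_lintegral_enorm _).trans ?_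
    exact lintegral_enorm_mul_powWeight_le (by fun_prop) ae_norm_fst_pos (by ring)
      (((hF n).sub hf).1.mono_ac (absolutelyContinuous_powWeight (by fun_prop) ae_norm_fst_pos _))
      (measurable_coordKernel_right γ ε p).aestronglyMeasurable
  refine tendsto_of_tendsto_of_tendsto_of_le_of_le tendsto_const_nhds ?_ (fun n => zero_le) hb
  have h1 := ENNReal.Tendsto.mul_const hlim (Or.inr hK.2.ne)
  have h2 := ENNReal.Tendsto.const_mul (a := ‖c‖ₑ) h1 (Or.inr enorm_ne_top)
  simpa using h2

/-- For functions in `L¹ ∩ L²` the bound comes from the Fourier side. In general one approximates: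
at each point the Leray integral is continuous in `f`, because the kernel lies in the complementary
`L²` space, and the norm is lower semicontinuous under pointwise limits. -/
theorem exists_lintegral_coordLeray_le {γ : ℝ} (hγ : 1 < γ) :
    ∃ C : ENNReal, C ≠ ⊤ ∧ ∀ ε : ℝ, 0 < ε → ∀ f : ℂ × ℝ → ℂ, StronglyMeasurable f →
      MemLp f 2 (wtProd ((γ - 2) / 3)) →
        eLpNorm (coordLeray γ ε f) 2 (wtProd ((γ - 2) / 3)) ≤
          C * eLpNorm f 2 (wtProd ((γ - 2) / 3)) := by
  obtain ⟨C, hCt, hC⟩ := exists_lintegral_fiberOp_le hγ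
  refine ⟨C ^ (1 / 2 : ℝ), ENNReal.rpow_ne_top_of_nonneg (by norm_num) hCt,
    fun ε hε f hfm hf => ?_⟩
  obtain ⟨F, hFm, hF2, hF1, hlim⟩ := exists_seq_memLp_integrable (by fun_prop) ae_norm_fst_pos
    (a := (γ - 2) / 3) (b := 5 * (γ - 2) / 3) (c := γ - 2) (by ring) hf hfm
  have hFn : ∀ n, eLpNorm (coordLeray γ ε (F n)) 2 (wtProd ((γ - 2) / 3)) ≤
      C ^ (1 / 2 : ℝ) * eLpNorm (F n) 2 (wtProd ((γ - 2) / 3)) := by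
    intro n
    rw [eLpNorm_two_eq, eLpNorm_two_eq, ← ENNReal.mul_rpow_of_nonneg _ _ (by norm_num)]
    refine ENNReal.rpow_le_rpow ?_ (by norm_num)
    rw [lintegral_coordLeray hγ hε (hFm n) (hF1 n)]
    exact lintegral_freqCut_le hC hε (hFm n) (hF1 n) (hF2 n)
  have hnorm : Tendsto (fun n => eLpNorm f 2 (wtProd ((γ - 2) / 3)) +
      eLpNorm (F n - f) 2 (wtProd ((γ - 2) / 3))) atTop
        (𝓝 (eLpNorm f 2 (wtProd ((γ - 2) / 3)) + 0)) := tendsto_const_nhds.add hlim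
  have hFn' : ∀ n, eLpNorm (coordLeray γ ε (F n)) 2 (wtProd ((γ - 2) / 3)) ≤
      C ^ (1 / 2 : ℝ) * (eLpNorm f 2 (wtProd ((γ - 2) / 3)) +
        eLpNorm (F n - f) 2 (wtProd ((γ - 2) / 3))) := by
    intro n
    refine (hFn n).trans ?_
    gcongr
    have h := eLpNorm_add_le hf.1 ((hF2 n).sub hf).1 (p := 2) (by norm_num)
    simpa using h
  have hfat := Lp.eLpNorm_lim_le_liminf_eLpNorm (p := 2) (μ := wtProd ((γ - 2) / 3))
    (f := fun n => coordLeray γ ε (F n))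
    (fun n => (stronglyMeasurable_coordLeray γ ε (hFm n)).aestronglyMeasurable)
    (coordLeray γ ε f) (Eventually.of_forall fun p => tendsto_coordLeray hγ hε hf hF2 hlim p)
  refine hfat.trans ?_
  have h3 := ENNReal.Tendsto.const_mul (a := C ^ (1 / 2 : ℝ)) hnorm
    (Or.inr (ENNReal.rpow_ne_top_of_nonneg (by norm_num) hCt))
  rw [add_zero] at h3
  rw [← h3.liminf_eq]
  exact liminf_le_liminf (Eventually.of_forall hFn')

theorem integral_fourierInv_mul {g k : ℝ → ℂ} (hg : Integrable g) (hk : Integrable k) :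
    ∫ t, 𝓕⁻ g t * k t = ∫ ξ, g ξ * 𝓕⁻ k ξ := by
  have hint : Integrable (Function.uncurry fun t ξ : ℝ =>
      exp (2 * Real.pi * I * ξ * t) * g ξ * k t) (volume.prod volume) := by
    refine (hk.norm.mul_prod hg.norm).mono' ?_ (Eventually.of_forall fun p => ?_)
    · exact ((Measurable.aestronglyMeasurable (by fun_prop)).mul hg.1.comp_snd).mul hk.1.comp_fst
    · simp only [Function.uncurry, norm_mul, norm_exp]
      simp [mul_comm]
  calc ∫ t, 𝓕⁻ g t * k t = ∫ t : ℝ, ∫ ξ : ℝ, exp (2 * Real.pi * I * ξ * t) * g ξ * k t := by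
        simp only [fourierInv_eq_integral_exp, integral_mul_const]
    _ = ∫ ξ : ℝ, ∫ t : ℝ, exp (2 * Real.pi * I * ξ * t) * g ξ * k t :=
        integral_integral_swap hint
    _ = ∫ ξ, g ξ * 𝓕⁻ k ξ := by
        congr 1 with ξ
        rw [fourierInv_eq_integral_exp, ← integral_const_mul]
        congr 1 with t
        ring_nf

theorem memLp_freqCut_prod {γ ε : ℝ} (hγ : 1 < γ) (hε : 0 < ε) {f : ℂ × ℝ → ℂ}
    (hfm : StronglyMeasurable f) (hf1 : Integrable f (wtProd (γ - 2)))
    (hf2 : MemLp f 2 (wtProd ((γ - 2) / 3))) :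
    MemLp (fun p : ℂ × ℝ => freqCut γ ε f p.1 p.2) 2 (wtProd ((γ - 2) / 3)) := by
  obtain ⟨C, hCt, hC⟩ := exists_lintegral_fiberOp_le hγ
  refine (memLp_two_iff (stronglyMeasurable_freqCut γ ε hfm).aestronglyMeasurable).2 ?_
  exact (lintegral_freqCut_le hC hε hfm hf1 hf2).trans_lt
    (ENNReal.mul_lt_top hCt.lt_top ((memLp_two_iff hf2.1).1 hf2))

theorem memLp_laplaceFun_prod {γ ε : ℝ} (hγ : 1 < γ) (hε : 0 < ε) (z : ℂ) (x : ℝ) :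
    MemLp (fun p : ℂ × ℝ => (2 * Real.pi) ^ 2 * laplaceFun (phase γ z p.1 + ε - I * x) p.2) 2
      (wtProd (5 * (γ - 2) / 3)) := by
  have hph := measurable_phase_right γ z
  have hm : Measurable fun p : ℂ × ℝ =>
      (2 * Real.pi) ^ 2 * laplaceFun (phase γ z p.1 + ε - I * x) p.2 := by
    simp only [laplaceFun_eq_max]
    fun_prop
  rw [memLp_two_iff hm.aestronglyMeasurable, lintegral_wtProd _ (by fun_prop)]
  refine lt_of_le_of_lt (lintegral_mono fun ζ => ?_) (lintegral_inv_re_phase_lt_top hγ z hε)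
  have h := lintegral_enorm_sq_laplaceFun_le (re_phase_add_pos hγ hε x z ζ)
  rw [re_phase_add] at h
  exact h

theorem memLp_coordLeray {γ ε : ℝ} (hγ : 1 < γ) (hε : 0 < ε) {f : ℂ × ℝ → ℂ}
    (hfm : StronglyMeasurable f) (hf2 : MemLp f 2 (wtProd ((γ - 2) / 3))) :
    MemLp (coordLeray γ ε f) 2 (wtProd ((γ - 2) / 3)) := by
  obtain ⟨C, hCt, hC⟩ := exists_lintegral_coordLeray_le hγ
  exact ⟨(stronglyMeasurable_coordLeray γ ε hfm).aestronglyMeasurable,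
    (hC ε hε f hfm hf2).trans_lt (ENNReal.mul_lt_top hCt.lt_top hf2.2)⟩

/-- On each fibre `integral_fourierInv_mul` moves the inverse Fourier transform from the inner Leray
integral to the kernel. At every frequency the damping factors then multiply, and the fibre operator
acts twice, which by `fiberOp_fiberOp` is the same as once. -/
theorem coordLeray_coordLeray {γ δ ε : ℝ} (hγ : 1 < γ) (hδ : 0 < δ) (hε : 0 < ε)
    {f : ℂ × ℝ → ℂ} (hfm : StronglyMeasurable f) (hf1 : Integrable f (wtProd (γ - 2)))
    (hf2 : MemLp f 2 (wtProd ((γ - 2) / 3))) (p : ℂ × ℝ) :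
    coordLeray γ δ (coordLeray γ ε f) p = coordLeray γ (δ + ε) f p := by
  obtain ⟨z, x⟩ := p
  set c : ℂ := ((γ ^ 2 / (4 * Real.pi ^ 2) : ℝ) : ℂ) with hc
  have hpi : (Real.pi : ℂ) ≠ 0 := by exact_mod_cast Real.pi_ne_zero
  have hi := integrable_mul_coordKernel hγ hδ (memLp_coordLeray hγ hε hfm hf2) (z, x)
  rw [wtProd_eq_prod] at hi
  have h1 : ∀ ζ, ∫ t : ℝ, coordLeray γ ε f (ζ, t) * coordKernel γ δ (z, x) (ζ, t) =
      ∫ ξ : ℝ, freqCut γ ε f ζ ξ *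
        ((2 * Real.pi) ^ 2 * laplaceFun (phase γ z ζ + δ - I * x) ξ) := by
    intro ζ
    have ha := re_phase_add_pos hγ hδ x z ζ
    simp only [coordLeray_eq_fourierInv hγ hε hf1, coordKernel, ← fourierInv_one_div_sq ha]
    exact integral_fourierInv_mul (integrable_freqCut hγ hε hfm hf1 ζ) (integrable_one_div_sq ha)
  -- Exchanging `ζ` and `ξ` needs joint integrability, which is Cauchy–Schwarz between the two
  -- complementary weights.
  have hsw := integrable_mul_powWeight (by fun_prop) ae_norm_fst_pos
    (a := (γ - 2) / 3) (b := 5 * (γ - 2) / 3) (c := γ - 2) (by ring)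
    (memLp_freqCut_prod hγ hε hfm hf1 hf2) (memLp_laplaceFun_prod hγ hδ z x)
  change Integrable _ (wtProd (γ - 2)) at hsw
  rw [wtProd_eq_prod] at hsw
  have h2 : ∀ ξ : ℝ, c * ∫ ζ, freqCut γ ε f ζ ξ *
      ((2 * Real.pi) ^ 2 * laplaceFun (phase γ z ζ + δ - I * x) ξ) ∂(wt (γ - 2)) =
        exp (2 * Real.pi * I * ξ * x) * freqCut γ (δ + ε) f z ξ := by
    intro ξ
    by_cases hξ : 0 < ξ
    · have hproj : freqPart γ f z ξ = fiberOp γ (2 * Real.pi * ξ) (fun ζ => freqPart γ f ζ ξ) z :=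
        (fiberOp_fiberOp hγ (by positivity) (integrable_partialFourier hfm hf1 ξ) z).symm
      simp only [freqCut, laplaceFun, Set.mem_Ioi, hξ, Set.indicator_of_mem]
      rw [hproj, fiberOp]
      have e : ∀ ζ, exp (-(2 * Real.pi * ε * ξ)) * freqPart γ f ζ ξ *
          ((2 * Real.pi) ^ 2 * (ξ * exp (-(2 * Real.pi * ξ * (phase γ z ζ + δ - I * x))))) =
          ((2 * Real.pi) ^ 2 * ξ * exp (2 * Real.pi * I * ξ * x) *
            exp (-(2 * Real.pi * (δ + ε : ℝ) * ξ))) *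
              (freqPart γ f ζ ξ * exp (-((2 * Real.pi * ξ : ℝ) * phase γ z ζ))) := by
        intro ζ
        have : exp (-(2 * Real.pi * ε * ξ)) *
            exp (-(2 * Real.pi * ξ * (phase γ z ζ + δ - I * x))) =
            exp (2 * Real.pi * I * ξ * x) * exp (-(2 * Real.pi * (δ + ε : ℝ) * ξ)) *
              exp (-((2 * Real.pi * ξ : ℝ) * phase γ z ζ)) := by
          rw [← Complex.exp_add, ← Complex.exp_add, ← Complex.exp_add]
          congr 1
          push_cast
          ring
        linear_combination ((2 * Real.pi) ^ 2 * ξ * freqPart γ f ζ ξ) * this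
      simp only [e]
      rw [integral_const_mul, hc]
      push_cast
      field_simp
      ring
    · simp [freqCut, hξ]
  rw [coordLeray_eq_fourierInv hγ (by positivity) hf1, fourierInv_eq_integral_exp, coordLeray,
    wtProd_eq_prod, integral_prod _ hi, ← hc]
  simp only [h1, ← h2]
  rw [integral_const_mul, integral_integral_swap hsw]

/-! ### Transport to the hypersurface -/

theorem measurable_param (γ : ℝ) : Measurable (param γ) := by
  refine Measurable.subtype_mk (f := fun p : ℂ × ℝ =>
    ((p.1, (p.2 : ℂ) + ((‖p.1‖ ^ γ : ℝ) : ℂ) * I) : ℂ × ℂ)) ?_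
  fun_prop

/-- The parametrization as an equivalence of measurable spaces. -/
def paramEquiv (γ : ℝ) : ℂ × ℝ ≃ᵐ hypersurface γ where
  toFun := param γ
  invFun ζ := (ζ.1.1, ζ.1.2.re)
  left_inv p := by simp [param]
  right_inv ζ := by
    obtain ⟨⟨z, w⟩, h⟩ := ζ
    have h' : w.im = ‖z‖ ^ γ := h
    refine Subtype.ext (Prod.ext rfl ?_)
    simp only [param, ← h', re_add_im]
  measurable_toFun := measurable_param γ
  measurable_invFun := by
    have h : Measurable fun ζ : hypersurface γ => (ζ : ℂ × ℂ) := measurable_subtype_coe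
    exact (measurable_fst.comp h).prodMk (Complex.measurable_re.comp (measurable_snd.comp h))

theorem mu_eq_map (γ r : ℝ) : mu γ r = (wtProd (r - 1)).map (paramEquiv γ) := rfl

theorem sigma_eq_map (γ : ℝ) : sigma γ = (wtProd (γ - 2)).map (paramEquiv γ) := by
  rw [sigma, mu_eq_map, show γ - 1 - 1 = γ - 2 by ring]

/-- The constant factor of the preferred measure. -/
def preferredFactor (c γ : ℝ) : ℝ := c * γ ^ (4 / 3 : ℝ) / (4 * (γ - 1) ^ (1 / 3 : ℝ))

theorem preferredFactor_pos {c γ : ℝ} (hc : 0 < c) (hγ : 1 < γ) : 0 < preferredFactor c γ := by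
  have h1 : 0 < γ - 1 := by linarith
  have h0 : 0 < γ := by linarith
  unfold preferredFactor
  positivity

theorem preferredMeasureWith_eq (c γ : ℝ) : preferredMeasureWith c γ =
    ENNReal.ofReal (preferredFactor c γ) • (wtProd ((γ - 2) / 3)).map (paramEquiv γ) := by
  rw [preferredMeasureWith, mu_eq_map, show (γ + 1) / 3 - 1 = (γ - 2) / 3 by ring, preferredFactor]

theorem conj_mul_rpow_mul_self {γ : ℝ} (hγ : 1 < γ) (z : ℂ) :
    conj z * ((‖z‖ ^ (γ - 2) : ℝ) : ℂ) * z = ((‖z‖ ^ γ : ℝ) : ℂ) := by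
  rcases (norm_nonneg z).eq_or_lt with h | h
  · have h0 : z = 0 := norm_eq_zero.1 h.symm
    simp [h0, Real.zero_rpow (by linarith : γ ≠ 0)]
  · have e : ‖z‖ ^ γ = ‖z‖ ^ 2 * ‖z‖ ^ (γ - 2) := by
      rw [← Real.rpow_natCast, ← Real.rpow_add h]; congr 1; push_cast; ring
    rw [e, mul_right_comm, mul_comm (conj z), mul_conj, Complex.normSq_eq_norm_sq]
    push_cast; ring

/-- The height of `(z, w)` above the hypersurface is `w.im - ‖z‖^γ`. Evaluating at `ζ₁` turns the
diagonal term `γ|ζ₁|^γ` and the imaginary part of `ζ₂` into the `(γ-1)|ζ₁|^γ` of the phase. -/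
theorem lerayKernel_param {γ : ℝ} (hγ : 1 < γ) (z w : ℂ) (q : ℂ × ℝ) :
    lerayKernel γ (z, w) (paramEquiv γ q) = coordKernel γ (w.im - ‖z‖ ^ γ) (z, w.re) q := by
  have hq := conj_mul_rpow_mul_self hγ q.1
  change lerayKernel γ (z, w) (q.1, (q.2 : ℂ) + ((‖q.1‖ ^ γ : ℝ) : ℂ) * I) = _
  simp only [lerayKernel, coordKernel, phase]
  congr 2
  have hw : w = w.re + w.im * I := (re_add_im w).symm
  have hI : I * I = -1 := I_mul_I
  push_cast
  calc _ = γ * (conj q.1 * ((‖q.1‖ ^ (γ - 2) : ℝ) : ℂ) * q.1) -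
        γ * (conj q.1 * ((‖q.1‖ ^ (γ - 2) : ℝ) : ℂ)) * z +
        I * (q.2 + ((‖q.1‖ ^ γ : ℝ) : ℂ) * I - (w.re + w.im * I)) := by
        rw [← hw]; ring
    _ = _ := by
        rw [hq]
        linear_combination (((‖q.1‖ ^ γ : ℝ) : ℂ) - w.im) * hI

/-- The Leray integral at height `ε` above the hypersurface. -/
def shiftLeray (γ ε : ℝ) (f : hypersurface γ → ℂ) (ζ : hypersurface γ) : ℂ :=
  lerayIntegral γ f (ζ.1.1, ζ.1.2 + (ε : ℂ) * I)

theorem shiftLeray_param {γ : ℝ} (hγ : 1 < γ) (ε : ℝ) (f : hypersurface γ → ℂ) (p : ℂ × ℝ) :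
    shiftLeray γ ε f (paramEquiv γ p) = coordLeray γ ε (f ∘ paramEquiv γ) p := by
  rw [shiftLeray, lerayIntegral, coordLeray, sigma_eq_map, integral_map_equiv]
  congr 1
  refine integral_congr_ae (Eventually.of_forall fun q => ?_)
  simp only [Function.comp]
  rw [lerayKernel_param hγ]
  congr 2
  · simp [paramEquiv, param]
  · simp [paramEquiv, param]

theorem shiftLeray_comp_param {γ : ℝ} (hγ : 1 < γ) (ε : ℝ) (f : hypersurface γ → ℂ) :
    shiftLeray γ ε f ∘ paramEquiv γ = coordLeray γ ε (f ∘ paramEquiv γ) :=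
  funext (shiftLeray_param hγ ε f)

section Transport

variable {γ c : ℝ}

theorem eLpNorm_preferred (hc : 0 < c) (hγ : 1 < γ) (f : hypersurface γ → ℂ) :
    eLpNorm f 2 (preferredMeasureWith c γ) = ENNReal.ofReal (preferredFactor c γ) ^ (1 / 2 : ℝ) *
      eLpNorm (f ∘ paramEquiv γ) 2 (wtProd ((γ - 2) / 3)) := by
  have h0 : ENNReal.ofReal (preferredFactor c γ) ≠ 0 := by
    simpa using preferredFactor_pos hc hγ
  rw [preferredMeasureWith_eq, eLpNorm_smul_measure_of_ne_zero h0,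
    (paramEquiv γ).measurableEmbedding.eLpNorm_map_measure]
  simp

theorem memLp_preferred_iff (hc : 0 < c) (hγ : 1 < γ) (f : hypersurface γ → ℂ) :
    MemLp f 2 (preferredMeasureWith c γ) ↔ MemLp (f ∘ paramEquiv γ) 2 (wtProd ((γ - 2) / 3)) := by
  have h0 : ENNReal.ofReal (preferredFactor c γ) ≠ 0 := by
    simpa using preferredFactor_pos hc hγ
  rw [preferredMeasureWith_eq, ← (paramEquiv γ).memLp_map_measure_iff]
  refine ⟨fun h => ?_, fun h => h.smul_measure ENNReal.ofReal_ne_top⟩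
  have h2 := h.smul_measure (c := (ENNReal.ofReal (preferredFactor c γ))⁻¹) (by simpa using h0)
  rwa [smul_smul, ENNReal.inv_mul_cancel h0 ENNReal.ofReal_ne_top, one_smul] at h2

theorem integrable_sigma_iff (γ : ℝ) (f : hypersurface γ → ℂ) :
    Integrable f (sigma γ) ↔ Integrable (f ∘ paramEquiv γ) (wtProd (γ - 2)) := by
  rw [sigma_eq_map, integrable_map_equiv]

theorem sigma_absolutelyContinuous_preferred (hc : 0 < c) (hγ : 1 < γ) :
    sigma γ ≪ preferredMeasureWith c γ := by
  have h0 : ENNReal.ofReal (preferredFactor c γ) ≠ 0 := by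
    simpa using preferredFactor_pos hc hγ
  rw [sigma_eq_map, preferredMeasureWith_eq]
  exact ((powWeight_absolutelyContinuous_powWeight (by fun_prop) ae_norm_fst_pos _ _).map
    (paramEquiv γ).measurable).trans (Measure.absolutelyContinuous_smul h0)

theorem integrable_mul_lerayKernel (hc : 0 < c) (hγ : 1 < γ) {f : hypersurface γ → ℂ}
    (hf : MemLp f 2 (preferredMeasureWith c γ)) {z : ℂ × ℂ} (hz : z ∈ domain γ) :
    Integrable (fun ζ : hypersurface γ => f ζ * lerayKernel γ z ζ) (sigma γ) := by
  rw [integrable_sigma_iff]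
  have hz' : 0 < z.2.im - ‖z.1‖ ^ γ := sub_pos.2 hz
  refine (integrable_mul_coordKernel hγ hz' ((memLp_preferred_iff hc hγ f).1 hf)
    (z.1, z.2.re)).congr (Eventually.of_forall fun q => ?_)
  simp only [Function.comp]
  rw [← lerayKernel_param hγ]

theorem shift_mem_domain {ε : ℝ} (hε : 0 < ε) (ζ : hypersurface γ) :
    ((ζ.1.1, ζ.1.2 + (ε : ℂ) * I) : ℂ × ℂ) ∈ domain γ := by
  have h : ζ.1.2.im = ‖ζ.1.1‖ ^ γ := ζ.2
  simp [domain, h, hε]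

theorem shiftLeray_congr_ae (ε : ℝ) {f g : hypersurface γ → ℂ} (h : f =ᵐ[sigma γ] g) :
    shiftLeray γ ε f = shiftLeray γ ε g := by
  funext ζ
  rw [shiftLeray, shiftLeray, lerayIntegral, lerayIntegral]
  congr 1
  exact integral_congr_ae (h.mono fun ζ hζ => by simp only [hζ])

theorem shiftLeray_add {ε : ℝ} (hc : 0 < c) (hγ : 1 < γ) (hε : 0 < ε) {f g : hypersurface γ → ℂ}
    (hf : MemLp f 2 (preferredMeasureWith c γ)) (hg : MemLp g 2 (preferredMeasureWith c γ)) :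
    shiftLeray γ ε (f + g) = shiftLeray γ ε f + shiftLeray γ ε g := by
  funext ζ
  simp only [shiftLeray, lerayIntegral, Pi.add_apply, add_mul]
  rw [integral_add (integrable_mul_lerayKernel hc hγ hf (shift_mem_domain hε ζ))
    (integrable_mul_lerayKernel hc hγ hg (shift_mem_domain hε ζ)), mul_add]

theorem shiftLeray_smul (ε : ℝ) (a : ℂ) (f : hypersurface γ → ℂ) :
    shiftLeray γ ε (a • f) = a • shiftLeray γ ε f := by
  funext ζ
  simp only [shiftLeray, lerayIntegral, Pi.smul_apply, smul_eq_mul, mul_assoc]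
  rw [integral_const_mul]
  ring

theorem memLp_shiftLeray {ε : ℝ} (hc : 0 < c) (hγ : 1 < γ) (hε : 0 < ε) {f : hypersurface γ → ℂ}
    (hfm : StronglyMeasurable f) (hf : MemLp f 2 (preferredMeasureWith c γ)) :
    MemLp (shiftLeray γ ε f) 2 (preferredMeasureWith c γ) := by
  rw [memLp_preferred_iff hc hγ, shiftLeray_comp_param hγ]
  exact memLp_coordLeray hγ hε (hfm.comp_measurable (paramEquiv γ).measurable)
    ((memLp_preferred_iff hc hγ f).1 hf)

theorem exists_eLpNorm_shiftLeray_le (hc : 0 < c) (hγ : 1 < γ) :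
    ∃ C : ENNReal, C ≠ ⊤ ∧ ∀ ε : ℝ, 0 < ε → ∀ f : hypersurface γ → ℂ, StronglyMeasurable f →
      MemLp f 2 (preferredMeasureWith c γ) →
        eLpNorm (shiftLeray γ ε f) 2 (preferredMeasureWith c γ) ≤
          C * eLpNorm f 2 (preferredMeasureWith c γ) := by
  obtain ⟨C, hCt, hC⟩ := exists_lintegral_coordLeray_le hγ
  refine ⟨C, hCt, fun ε hε f hfm hf => ?_⟩
  rw [eLpNorm_preferred hc hγ, eLpNorm_preferred hc hγ, shiftLeray_comp_param hγ, mul_left_comm]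
  gcongr
  exact hC ε hε _ (hfm.comp_measurable (paramEquiv γ).measurable)
    ((memLp_preferred_iff hc hγ f).1 hf)

theorem tendsto_eLpNorm_shiftLeray_sub (hc : 0 < c) (hγ : 1 < γ) {f : hypersurface γ → ℂ}
    (hfm : StronglyMeasurable f) (hf1 : Integrable f (sigma γ))
    (hf2 : MemLp f 2 (preferredMeasureWith c γ)) :
    Tendsto (fun r : ℝ × ℝ => eLpNorm (shiftLeray γ r.1 f - shiftLeray γ r.2 f) 2
      (preferredMeasureWith c γ)) (𝓝[>] 0 ×ˢ 𝓝[>] 0) (𝓝 0) := by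
  have h := tendsto_lintegral_coordLeray_sub hγ (hfm.comp_measurable (paramEquiv γ).measurable)
    ((integrable_sigma_iff γ f).1 hf1) ((memLp_preferred_iff hc hγ f).1 hf2)
  have h2 := ENNReal.Tendsto.const_mul (a := ENNReal.ofReal (preferredFactor c γ) ^ (1 / 2 : ℝ))
    (h.ennrpow_const (1 / 2 : ℝ))
    (Or.inr (ENNReal.rpow_ne_top_of_nonneg (by norm_num) ENNReal.ofReal_ne_top))
  have h3 : (0 : ENNReal) ^ (1 / 2 : ℝ) = 0 := ENNReal.zero_rpow_of_pos (by norm_num)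
  rw [h3, mul_zero] at h2
  refine h2.congr fun r => ?_
  rw [eLpNorm_preferred hc hγ, eLpNorm_two_eq]
  simp only [Function.comp, Pi.sub_apply, shiftLeray_param hγ]

theorem shiftLeray_shiftLeray {δ ε : ℝ} (hc : 0 < c) (hγ : 1 < γ) (hδ : 0 < δ) (hε : 0 < ε)
    {f : hypersurface γ → ℂ} (hfm : StronglyMeasurable f) (hf1 : Integrable f (sigma γ))
    (hf2 : MemLp f 2 (preferredMeasureWith c γ)) :
    shiftLeray γ δ (shiftLeray γ ε f) = shiftLeray γ (δ + ε) f := by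
  funext ζ
  obtain ⟨p, rfl⟩ := (paramEquiv γ).surjective ζ
  rw [shiftLeray_param hγ, shiftLeray_param hγ, shiftLeray_comp_param hγ,
    coordLeray_coordLeray hγ hδ hε (hfm.comp_measurable (paramEquiv γ).measurable)
      ((integrable_sigma_iff γ f).1 hf1) ((memLp_preferred_iff hc hγ f).1 hf2)]

theorem exists_seq_memLp_preferred_integrable (hc : 0 < c) (hγ : 1 < γ) {f : hypersurface γ → ℂ}
    (hfm : StronglyMeasurable f) (hf : MemLp f 2 (preferredMeasureWith c γ)) :
    ∃ F : ℕ → hypersurface γ → ℂ, (∀ n, StronglyMeasurable (F n)) ∧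
      (∀ n, MemLp (F n) 2 (preferredMeasureWith c γ)) ∧ (∀ n, Integrable (F n) (sigma γ)) ∧
      Tendsto (fun n => eLpNorm (F n - f) 2 (preferredMeasureWith c γ)) atTop (𝓝 0) := by
  obtain ⟨G, hGm, hG2, hG1, hlim⟩ := exists_seq_memLp_integrable (m := volume)
    (d := fun p : ℂ × ℝ => ‖p.1‖) (by fun_prop) ae_norm_fst_pos
    (a := (γ - 2) / 3) (b := 5 * (γ - 2) / 3) (c := γ - 2) (by ring)
    ((memLp_preferred_iff hc hγ f).1 hf) (hfm.comp_measurable (paramEquiv γ).measurable)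
  have hcomp : ∀ n, (G n ∘ (paramEquiv γ).symm) ∘ paramEquiv γ = G n := fun n => by
    funext p; simp
  refine ⟨fun n => G n ∘ (paramEquiv γ).symm, fun n => (hGm n).comp_measurable
    (paramEquiv γ).symm.measurable, fun n => ?_, fun n => ?_, ?_⟩
  · rw [memLp_preferred_iff hc hγ, hcomp]; exact hG2 n
  · rw [integrable_sigma_iff, hcomp]; exact hG1 n
  · have h2 := ENNReal.Tendsto.const_mul (a := ENNReal.ofReal (preferredFactor c γ) ^ (1 / 2 : ℝ))
      hlim (Or.inr (ENNReal.rpow_ne_top_of_nonneg (by norm_num) ENNReal.ofReal_ne_top))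
    rw [mul_zero] at h2
    refine h2.congr fun n => ?_
    rw [eLpNorm_preferred hc hγ]
    congr 2
    funext p
    simp

end Transport

/-! ### Strong limits of bounded families of operators -/

/-- An `η/3` argument: the uniform bound carries the Cauchy property from the dense set to all of
`E`, and the pointwise limit is linear with the same bound. -/
theorem exists_strong_limit {E : Type*} [NormedAddCommGroup E] [NormedSpace ℂ E] [CompleteSpace E]
    {T : ℝ → E →L[ℂ] E} {C : ℝ} (hT : ∀ ε, 0 < ε → ‖T ε‖ ≤ C) {D : Set E} (hD : Dense D)
    (hcauchy : ∀ f ∈ D, Tendsto (fun r : ℝ × ℝ => ‖T r.1 f - T r.2 f‖)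
      (𝓝[>] 0 ×ˢ 𝓝[>] 0) (𝓝 0)) :
    ∃ L : E →L[ℂ] E, ∀ f, Tendsto (fun ε => T ε f) (𝓝[>] 0) (𝓝 (L f)) := by
  have hpos : ∀ᶠ r : ℝ × ℝ in 𝓝[>] 0 ×ˢ 𝓝[>] 0, 0 < r.1 ∧ 0 < r.2 :=
    (eventually_mem_nhdsWithin (a := (0 : ℝ)) (s := Set.Ioi 0)).prod_mk
      (eventually_mem_nhdsWithin (a := (0 : ℝ)) (s := Set.Ioi 0))
  have hC0 : 0 ≤ C := (norm_nonneg _).trans (hT 1 one_pos)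
  have hc : ∀ f, Cauchy (map (fun ε => T ε f) (𝓝[>] 0)) := by
    intro f
    rw [Metric.cauchy_iff]
    refine ⟨inferInstance, fun η hη => ?_⟩
    obtain ⟨g, hgD, hg⟩ := hD.exists_dist_lt f (ε := η / (3 * (C + 1))) (by positivity)
    have hfg : C * ‖f - g‖ < η / 3 := by
      rw [dist_eq_norm] at hg
      calc C * ‖f - g‖ ≤ (C + 1) * ‖f - g‖ := by gcongr; linarith
        _ < (C + 1) * (η / (3 * (C + 1))) := by gcongr
        _ = η / 3 := by field_simp
    have hev := ((hcauchy g hgD).eventually (gt_mem_nhds (by positivity : (0 : ℝ) < η / 3))).and hpos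
    obtain ⟨P, hP, Q, hQ, hPQ⟩ := Filter.eventually_prod_iff.1 hev
    refine ⟨(fun ε => T ε f) '' {ε | P ε ∧ Q ε}, image_mem_map (hP.and hQ), ?_⟩
    rintro _ ⟨a, ⟨ha, -⟩, rfl⟩ _ ⟨b, ⟨-, hb⟩, rfl⟩
    obtain ⟨h1, h2, h3⟩ := hPQ ha hb
    have key : ∀ ε, 0 < ε → ‖T ε f - T ε g‖ < η / 3 := fun ε hε => by
      rw [← map_sub]
      exact ((T ε).le_of_opNorm_le (hT ε hε) _).trans_lt hfg
    calc dist (T a f) (T b f) = ‖(T a f - T a g) + (T a g - T b g) + -(T b f - T b g)‖ := by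
          rw [dist_eq_norm]; congr 1; abel
      _ ≤ ‖T a f - T a g‖ + ‖T a g - T b g‖ + ‖-(T b f - T b g)‖ := norm_add₃_le
      _ < η := by
          rw [norm_neg]
          have := key a h2
          have := key b h3
          linarith
  choose L hL using fun f => cauchy_iff_exists_le_nhds.1 (hc f)
  have hL' : ∀ f, Tendsto (fun ε => T ε f) (𝓝[>] 0) (𝓝 (L f)) := hL
  have hlin : Tendsto (fun ε f => (T ε : E →ₗ[ℂ] E) f) (𝓝[>] 0) (𝓝 L) :=
    tendsto_pi_nhds.2 hL'
  refine ⟨(linearMapOfTendsto L (fun ε => (T ε : E →ₗ[ℂ] E)) hlin).mkContinuous C fun f => ?_, hL'⟩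
  refine le_of_tendsto (hL' f).norm ?_
  filter_upwards [self_mem_nhdsWithin] with ε hε
  exact (T ε).le_of_opNorm_le (hT ε hε) f

theorem tendsto_apply_tendsto {E : Type*} [NormedAddCommGroup E] [NormedSpace ℂ E]
    {T : ℝ → E →L[ℂ] E} {C : ℝ} (hT : ∀ ε, 0 < ε → ‖T ε‖ ≤ C) {L : E →L[ℂ] E}
    (hL : ∀ f, Tendsto (fun ε => T ε f) (𝓝[>] 0) (𝓝 (L f))) {g : ℝ → E} {f : E}
    (hg : Tendsto g (𝓝[>] 0) (𝓝 f)) : Tendsto (fun ε => T ε (g ε)) (𝓝[>] 0) (𝓝 (L f)) := by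
  have h1 : Tendsto (fun ε => T ε (g ε - f)) (𝓝[>] 0) (𝓝 0) := by
    have h2 := (tendsto_iff_norm_sub_tendsto_zero.1 hg).const_mul C
    rw [mul_zero] at h2
    refine squeeze_zero_norm' ?_ h2
    filter_upwards [self_mem_nhdsWithin] with ε hε
    exact (T ε).le_of_opNorm_le (hT ε hε) _
  have h3 := h1.add (hL f)
  simpa using h3

/-- On the dense set `T ε (T ε f)` tends to `L (L f)`, thanks to the uniform bound, while `T (ε + ε)
f` tends to `L f`; the identity is a closed condition on `f`. -/
theorem apply_apply_of_semigroup {E : Type*} [NormedAddCommGroup E] [NormedSpace ℂ E]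
    {T : ℝ → E →L[ℂ] E} {C : ℝ} (hT : ∀ ε, 0 < ε → ‖T ε‖ ≤ C) {D : Set E} (hD : Dense D)
    (hsemi : ∀ ε, 0 < ε → ∀ f ∈ D, T ε (T ε f) = T (ε + ε) f) {L : E →L[ℂ] E}
    (hL : ∀ f, Tendsto (fun ε => T ε f) (𝓝[>] 0) (𝓝 (L f))) (f : E) : L (L f) = L f := by
  have hcl : IsClosed {f | L (L f) = L f} :=
    isClosed_eq (L.continuous.comp L.continuous) L.continuous
  refine hcl.closure_subset_iff.2 (fun f hf => ?_) (hD f)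
  have h1 := tendsto_apply_tendsto hT hL (hL f)
  have hdouble : Tendsto (fun ε : ℝ => ε + ε) (𝓝[>] 0) (𝓝[>] 0) := by
    refine tendsto_nhdsWithin_iff.2 ⟨?_, ?_⟩
    · have : Tendsto (fun ε : ℝ => ε + ε) (𝓝 0) (𝓝 (0 + 0)) := tendsto_id.add tendsto_id
      rw [add_zero] at this
      exact this.mono_left nhdsWithin_le_nhds
    · filter_upwards [self_mem_nhdsWithin] with ε hε
      have : 0 < ε := hε
      simpa using this
  have h2 := (hL f).comp hdouble
  refine tendsto_nhds_unique (h1.congr' ?_) h2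
  filter_upwards [self_mem_nhdsWithin] with ε hε
  exact hsemi ε hε f hf

/-! ### The Leray transform as an operator -/

section Operator

variable {γ c : ℝ}

theorem coeFn_ae_eq_sigma (hc : 0 < c) (hγ : 1 < γ) {f g : hypersurface γ → ℂ}
    (h : f =ᵐ[preferredMeasureWith c γ] g) : f =ᵐ[sigma γ] g :=
  (sigma_absolutelyContinuous_preferred hc hγ).ae_le h

theorem exists_shiftOp_bound (hc : 0 < c) (hγ : 1 < γ) :
    ∃ C : ℝ, 0 ≤ C ∧ ∀ ε (hε : 0 < ε) (f : Lp ℂ 2 (preferredMeasureWith c γ)),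
      ‖(memLp_shiftLeray hc hγ hε (Lp.stronglyMeasurable f) (Lp.memLp f)).toLp _‖ ≤ C * ‖f‖ := by
  obtain ⟨C, hCt, hC⟩ := exists_eLpNorm_shiftLeray_le hc hγ
  refine ⟨C.toReal, ENNReal.toReal_nonneg, fun ε hε f => ?_⟩
  rw [Lp.norm_toLp, Lp.norm_def, ← ENNReal.toReal_mul]
  exact ENNReal.toReal_mono (ENNReal.mul_ne_top hCt (Lp.memLp f).2.ne)
    (hC ε hε f (Lp.stronglyMeasurable f) (Lp.memLp f))

/-- The Leray integral at height `ε` as a bounded operator on `L²`. -/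
def shiftOpOfPos (hc : 0 < c) (hγ : 1 < γ) {ε : ℝ} (hε : 0 < ε) :
    Lp ℂ 2 (preferredMeasureWith c γ) →L[ℂ] Lp ℂ 2 (preferredMeasureWith c γ) :=
  LinearMap.mkContinuous
    { toFun := fun f => (memLp_shiftLeray hc hγ hε (Lp.stronglyMeasurable f) (Lp.memLp f)).toLp _
      map_add' := fun f g => by
        rw [← MemLp.toLp_add]
        refine (MemLp.toLp_eq_toLp_iff _ _).2 (Eventually.of_forall fun ζ => ?_)
        rw [shiftLeray_congr_ae ε (coeFn_ae_eq_sigma hc hγ (Lp.coeFn_add f g)),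
          shiftLeray_add hc hγ hε (Lp.memLp f) (Lp.memLp g)]
      map_smul' := fun a f => by
        rw [RingHom.id_apply, ← MemLp.toLp_const_smul]
        refine (MemLp.toLp_eq_toLp_iff _ _).2 (Eventually.of_forall fun ζ => ?_)
        rw [shiftLeray_congr_ae ε (coeFn_ae_eq_sigma hc hγ (Lp.coeFn_smul a f)),
          shiftLeray_smul] }
    (exists_shiftOp_bound hc hγ).choose
    fun f => (exists_shiftOp_bound hc hγ).choose_spec.2 ε hε f

/-- The Leray integral at height `ε` as a bounded operator on `L²` (and `0` if `ε ≤ 0`). -/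
def shiftOp (hc : 0 < c) (hγ : 1 < γ) (ε : ℝ) :
    Lp ℂ 2 (preferredMeasureWith c γ) →L[ℂ] Lp ℂ 2 (preferredMeasureWith c γ) :=
  if hε : 0 < ε then shiftOpOfPos hc hγ hε else 0

theorem shiftOp_apply (hc : 0 < c) (hγ : 1 < γ) {ε : ℝ} (hε : 0 < ε)
    (f : Lp ℂ 2 (preferredMeasureWith c γ)) : shiftOp hc hγ ε f =
      (memLp_shiftLeray hc hγ hε (Lp.stronglyMeasurable f) (Lp.memLp f)).toLp _ := by
  rw [shiftOp, dif_pos hε]; rfl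

theorem coeFn_shiftOp (hc : 0 < c) (hγ : 1 < γ) {ε : ℝ} (hε : 0 < ε)
    (f : Lp ℂ 2 (preferredMeasureWith c γ)) :
    (shiftOp hc hγ ε f : hypersurface γ → ℂ) =ᵐ[preferredMeasureWith c γ] shiftLeray γ ε f := by
  rw [shiftOp_apply hc hγ hε]
  exact MemLp.coeFn_toLp _

theorem exists_norm_shiftOp_le (hc : 0 < c) (hγ : 1 < γ) :
    ∃ C : ℝ, ∀ ε, 0 < ε → ‖shiftOp hc hγ ε‖ ≤ C := by
  refine ⟨(exists_shiftOp_bound hc hγ).choose, fun ε hε => ?_⟩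
  rw [shiftOp, dif_pos hε]
  exact LinearMap.mkContinuous_norm_le _ (exists_shiftOp_bound hc hγ).choose_spec.1 _

/-- The elements of `L²` that are integrable with respect to `σ`. -/
def niceSet (c γ : ℝ) : Set (Lp ℂ 2 (preferredMeasureWith c γ)) :=
  {f | Integrable f (sigma γ)}

theorem dense_niceSet (hc : 0 < c) (hγ : 1 < γ) : Dense (niceSet c γ) := by
  intro f
  obtain ⟨F, hFm, hF2, hF1, hlim⟩ := exists_seq_memLp_preferred_integrable hc hγ
    (Lp.stronglyMeasurable f) (Lp.memLp f)
  refine mem_closure_of_tendsto (f := fun n => (hF2 n).toLp (F n)) (b := atTop) ?_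
    (Eventually.of_forall fun n => ?_)
  · rw [← Lp.toLp_coeFn f (Lp.memLp f), Lp.tendsto_Lp_iff_tendsto_eLpNorm'']
    exact hlim
  · exact (hF1 n).congr (coeFn_ae_eq_sigma hc hγ (hF2 n).coeFn_toLp).symm

theorem tendsto_norm_shiftOp_sub (hc : 0 < c) (hγ : 1 < γ) {f : Lp ℂ 2 (preferredMeasureWith c γ)}
    (hf : f ∈ niceSet c γ) : Tendsto (fun r : ℝ × ℝ => ‖shiftOp hc hγ r.1 f - shiftOp hc hγ r.2 f‖)
      (𝓝[>] 0 ×ˢ 𝓝[>] 0) (𝓝 0) := by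
  have hpos : ∀ᶠ r : ℝ × ℝ in 𝓝[>] 0 ×ˢ 𝓝[>] 0, 0 < r.1 ∧ 0 < r.2 :=
    (eventually_mem_nhdsWithin (a := (0 : ℝ)) (s := Set.Ioi 0)).prod_mk
      (eventually_mem_nhdsWithin (a := (0 : ℝ)) (s := Set.Ioi 0))
  have h := (ENNReal.tendsto_toReal ENNReal.zero_ne_top).comp
    (tendsto_eLpNorm_shiftLeray_sub hc hγ (Lp.stronglyMeasurable f) hf (Lp.memLp f))
  rw [ENNReal.toReal_zero] at h
  refine h.congr' ?_
  filter_upwards [hpos] with r ⟨h1, h2⟩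
  rw [shiftOp_apply hc hγ h1, shiftOp_apply hc hγ h2, ← MemLp.toLp_sub, Lp.norm_toLp]
  rfl

theorem shiftOp_shiftOp (hc : 0 < c) (hγ : 1 < γ) {ε : ℝ} (hε : 0 < ε)
    {f : Lp ℂ 2 (preferredMeasureWith c γ)} (hf : f ∈ niceSet c γ) :
    shiftOp hc hγ ε (shiftOp hc hγ ε f) = shiftOp hc hγ (ε + ε) f := by
  rw [shiftOp_apply hc hγ hε, shiftOp_apply hc hγ (add_pos hε hε)]
  refine (MemLp.toLp_eq_toLp_iff _ _).2 (Eventually.of_forall fun ζ => ?_)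
  rw [shiftLeray_congr_ae ε (coeFn_ae_eq_sigma hc hγ (coeFn_shiftOp hc hγ hε f)),
    shiftLeray_shiftLeray hc hγ hε hε (Lp.stronglyMeasurable f) hf (Lp.memLp f)]

/-- Absolute convergence and membership in `L²` hold for every `f`, so only the strong convergence
of the operators at height `ε` distinguishes `L`. -/
theorem isLerayTransform_iff (hc : 0 < c) (hγ : 1 < γ)
    (L : Lp ℂ 2 (preferredMeasureWith c γ) →L[ℂ] Lp ℂ 2 (preferredMeasureWith c γ)) :
    IsLerayTransform γ (preferredMeasureWith c γ) L ↔
      ∀ f, Tendsto (fun ε => shiftOp hc hγ ε f) (𝓝[>] 0) (𝓝 (L f)) := by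
  have key : ∀ f : Lp ℂ 2 (preferredMeasureWith c γ),
      Tendsto (fun ε : ℝ => eLpNorm (fun ζ : hypersurface γ =>
        lerayIntegral γ f (ζ.1.1, ζ.1.2 + (ε : ℂ) * I) - L f ζ) 2 (preferredMeasureWith c γ))
          (𝓝[>] 0) (𝓝 0) ↔ Tendsto (fun ε => shiftOp hc hγ ε f) (𝓝[>] 0) (𝓝 (L f)) := by
    intro f
    rw [Lp.tendsto_Lp_iff_tendsto_eLpNorm']
    refine tendsto_congr' ?_
    filter_upwards [self_mem_nhdsWithin] with ε hε
    refine eLpNorm_congr_ae ?_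
    filter_upwards [coeFn_shiftOp hc hγ hε f] with ζ hζ
    rw [Pi.sub_apply, hζ, shiftLeray]
  refine forall_congr' fun f => ?_
  rw [key]
  refine ⟨fun h => h.2.2, fun h => ⟨fun z hz => integrable_mul_lerayKernel hc hγ (Lp.memLp f) hz,
    fun ε hε => memLp_shiftLeray hc hγ hε (Lp.stronglyMeasurable f) (Lp.memLp f), h⟩⟩

theorem isLerayTransform_leray (hc : 0 < c) (hγ : 1 < γ) :
    IsLerayTransform γ (preferredMeasureWith c γ) (leray γ (preferredMeasureWith c γ)) := by
  obtain ⟨C, hC⟩ := exists_norm_shiftOp_le hc hγ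
  obtain ⟨L, hL⟩ := exists_strong_limit hC (dense_niceSet hc hγ)
    fun f hf => tendsto_norm_shiftOp_sub hc hγ hf
  have h : ∃ L, IsLerayTransform γ (preferredMeasureWith c γ) L :=
    ⟨L, (isLerayTransform_iff hc hγ L).2 hL⟩
  rw [leray, dif_pos h]
  exact h.choose_spec

theorem tendsto_shiftOp (hc : 0 < c) (hγ : 1 < γ) (f : Lp ℂ 2 (preferredMeasureWith c γ)) :
    Tendsto (fun ε => shiftOp hc hγ ε f) (𝓝[>] 0)
      (𝓝 (leray γ (preferredMeasureWith c γ) f)) :=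
  (isLerayTransform_iff hc hγ _).1 (isLerayTransform_leray hc hγ) f

theorem leray_leray (hc : 0 < c) (hγ : 1 < γ) (f : Lp ℂ 2 (preferredMeasureWith c γ)) :
    leray γ (preferredMeasureWith c γ) (leray γ (preferredMeasureWith c γ) f) =
      leray γ (preferredMeasureWith c γ) f := by
  obtain ⟨C, hC⟩ := exists_norm_shiftOp_le hc hγ
  exact apply_apply_of_semigroup hC (dense_niceSet hc hγ)
    (fun ε hε f hf => shiftOp_shiftOp hc hγ hε hf) (tendsto_shiftOp hc hγ) f

end Operator

/-! ### Change of variables under the dualization map -/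

theorem lintegral_Ioi_rpow {a : ℝ} (ha : 0 < a) (G : ℝ → ENNReal) :
    ∫⁻ r in Set.Ioi (0 : ℝ), ENNReal.ofReal (a * r ^ (a - 1)) * G (r ^ a) =
      ∫⁻ r in Set.Ioi (0 : ℝ), G r := by
  have himg : (fun r : ℝ => r ^ a) '' Set.Ioi 0 = Set.Ioi 0 := by
    ext y
    constructor
    · rintro ⟨x, hx, rfl⟩
      exact Real.rpow_pos_of_pos hx a
    · intro hy
      exact ⟨y ^ a⁻¹, Real.rpow_pos_of_pos hy _, Real.rpow_inv_rpow (le_of_lt hy) ha.ne'⟩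
  have hinj : Set.InjOn (fun r : ℝ => r ^ a) (Set.Ioi 0) := fun x hx y hy h =>
    (Real.rpow_left_inj (le_of_lt hx) (le_of_lt hy) ha.ne').1 h
  have h := lintegral_image_eq_lintegral_abs_deriv_mul (f := fun r : ℝ => r ^ a)
    (f' := fun r => a * r ^ (a - 1)) measurableSet_Ioi
    (fun x hx => (Real.hasDerivAt_rpow_const (Or.inl (ne_of_gt hx))).hasDerivWithinAt) hinj G
  rw [himg] at h
  rw [h]
  refine setLIntegral_congr_fun measurableSet_Ioi fun x hx => ?_
  have : 0 < x := hx
  rw [abs_of_nonneg (by positivity)]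

theorem norm_polarCoord_symm {r : ℝ} (hr : 0 < r) (θ : ℝ) : ‖Complex.polarCoord.symm (r, θ)‖ = r := by
  rw [Complex.norm_polarCoord_symm, abs_of_pos hr]

/-- The radial power map `z ↦ |z| ^ (a - 1) z` of the plane. -/
theorem lintegral_comp_radial {a : ℝ} (ha : 0 < a) {F : ℂ → ENNReal} (hF : Measurable F) :
    ∫⁻ z : ℂ, ENNReal.ofReal (a * ‖z‖ ^ (2 * (a - 1))) * F (z * ((‖z‖ ^ (a - 1) : ℝ) : ℂ)) =
      ∫⁻ z : ℂ, F z := by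
  rw [← Complex.lintegral_comp_polarCoord_symm, ← Complex.lintegral_comp_polarCoord_symm F]
  have hsm : ∀ G : ℝ × ℝ → ENNReal, AEMeasurable G →
      ∫⁻ p in polarCoord.target, G p = ∫⁻ θ in Set.Ioo (-Real.pi) Real.pi,
        (∫⁻ r in Set.Ioi (0 : ℝ), G (r, θ)) := by
    intro G hG
    rw [polarCoord_target, Measure.volume_eq_prod, ← Measure.prod_restrict,
      lintegral_prod_symm]
    rw [Measure.prod_restrict, ← Measure.volume_eq_prod]
    exact hG.restrict
  have hmeas : Measurable fun p : ℝ × ℝ => Complex.polarCoord.symm p := by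
    simp only [Complex.polarCoord_symm_apply]
    fun_prop
  rw [hsm _ (by simp only [smul_eq_mul]; fun_prop), hsm _ (by simp only [smul_eq_mul]; fun_prop)]
  refine lintegral_congr fun θ => ?_
  rw [← lintegral_Ioi_rpow ha fun r => ENNReal.ofReal r • F (Complex.polarCoord.symm (r, θ))]
  refine setLIntegral_congr_fun measurableSet_Ioi fun r hr => ?_
  have hr0 : 0 < r := hr
  simp only [norm_polarCoord_symm hr0, smul_eq_mul]
  symm
  rw [← mul_assoc, ← mul_assoc, ← ENNReal.ofReal_mul (by positivity), ← ENNReal.ofReal_mul hr0.le]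
  congr 2
  · have e1 : r ^ (2 * (a - 1)) = r ^ (a - 1) * r ^ (a - 1) := by
      rw [← Real.rpow_add hr0]; ring_nf
    have e2 : r ^ a = r * r ^ (a - 1) := by
      rw [← Real.rpow_one_add' hr0.le (by linarith)]; ring_nf
    rw [e1, e2]; ring
  · have e2 : r ^ a = r * r ^ (a - 1) := by
      rw [← Real.rpow_one_add' hr0.le (by linarith)]; ring_nf
    rw [e2]
    simp only [Complex.polarCoord_symm_apply]
    push_cast
    ring

theorem lintegral_comp_conj (F : ℂ → ENNReal) (hF : Measurable F) :
    ∫⁻ z : ℂ, F (conj z) = ∫⁻ z : ℂ, F z :=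
  (conjLIE.measurePreserving).lintegral_comp hF

theorem lintegral_comp_div_real {a : ℝ} (ha : a ≠ 0) (F : ℝ → ENNReal) (hF : Measurable F) :
    ∫⁻ s : ℝ, F (s / a) = ENNReal.ofReal |a| * ∫⁻ s : ℝ, F s := by
  have h := Real.map_volume_mul_left (inv_ne_zero ha)
  rw [inv_inv] at h
  rw [← smul_eq_mul, ← lintegral_smul_measure, ← h, lintegral_map hF (by fun_prop)]
  simp only [div_eq_inv_mul]

/-- The dualization map in the coordinates of `param`. -/
def coordDual (γ : ℝ) (p : ℂ × ℝ) : ℂ × ℝ :=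
  (conj p.1 * ((‖p.1‖ ^ (γ - 2) : ℝ) : ℂ), p.2 / (1 - γ))

theorem measurable_coordDual (γ : ℝ) : Measurable (coordDual γ) := by
  have : Measurable fun z : ℂ => conj z := continuous_conj.measurable
  unfold coordDual
  fun_prop

theorem norm_coordDual_fst {γ : ℝ} (hγ : 1 < γ) (p : ℂ × ℝ) :
    ‖(coordDual γ p).1‖ = ‖p.1‖ ^ (γ - 1) :=
  norm_dualPoint_fst hγ (p.1, 0)

theorem dualMap_paramEquiv {γ : ℝ} (hγ : 1 < γ) (p : ℂ × ℝ) :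
    dualMap hγ (paramEquiv γ p) = paramEquiv γ.conjExponent (coordDual γ p) := by
  apply (paramEquiv γ.conjExponent).symm.injective
  rw [MeasurableEquiv.symm_apply_apply]
  refine Prod.ext rfl ?_
  change (((p.2 : ℂ) + ((‖p.1‖ ^ γ : ℝ) : ℂ) * I - I * (γ : ℂ) * ((‖p.1‖ ^ γ : ℝ) : ℂ)) /
    (1 - (γ : ℂ))).re = p.2 / (1 - γ)
  have h1 : (1 - (γ : ℂ)) = ((1 - γ : ℝ) : ℂ) := by push_cast; ring
  rw [h1, div_ofReal_re]
  congr 1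
  simp only [sub_re, add_re, mul_re, mul_im, ofReal_re, ofReal_im, I_re, I_im]
  ring

/-- The map is a conjugation, a radial power map with exponent `γ - 1`, whose Jacobian is
`(γ-1)|z|^{2(γ-2)}`, and a division of `s` by `1 - γ`. The factors `γ - 1` cancel, and only the
power of `|z|` is left as weight. -/
theorem map_coordDual {γ : ℝ} (hγ : 1 < γ) :
    (wtProd (2 * (γ - 2))).map (coordDual γ) = volume := by
  have hc : Measurable fun z : ℂ => conj z := continuous_conj.measurable
  have hd := measurable_coordDual γ
  refine Measure.ext_of_lintegral _ fun F hF => ?_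
  rw [lintegral_map hF hd, wtProd, lintegral_powWeight (by fun_prop) _ (by fun_prop),
    Measure.volume_eq_prod, lintegral_prod _ (by fun_prop), lintegral_prod _ (by fun_prop)]
  have hG : Measurable fun z : ℂ => ∫⁻ s : ℝ, F (z, s) := hF.lintegral_prod_right'
  have h2 := lintegral_comp_radial (by linarith : 0 < γ - 1) (hG.comp hc)
  simp only [Function.comp] at h2
  rw [← lintegral_comp_conj _ hG, ← h2]
  refine lintegral_congr fun z => ?_
  have h1 := lintegral_comp_div_real (by linarith : (1 - γ) ≠ 0)
    (fun s => F (conj z * ((‖z‖ ^ (γ - 2) : ℝ) : ℂ), s)) (by fun_prop)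
  simp only [coordDual]
  rw [lintegral_const_mul _ (by fun_prop), h1, ← mul_assoc, ← ENNReal.ofReal_mul (by positivity), abs_of_neg (by linarith)]
  congr 2
  · rw [show γ - 1 - 1 = γ - 2 by ring]; ring
  · simp only [map_mul, conj_ofReal]
    rw [show γ - 1 - 1 = γ - 2 by ring]

/-- Since `|w₁| = |ζ₁|^{γ-1}`, the weight `e'` pulls back to `(γ - 1) e'`, to which the Jacobian
adds `2(γ - 2)`. -/
theorem map_coordDual_wtProd {γ : ℝ} (hγ : 1 < γ) {e e' : ℝ} (h : e = 2 * (γ - 2) + (γ - 1) * e') :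
    (wtProd e).map (coordDual γ) = wtProd e' := by
  have hd := measurable_coordDual γ
  refine Measure.ext_of_lintegral _ fun F hF => ?_
  have key : ∀ G : ℂ × ℝ → ENNReal, Measurable G → ∫⁻ p, G p =
      ∫⁻ p : ℂ × ℝ, ENNReal.ofReal (‖p.1‖ ^ (2 * (γ - 2))) * G (coordDual γ p) := by
    intro G hG
    conv_lhs => rw [← map_coordDual hγ]
    rw [lintegral_map hG hd, wtProd, lintegral_powWeight (by fun_prop) _ (by fun_prop)]
  rw [lintegral_map hF hd, wtProd, wtProd, lintegral_powWeight (by fun_prop) _ (by fun_prop),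
    lintegral_powWeight (by fun_prop) _ (by fun_prop), 
    key (fun p => ENNReal.ofReal (‖p.1‖ ^ e') * F p) (by fun_prop)]
  refine lintegral_congr_ae (ae_norm_fst_pos.mono fun p hp => ?_)
  simp only [norm_coordDual_fst hγ]
  rw [← mul_assoc, ← ENNReal.ofReal_mul (by positivity), ← Real.rpow_mul hp.le,
    ← Real.rpow_add hp, h]

theorem map_dualMap {γ : ℝ} (hγ : 1 < γ) {e e' : ℝ} (h : e = 2 * (γ - 2) + (γ - 1) * e') :
    ((wtProd e).map (paramEquiv γ)).map (dualMap hγ) =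
      (wtProd e').map (paramEquiv γ.conjExponent) := by
  rw [Measure.map_map (dualMap hγ).measurable (paramEquiv γ).measurable,
    ← map_coordDual_wtProd hγ h, Measure.map_map (paramEquiv γ.conjExponent).measurable
      (measurable_coordDual γ)]
  congr 1
  exact funext (dualMap_paramEquiv hγ)

theorem map_dualMap_sigma {γ : ℝ} (hγ : 1 < γ) :
    (sigma γ).map (dualMap hγ) = sigma γ.conjExponent := by
  rw [sigma_eq_map, sigma_eq_map]
  refine map_dualMap hγ ?_
  have : γ - 1 ≠ 0 := by linarith
  rw [Real.conjExponent]; field_simp; ring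

theorem preferredDualMeasure_eq {γ : ℝ} (hγ : 1 < γ) : preferredDualMeasure hγ =
    ENNReal.ofReal (preferredFactor (normConst γ) γ.conjExponent) •
      (wtProd (5 * (γ - 2) / 3)).map (paramEquiv γ) := by
  have h : 5 * (γ - 2) / 3 = 2 * (γ - 2) + (γ - 1) * ((γ.conjExponent - 2) / 3) := by
    have : γ - 1 ≠ 0 := by linarith
    rw [Real.conjExponent]; field_simp; ring
  apply (MeasurableEquiv.map_measurableEquiv_injective (dualMap hγ))
  rw [(measurePreserving_dualMap hγ).map_eq, preferredMeasureOnDual, preferredMeasureWith_eq,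
    Measure.map_smul, map_dualMap hγ h]

/-! ### The constants -/

theorem normConst_pos {γ : ℝ} (hγ : 1 < γ) : 0 < normConst γ := by
  have h1 : 0 < γ - 1 := by linarith
  have h0 : 0 < γ := by linarith
  unfold normConst
  positivity

theorem preferredFactor_normConst {γ : ℝ} (hγ : 1 < γ) : preferredFactor (normConst γ) γ =
    γ ^ 2 / (4 * Real.pi ^ 2) * (γ - 1) ^ (1 / 3 : ℝ) := by
  have h1 : 0 < γ - 1 := by linarith
  have h0 : 0 < γ := by linarith
  have e1 : γ ^ 2 = γ ^ (2 / 3 : ℝ) * γ ^ (4 / 3 : ℝ) := by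
    rw [← Real.rpow_add h0, ← Real.rpow_natCast]; norm_num
  have e2 : (γ - 1) ^ (2 / 3 : ℝ) = (γ - 1) ^ (1 / 3 : ℝ) * (γ - 1) ^ (1 / 3 : ℝ) := by
    rw [← Real.rpow_add h1]; norm_num
  have h2 : 0 < (γ - 1) ^ (1 / 3 : ℝ) := Real.rpow_pos_of_pos h1 _
  rw [preferredFactor, normConst, Real.mul_rpow h0.le h1.le, e1, e2]
  field_simp

/-- Its product with the factor on `M_γ` is the square of the constant `γ²/(4π²)` of `ν`: this is
the purpose of `normConst`. -/
theorem preferredFactor_normConst_conjExponent {γ : ℝ} (hγ : 1 < γ) :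
    preferredFactor (normConst γ) γ.conjExponent =
      γ ^ 2 / (4 * Real.pi ^ 2) * ((γ - 1) ^ (1 / 3 : ℝ))⁻¹ := by
  have h1 : 0 < γ - 1 := by linarith
  have h0 : 0 < γ := by linarith
  have e0 : γ.conjExponent - 1 = (γ - 1)⁻¹ := by rw [Real.conjExponent]; field_simp; ring
  have e1 : γ ^ 2 = γ ^ (2 / 3 : ℝ) * γ ^ (4 / 3 : ℝ) := by
    rw [← Real.rpow_add h0, ← Real.rpow_natCast]; norm_num
  have e2 : (γ - 1) ^ (2 / 3 : ℝ) = (γ - 1) ^ (1 / 3 : ℝ) * (γ - 1) ^ (1 / 3 : ℝ) := by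
    rw [← Real.rpow_add h1]; norm_num
  have e3 : (γ - 1) ^ (4 / 3 : ℝ) = (γ - 1) ^ (1 / 3 : ℝ) * (γ - 1) ^ (1 / 3 : ℝ) *
      (γ - 1) ^ (1 / 3 : ℝ) * (γ - 1) ^ (1 / 3 : ℝ) := by
    simp only [← Real.rpow_add h1]; norm_num
  have h2 : 0 < (γ - 1) ^ (1 / 3 : ℝ) := Real.rpow_pos_of_pos h1 _
  rw [preferredFactor, normConst, e0, Real.conjExponent, Real.mul_rpow h0.le h1.le,
    Real.div_rpow h0.le h1.le, Real.inv_rpow h1.le, e1, e2, e3]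
  field_simp

/-! ### Duality of weighted `L²` spaces -/

section Duality

variable {X : Type*} [MeasurableSpace X] {m : Measure X} {d : X → ℝ}

theorem powWeight_zero : powWeight m d 0 = m := by
  simp [powWeight]

theorem eLpNorm_inv_mul_conj (hd : Measurable d) (hpos : ∀ᵐ x ∂m, 0 < d x) {g : X → ℂ}
    (hg : AEStronglyMeasurable g m) :
    eLpNorm (fun x => ((d x)⁻¹ : ℂ) * conj (g x)) 2 (powWeight m d 2) = eLpNorm g 2 m := by
  have hc : Measurable fun z : ℂ => conj z := continuous_conj.measurable
  have hg' := hg.aemeasurable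
  rw [eLpNorm_two_eq, eLpNorm_two_eq,
    lintegral_powWeight (f := fun x => ‖((d x)⁻¹ : ℂ) * conj (g x)‖ₑ ^ 2) hd 2 (by fun_prop)]
  congr 1
  refine lintegral_congr_ae (hpos.mono fun x hx => ?_)
  have h1 : ‖((d x)⁻¹ : ℂ)‖ₑ = ENNReal.ofReal (d x)⁻¹ := by
    rw [← ofReal_inv, ← ofReal_norm, norm_real, Real.norm_of_nonneg (by positivity)]
  simp only [enorm_mul, h1, mul_pow, RCLike.enorm_conj]
  rw [← mul_assoc, ← ENNReal.ofReal_pow (by positivity), ← ENNReal.ofReal_mul (by positivity)]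
  have h2 : d x ^ (2 : ℝ) * (d x)⁻¹ ^ 2 = 1 := by
    rw [Real.rpow_two]; field_simp
  rw [h2, ENNReal.ofReal_one, one_mul]

theorem memLp_inv_mul_conj (hd : Measurable d) (hpos : ∀ᵐ x ∂m, 0 < d x) {g : X → ℂ}
    (hg : MemLp g 2 m) :
    MemLp (fun x => ((d x)⁻¹ : ℂ) * conj (g x)) 2 (powWeight m d 2) := by
  have hc : Continuous fun z : ℂ => conj z := continuous_conj
  have h1 : AEStronglyMeasurable (fun x => ((d x)⁻¹ : ℂ)) m :=
    (Measurable.stronglyMeasurable (by fun_prop)).aestronglyMeasurable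
  refine ⟨(h1.mul (hc.comp_aestronglyMeasurable hg.1)).mono_ac
    (powWeight_absolutelyContinuous 2), ?_⟩
  rw [eLpNorm_inv_mul_conj hd hpos hg.1]
  exact hg.2

/-- The conjugate linear isometry `g ↦ d⁻¹ ḡ` from `L²(m)` to `L²(d² m)`. -/
def conjDivIsometry (hd : Measurable d) (hpos : ∀ᵐ x ∂m, 0 < d x) :
    Lp ℂ 2 m →ₗᵢ⋆[ℂ] Lp ℂ 2 (powWeight m d 2) where
  toFun g := (memLp_inv_mul_conj hd hpos (Lp.memLp g)).toLp _
  map_add' f g := by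
    rw [← MemLp.toLp_add]
    refine (MemLp.toLp_eq_toLp_iff _ _).2 ?_
    filter_upwards [(powWeight_absolutelyContinuous 2).ae_le (Lp.coeFn_add f g)] with x hx
    simp only [hx, Pi.add_apply, map_add, mul_add]
  map_smul' a f := by
    rw [← MemLp.toLp_const_smul]
    refine (MemLp.toLp_eq_toLp_iff _ _).2 ?_
    filter_upwards [(powWeight_absolutelyContinuous 2).ae_le (Lp.coeFn_smul a f)] with x hx
    simp only [hx, Pi.smul_apply, smul_eq_mul, map_mul]
    ring
  norm_map' g := by
    change ‖(memLp_inv_mul_conj hd hpos (Lp.memLp g)).toLp _‖ = _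
    rw [Lp.norm_toLp, eLpNorm_inv_mul_conj hd hpos (Lp.memLp g).1, Lp.norm_def]

theorem coeFn_conjDivIsometry (hd : Measurable d) (hpos : ∀ᵐ x ∂m, 0 < d x) (g : Lp ℂ 2 m) :
    conjDivIsometry hd hpos g =ᵐ[powWeight m d 2] fun x => ((d x)⁻¹ : ℂ) * conj (g x) :=
  (memLp_inv_mul_conj hd hpos (Lp.memLp g)).coeFn_toLp

theorem surjective_conjDivIsometry (hd : Measurable d) (hpos : ∀ᵐ x ∂m, 0 < d x) :
    Function.Surjective (conjDivIsometry hd hpos) := by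
  intro h
  have hc : Continuous fun z : ℂ => conj z := continuous_conj
  have hac := absolutelyContinuous_powWeight hd hpos 2
  have hpos' := (powWeight_absolutelyContinuous (m := m) (d := d) 2).ae_le hpos
  have h1 : AEStronglyMeasurable (fun x => (d x : ℂ)) m :=
    (Measurable.stronglyMeasurable (by fun_prop)).aestronglyMeasurable
  have hgm : AEStronglyMeasurable (fun x => (d x : ℂ) * conj (h x)) m :=
    h1.mul (hc.comp_aestronglyMeasurable ((Lp.memLp h).1.mono_ac hac))
  have hinv : (fun x => ((d x)⁻¹ : ℂ) * conj ((d x : ℂ) * conj (h x))) =ᵐ[powWeight m d 2] h := by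
    filter_upwards [hpos'] with x hx
    have : (d x : ℂ) ≠ 0 := by exact_mod_cast hx.ne'
    simp only [map_mul, conj_conj, conj_ofReal]
    field_simp
  have hg : MemLp (fun x => (d x : ℂ) * conj (h x)) 2 m := by
    refine ⟨hgm, ?_⟩
    rw [← eLpNorm_inv_mul_conj hd hpos hgm, eLpNorm_congr_ae hinv]
    exact (Lp.memLp h).2
  refine ⟨hg.toLp _, Lp.ext ?_⟩
  filter_upwards [coeFn_conjDivIsometry hd hpos (hg.toLp _), hinv,
    (powWeight_absolutelyContinuous 2).ae_le hg.coeFn_toLp] with x h1 h2 h3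
  rw [h1, h3, h2]

/-- If `μ = d² m` and `ν = d m`, the pairing with respect to `ν` identifies `L²(m)` isometrically
with the dual of `L²(μ)`. -/
theorem exists_dual_isometry (hd : Measurable d) (hpos : ∀ᵐ x ∂m, 0 < d x) {μ ν : Measure X}
    (hμ : μ = powWeight m d 2) (hν : ν = powWeight m d 1) :
    ∃ J : Lp ℂ 2 m ≃ₗᵢ[ℂ] (Lp ℂ 2 μ →L[ℂ] ℂ), ∀ g f, J g f = ∫ x, f x * g x ∂ν := by
  subst hμ hν
  -- `J` is linear as the composition of two conjugate-linear isometries, `g ↦ d⁻¹ ḡ` and the Riesz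
  -- map.
  refine ⟨(LinearIsometryEquiv.ofSurjective (conjDivIsometry hd hpos)
    (surjective_conjDivIsometry hd hpos)).trans (InnerProductSpace.toDual ℂ _), fun g f => ?_⟩
  change inner ℂ (conjDivIsometry hd hpos g) f = _
  rw [L2.inner_def]
  have h2 : ∫ x, inner ℂ (conjDivIsometry hd hpos g x) (f x) ∂(powWeight m d 2) =
      ∫ x, ((d x)⁻¹ : ℂ) * g x * f x ∂(powWeight m d 2) := by
    refine integral_congr_ae ((coeFn_conjDivIsometry hd hpos g).mono fun x hx => ?_)
    simp only [hx, RCLike.inner_apply, map_mul, conj_conj]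
    rw [← ofReal_inv, conj_ofReal]
    ring
  rw [h2, integral_powWeight hd hpos, integral_powWeight hd hpos]
  refine integral_congr_ae (hpos.mono fun x hx => ?_)
  have : (d x : ℂ) ≠ 0 := by exact_mod_cast hx.ne'
  simp only [Real.rpow_one, Real.rpow_two]
  push_cast
  field_simp

theorem integrable_mul_of_memLp (hd : Measurable d) (hpos : ∀ᵐ x ∂m, 0 < d x) {μ ν : Measure X}
    (hμ : μ = powWeight m d 2) (hν : ν = powWeight m d 1) {f g : X → ℂ} (hf : MemLp f 2 μ)
    (hg : MemLp g 2 m) : Integrable (fun x => f x * g x) ν := by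
  subst hμ hν
  refine integrable_mul_powWeight hd hpos (a := 2) (b := 0) (by norm_num) hf ?_
  rwa [powWeight_zero]

end Duality

/-! ### The density of the preferred measure -/

/-- The density of `ν` with respect to the preferred dual measure. -/
def dualDensity (γ : ℝ) (ζ : hypersurface γ) : ℝ :=
  (γ - 1) ^ (1 / 3 : ℝ) * ‖ζ.1.1‖ ^ (-(2 * (γ - 2) / 3))

theorem measurable_dualDensity (γ : ℝ) : Measurable (dualDensity γ) := by
  have h : Measurable fun ζ : hypersurface γ => (ζ : ℂ × ℂ) := measurable_subtype_coe
  unfold dualDensity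
  fun_prop

theorem dualDensity_paramEquiv (γ : ℝ) (p : ℂ × ℝ) : dualDensity γ (paramEquiv γ p) =
    (γ - 1) ^ (1 / 3 : ℝ) * ‖p.1‖ ^ (-(2 * (γ - 2) / 3)) := rfl

theorem powWeight_dualDensity {γ : ℝ} (hγ : 1 < γ) (e : ℝ) :
    powWeight (preferredDualMeasure hγ) (dualDensity γ) e =
      ENNReal.ofReal (preferredFactor (normConst γ) γ.conjExponent * (γ - 1) ^ (e / 3)) •
        (wtProd (5 * (γ - 2) / 3 - 2 * (γ - 2) / 3 * e)).map (paramEquiv γ) := by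
  have h1 : 0 < γ - 1 := by linarith
  have hm := measurable_dualDensity γ
  have hp : Measurable (paramEquiv γ) := (paramEquiv γ).measurable
  have hP := preferredFactor_pos (normConst_pos hγ) (one_lt_conjExponent hγ)
  refine Measure.ext_of_lintegral _ fun F hF => ?_
  rw [lintegral_powWeight hm _ hF.aemeasurable, preferredDualMeasure_eq, lintegral_smul_measure,
    lintegral_smul_measure, lintegral_map (by fun_prop) hp, lintegral_map hF hp, wtProd, wtProd,
    lintegral_powWeight (by fun_prop) _ (by fun_prop),
    lintegral_powWeight (by fun_prop) _ (by fun_prop), ENNReal.ofReal_mul hP.le, smul_eq_mul,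
    smul_eq_mul, mul_assoc,
    ← lintegral_const_mul (ENNReal.ofReal ((γ - 1) ^ (e / 3))) (by fun_prop)]
  congr 1
  refine lintegral_congr_ae (ae_norm_fst_pos.mono fun p hp => ?_)
  simp only [dualDensity_paramEquiv]
  rw [← mul_assoc, ← mul_assoc, ← ENNReal.ofReal_mul (by positivity),
    ← ENNReal.ofReal_mul (by positivity)]
  congr 2
  rw [Real.mul_rpow (by positivity) (by positivity), ← Real.rpow_mul h1.le, ← Real.rpow_mul hp.le,
    mul_left_comm, ← Real.rpow_add hp]
  ring_nf

/-- Together with `pairingMeasure_eq_powWeight` this says that `ν` is exactly the geometric mean of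
`μ̃` and `μ̃*`, constants included, so that the pairing is isometric and not merely bounded. -/
theorem preferredMeasure_eq_powWeight {γ : ℝ} (hγ : 1 < γ) :
    preferredMeasure γ = powWeight (preferredDualMeasure hγ) (dualDensity γ) 2 := by
  have h1 : 0 < γ - 1 := by linarith
  rw [powWeight_dualDensity, preferredMeasure, preferredMeasureWith_eq,
    preferredFactor_normConst hγ, preferredFactor_normConst_conjExponent hγ]
  have h2 : (γ - 1) ^ (2 / 3 : ℝ) = (γ - 1) ^ (1 / 3 : ℝ) * (γ - 1) ^ (1 / 3 : ℝ) := by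
    rw [← Real.rpow_add h1]; norm_num
  have h3 : 0 < (γ - 1) ^ (1 / 3 : ℝ) := Real.rpow_pos_of_pos h1 _
  congr 2
  · rw [h2]; field_simp
  · congr 1; ring

theorem pairingMeasure_eq_powWeight {γ : ℝ} (hγ : 1 < γ) :
    pairingMeasure γ = powWeight (preferredDualMeasure hγ) (dualDensity γ) 1 := by
  have h1 : 0 < γ - 1 := by linarith
  have h3 : 0 < (γ - 1) ^ (1 / 3 : ℝ) := Real.rpow_pos_of_pos h1 _
  rw [powWeight_dualDensity, pairingMeasure, sigma_eq_map,
    preferredFactor_normConst_conjExponent hγ]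
  congr 2
  · field_simp
  · congr 1; ring

theorem dualDensity_pos_ae {γ : ℝ} (hγ : 1 < γ) :
    ∀ᵐ ζ ∂(preferredDualMeasure hγ), 0 < dualDensity γ ζ := by
  have h1 : 0 < γ - 1 := by linarith
  rw [preferredDualMeasure_eq]
  refine Measure.ae_smul_measure ?_ _
  rw [(paramEquiv γ).measurableEmbedding.ae_map_iff]
  filter_upwards [(powWeight_absolutelyContinuous _).ae_le ae_norm_fst_pos] with p hp
  rw [dualDensity_paramEquiv]
  positivity

theorem exists_pairing_isometry {γ : ℝ} (hγ : 1 < γ) :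
    ∃ J : Lp ℂ 2 (preferredDualMeasure hγ) ≃ₗᵢ[ℂ] (Lp ℂ 2 (preferredMeasure γ) →L[ℂ] ℂ),
      ∀ g f, J g f = pairing γ f g :=
  exists_dual_isometry (measurable_dualDensity γ) (dualDensity_pos_ae hγ)
    (preferredMeasure_eq_powWeight hγ) (pairingMeasure_eq_powWeight hγ)

theorem integrable_pairing {γ : ℝ} (hγ : 1 < γ) (f : Lp ℂ 2 (preferredMeasure γ))
    (g : Lp ℂ 2 (preferredDualMeasure hγ)) :
    Integrable (fun ζ => f ζ * g ζ) (pairingMeasure γ) :=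
  integrable_mul_of_memLp (measurable_dualDensity γ) (dualDensity_pos_ae hγ)
    (preferredMeasure_eq_powWeight hγ) (pairingMeasure_eq_powWeight hγ) (Lp.memLp f) (Lp.memLp g)

/-! ### Transposition of the Leray transform -/

/-- The denominator is, up to sign, the equation of the complex tangent line at `ζ` evaluated at
`z`. In this form the kernel depends on `ζ` only through its dual point. -/
theorem lerayKernel_eq_dualPoint {γ : ℝ} (hγ : 1 < γ) (z ζ : ℂ × ℂ) : lerayKernel γ z ζ =
    1 / (γ * (dualPoint γ ζ).1 * z.1 + I * z.2 + I * (γ - 1) * (dualPoint γ ζ).2) ^ 2 := by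
  have hc' : (1 - (γ : ℂ)) ≠ 0 := by
    have : (1 - γ) ≠ 0 := by linarith
    exact_mod_cast this
  have h1 : ((γ : ℂ) - 1) * (dualPoint γ ζ).2 =
      -(ζ.2 - I * (γ : ℂ) * ((‖ζ.1‖ ^ γ : ℝ) : ℂ)) := by
    simp only [dualPoint]
    field_simp
    ring
  have h2 := conj_mul_rpow_mul_self hγ ζ.1
  have hI : I * I = -1 := I_mul_I
  rw [lerayKernel, mul_assoc I, h1, ← neg_sq]
  congr 2
  simp only [dualPoint]
  linear_combination -(γ : ℂ) * h2 - (γ : ℂ) * ((‖ζ.1‖ ^ γ : ℝ) : ℂ) * hI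

/-- The incidence form is symmetric in point and line up to the factor `γ - 1`. This factor accounts
for both the `(γ-1)²` in front and the rescaled height `ε / (γ - 1)`. -/
theorem lerayKernel_dual {γ : ℝ} (hγ : 1 < γ) (ε : ℝ) (ζ η : ℂ × ℂ) :
    lerayKernel γ.conjExponent
      ((dualPoint γ η).1, (dualPoint γ η).2 + ((ε / (γ - 1) : ℝ) : ℂ) * I) (dualPoint γ ζ) =
    ((γ : ℂ) - 1) ^ 2 * lerayKernel γ (ζ.1, ζ.2 + (ε : ℂ) * I) η := by
  have hne : γ - 1 ≠ 0 := by linarith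
  have hc : ((γ : ℂ) - 1) ≠ 0 := by exact_mod_cast hne
  have e3 : (γ.conjExponent : ℂ) = (γ : ℂ) / ((γ : ℂ) - 1) := by simp [Real.conjExponent]
  have e4 : (γ.conjExponent : ℂ) - 1 = 1 / ((γ : ℂ) - 1) := by rw [e3]; field_simp; ring
  rw [lerayKernel_eq_dualPoint (one_lt_conjExponent hγ), lerayKernel_eq_dualPoint hγ,
    dualPoint_dualPoint hγ, e4, e3]
  have h : (γ : ℂ) / (γ - 1) * ζ.1 * (dualPoint γ η).1 +
      I * ((dualPoint γ η).2 + ((ε / (γ - 1) : ℝ) : ℂ) * I) + I * (1 / ((γ : ℂ) - 1)) * ζ.2 =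
      (γ * (dualPoint γ η).1 * ζ.1 + I * (ζ.2 + ε * I) + I * (γ - 1) * (dualPoint γ η).2) /
        ((γ : ℂ) - 1) := by
    push_cast
    field_simp
    ring
  rw [h, div_pow, one_div_div]
  ring

/-- The real part of the denominator is at least `ε`. With a bounded kernel, Fubini in the
transposition formula needs nothing but integrability of the two functions. -/
theorem norm_lerayKernel_shift_le {γ ε : ℝ} (hγ : 1 < γ) (hε : 0 < ε) (ζ η : hypersurface γ) :
    ‖lerayKernel γ (ζ.1.1, ζ.1.2 + (ε : ℂ) * I) η‖ ≤ 1 / ε ^ 2 := by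
  obtain ⟨q, rfl⟩ := (paramEquiv γ).surjective η
  have h : ζ.1.2.im = ‖ζ.1.1‖ ^ γ := ζ.2
  rw [lerayKernel_param hγ]
  have h2 : (ζ.1.2 + (ε : ℂ) * I).im - ‖ζ.1.1‖ ^ γ = ε := by simp [h]
  rw [h2, coordKernel, norm_div, norm_one, norm_pow]
  refine one_div_le_one_div_of_le (by positivity) (pow_le_pow_left₀ hε.le ?_ 2)
  refine le_trans ?_ ((le_abs_self _).trans (abs_re_le_norm _))
  rw [add_re, re_phase_add]
  have := re_phase_nonneg hγ ζ.1.1 q.1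
  simp only [mul_re, I_re, I_im, ofReal_re, ofReal_im]
  linarith

theorem measurable_lerayKernel_shift (γ ε : ℝ) :
    Measurable fun r : hypersurface γ × hypersurface γ =>
      lerayKernel γ (r.1.1.1, r.1.1.2 + (ε : ℂ) * I) r.2 := by
  have h : Measurable fun ζ : hypersurface γ => (ζ : ℂ × ℂ) := measurable_subtype_coe
  have hc : Measurable fun z : ℂ => conj z := continuous_conj.measurable
  unfold lerayKernel
  fun_prop

instance (γ : ℝ) : SigmaFinite (sigma γ) := by
  rw [sigma_eq_map]
  unfold wtProd
  exact (paramEquiv γ).sigmaFinite_map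

/-- The Leray integral of `M_{γ*}` at height `ε / (γ - 1)` is the transpose of the Leray integral
of `M_γ` at height `ε`. -/
theorem integral_shiftLeray_mul {γ ε : ℝ} (hγ : 1 < γ) (hε : 0 < ε) {f : hypersurface γ → ℂ}
    {h : hypersurface γ.conjExponent → ℂ} (hf : Integrable f (sigma γ))
    (hh : Integrable h (sigma γ.conjExponent)) :
    ∫ ζ, shiftLeray γ ε f ζ * h (dualMap hγ ζ) ∂(sigma γ) =
      ∫ η, f η * shiftLeray γ.conjExponent (ε / (γ - 1)) h (dualMap hγ η) ∂(sigma γ) := by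
  have hne : γ - 1 ≠ 0 := by linarith
  have hc : ((γ : ℂ) - 1) ≠ 0 := by exact_mod_cast hne
  have hg : Integrable (fun ζ => h (dualMap hγ ζ)) (sigma γ) := by
    rw [← map_dualMap_sigma hγ, integrable_map_equiv] at hh
    exact hh
  set κ : ℂ := ((γ ^ 2 / (4 * Real.pi ^ 2) : ℝ) : ℂ) with hκ
  set k : hypersurface γ → hypersurface γ → ℂ :=
    fun ζ η => lerayKernel γ (ζ.1.1, ζ.1.2 + (ε : ℂ) * I) η with hk
  have hint : Integrable (fun r : hypersurface γ × hypersurface γ =>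
      h (dualMap hγ r.1) * f r.2 * k r.1 r.2) ((sigma γ).prod (sigma γ)) :=
    (hg.mul_prod hf).mul_bdd (c := 1 / ε ^ 2)
      (measurable_lerayKernel_shift γ ε).aestronglyMeasurable
      (Eventually.of_forall fun r => norm_lerayKernel_shift_le hγ hε r.1 r.2)
  have hL : ∀ ζ, shiftLeray γ ε f ζ * h (dualMap hγ ζ) =
      κ * ∫ η, h (dualMap hγ ζ) * f η * k ζ η ∂(sigma γ) := by
    intro ζ
    simp only [mul_assoc]
    rw [integral_const_mul, shiftLeray, lerayIntegral]
    ring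
  -- The normalizations of the two Leray integrals match because `(γ*)² (γ - 1)² = γ²`.
  have hR : ∀ η, f η * shiftLeray γ.conjExponent (ε / (γ - 1)) h (dualMap hγ η) =
      κ * ∫ ζ, h (dualMap hγ ζ) * f η * k ζ η ∂(sigma γ) := by
    intro η
    rw [shiftLeray, lerayIntegral, ← map_dualMap_sigma hγ, integral_map_equiv,
      ← integral_const_mul, ← integral_const_mul, ← integral_const_mul]
    refine integral_congr_ae (Eventually.of_forall fun ζ => ?_)
    have hd := lerayKernel_dual hγ ε (ζ : ℂ × ℂ) (η : ℂ × ℂ)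
    change f η * (_ * (h (dualMap hγ ζ) * lerayKernel γ.conjExponent
      ((dualPoint γ η).1, (dualPoint γ η).2 + ((ε / (γ - 1) : ℝ) : ℂ) * I) (dualPoint γ ζ))) = _
    have e3 : (γ.conjExponent : ℂ) = (γ : ℂ) / ((γ : ℂ) - 1) := by simp [Real.conjExponent]
    rw [hd, hκ]
    simp only [hk]
    push_cast
    rw [e3]
    field_simp
  simp only [hL, hR]
  rw [integral_const_mul, integral_const_mul, integral_integral_swap hint]

theorem sigma_absolutelyContinuous_preferredDual {γ : ℝ} (hγ : 1 < γ) :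
    sigma γ ≪ preferredDualMeasure hγ := by
  have h0 : ENNReal.ofReal (preferredFactor (normConst γ) γ.conjExponent) ≠ 0 := by
    simpa using preferredFactor_pos (normConst_pos hγ) (one_lt_conjExponent hγ)
  rw [sigma_eq_map, preferredDualMeasure_eq]
  exact ((powWeight_absolutelyContinuous_powWeight (by fun_prop) ae_norm_fst_pos _ _).map
    (paramEquiv γ).measurable).trans (Measure.absolutelyContinuous_smul h0)

theorem coeFn_dualPullback {γ : ℝ} (hγ : 1 < γ) (h : Lp ℂ 2 (preferredMeasureOnDual γ)) :
    dualPullback hγ h =ᵐ[preferredDualMeasure hγ] h ∘ dualMap hγ :=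
  Lp.coeFn_compMeasurePreserving h (measurePreserving_dualMap hγ)

theorem surjective_dualPullback {γ : ℝ} (hγ : 1 < γ) : Function.Surjective (dualPullback hγ) := by
  intro g
  have hp : MeasurePreserving (dualMap hγ).symm (preferredMeasureOnDual γ)
      (preferredDualMeasure hγ) := (measurePreserving_dualMap hγ).symm
  refine ⟨Lp.compMeasurePreserving (dualMap hγ).symm hp g, Lp.ext ?_⟩
  filter_upwards [coeFn_dualPullback hγ (Lp.compMeasurePreserving (dualMap hγ).symm hp g),
    (measurePreserving_dualMap hγ).quasiMeasurePreserving.ae_eq_comp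
      (Lp.coeFn_compMeasurePreserving g hp)] with ζ h1 h2
  rw [h1, h2]
  simp

theorem pairing_shiftOp {γ ε : ℝ} (hγ : 1 < γ) (hε : 0 < ε)
    {f : Lp ℂ 2 (preferredMeasureWith (normConst γ) γ)} (hf : f ∈ niceSet (normConst γ) γ)
    {h : Lp ℂ 2 (preferredMeasureWith (normConst γ) γ.conjExponent)}
    (hh : h ∈ niceSet (normConst γ) γ.conjExponent) :
    pairing γ (shiftOp (normConst_pos hγ) hγ ε f) (dualPullback hγ h) =
      pairing γ f (dualPullback hγ
        (shiftOp (normConst_pos hγ) (one_lt_conjExponent hγ) (ε / (γ - 1)) h)) := by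
  have hγ' := one_lt_conjExponent hγ
  have hc := normConst_pos hγ
  have hε' : 0 < ε / (γ - 1) := div_pos hε (by linarith)
  have hmp : MeasurePreserving (dualMap hγ) (sigma γ) (sigma γ.conjExponent) :=
    ⟨(dualMap hγ).measurable, map_dualMap_sigma hγ⟩
  have hac := sigma_absolutelyContinuous_preferredDual hγ
  rw [pairing, pairing, pairingMeasure, integral_smul_measure, integral_smul_measure]
  congr 1
  refine (integral_congr_ae ?_).trans ((integral_shiftLeray_mul hγ hε hf hh).trans
    (integral_congr_ae ?_))
  · filter_upwards [coeFn_ae_eq_sigma hc hγ (coeFn_shiftOp hc hγ hε f),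
      hac.ae_le (coeFn_dualPullback hγ h)] with ζ h1 h2
    exact congrArg₂ (· * ·) h1 h2
  · filter_upwards [hac.ae_le (coeFn_dualPullback hγ (shiftOp hc hγ' (ε / (γ - 1)) h)),
      hmp.quasiMeasurePreserving.ae_eq_comp
        (coeFn_ae_eq_sigma hc hγ' (coeFn_shiftOp hc hγ' hε' h))] with ζ h1 h2
    exact congrArg (f ζ * ·) (h1.trans h2).symm

/-- The Leray transform of the dual hypersurface is the transpose of the Leray transform. -/
theorem pairing_leray {γ : ℝ} (hγ : 1 < γ)
    (J : Lp ℂ 2 (preferredDualMeasure hγ) ≃ₗᵢ[ℂ]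
      (Lp ℂ 2 (preferredMeasureWith (normConst γ) γ) →L[ℂ] ℂ))
    (hJ : ∀ g f, J g f = pairing γ f g)
    (f : Lp ℂ 2 (preferredMeasureWith (normConst γ) γ))
    (h : Lp ℂ 2 (preferredMeasureWith (normConst γ) γ.conjExponent)) :
    J (dualPullback hγ h) (leray γ (preferredMeasureWith (normConst γ) γ) f) =
      J (dualPullback hγ (leray γ.conjExponent
        (preferredMeasureWith (normConst γ) γ.conjExponent) h)) f := by
  have hγ' := one_lt_conjExponent hγ
  have hc := normConst_pos hγ
  have hP : Continuous fun h : Lp ℂ 2 (preferredMeasureWith (normConst γ) γ.conjExponent) =>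
      J (dualPullback hγ h) := J.continuous.comp (dualPullback hγ).continuous
  have hscale : Tendsto (fun ε : ℝ => ε / (γ - 1)) (𝓝[>] 0) (𝓝[>] 0) := by
    refine tendsto_nhdsWithin_iff.2 ⟨?_, ?_⟩
    · have : Tendsto (fun ε : ℝ => ε / (γ - 1)) (𝓝 0) (𝓝 (0 / (γ - 1))) :=
        tendsto_id.div_const _
      rw [zero_div] at this
      exact this.mono_left nhdsWithin_le_nhds
    · filter_upwards [self_mem_nhdsWithin] with ε hε
      have : 0 < ε := hε
      exact div_pos this (by linarith)
  -- For integrable data the identity is the limit of transposition at positive heights, `ε` and `ε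
  -- / (γ - 1)` tending to `0+` together. It is then extended by density, first in `f` and
  -- afterwards in `h`.
  have hnice : ∀ f ∈ niceSet (normConst γ) γ, ∀ h ∈ niceSet (normConst γ) γ.conjExponent,
      J (dualPullback hγ h) (leray γ (preferredMeasureWith (normConst γ) γ) f) =
        J (dualPullback hγ (leray γ.conjExponent
          (preferredMeasureWith (normConst γ) γ.conjExponent) h)) f := by
    intro f hf h hh
    have h1 := ((J (dualPullback hγ h)).continuous.tendsto _).comp (tendsto_shiftOp hc hγ f)
    have h2 := ((ContinuousLinearMap.apply ℂ ℂ f).continuous.tendsto _).comp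
      ((hP.tendsto _).comp ((tendsto_shiftOp hc hγ' h).comp hscale))
    refine tendsto_nhds_unique (h1.congr' ?_) h2
    filter_upwards [self_mem_nhdsWithin] with ε hε
    simp only [Function.comp, ContinuousLinearMap.apply_apply, hJ]
    exact pairing_shiftOp hγ hε hf hh
  have hnice' : ∀ f, ∀ h ∈ niceSet (normConst γ) γ.conjExponent,
      J (dualPullback hγ h) (leray γ (preferredMeasureWith (normConst γ) γ) f) =
        J (dualPullback hγ (leray γ.conjExponent
          (preferredMeasureWith (normConst γ) γ.conjExponent) h)) f := by
    intro f h hh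
    have hcl : IsClosed {f | J (dualPullback hγ h)
        (leray γ (preferredMeasureWith (normConst γ) γ) f) = J (dualPullback hγ
          (leray γ.conjExponent (preferredMeasureWith (normConst γ) γ.conjExponent) h)) f} :=
      isClosed_eq ((J (dualPullback hγ h)).continuous.comp (leray γ _).continuous)
        (ContinuousLinearMap.continuous _)
    exact hcl.closure_subset_iff.2 (fun f hf => hnice f hf h hh) (dense_niceSet hc hγ f)
  have hcl : IsClosed {h | J (dualPullback hγ h)
      (leray γ (preferredMeasureWith (normConst γ) γ) f) = J (dualPullback hγ
        (leray γ.conjExponent (preferredMeasureWith (normConst γ) γ.conjExponent) h)) f} :=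
    isClosed_eq
      ((ContinuousLinearMap.apply ℂ ℂ (leray γ _ f)).continuous.comp hP)
      ((ContinuousLinearMap.apply ℂ ℂ f).continuous.comp (hP.comp (leray _ _).continuous))
  exact hcl.closure_subset_iff.2 (fun h hh => hnice' f h hh) (dense_niceSet hc hγ' h)

/-- An element of the dual Hardy space corresponds to a functional of the form `φ ∘ L`, by
transposition, and idempotence of `L` makes it invariant. Conversely, if `φ ∘ L = φ`, transposition
exhibits the element as a dual Leray transform of itself. -/
theorem mem_dualHardySubspace_iff {γ : ℝ} (hγ : 1 < γ)
    (J : Lp ℂ 2 (preferredDualMeasure hγ) ≃ₗᵢ[ℂ]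
      (Lp ℂ 2 (preferredMeasureWith (normConst γ) γ) →L[ℂ] ℂ))
    (hJ : ∀ g f, J g f = pairing γ f g) (g : Lp ℂ 2 (preferredDualMeasure hγ)) :
    g ∈ dualHardySubspace hγ ↔
      ∀ f, J g (leray γ (preferredMeasureWith (normConst γ) γ) f) = J g f := by
  constructor
  · rintro ⟨_, ⟨h, rfl⟩, rfl⟩ f
    have h1 := pairing_leray hγ J hJ (leray γ _ f) h
    rw [leray_leray (normConst_pos hγ) hγ, pairing_leray hγ J hJ f h] at h1
    exact h1.symm
  · intro hg
    obtain ⟨h, rfl⟩ := surjective_dualPullback hγ g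
    refine ⟨leray γ.conjExponent (preferredMeasureOnDual γ) h, ⟨h, rfl⟩, ?_⟩
    apply J.injective
    ext f
    rw [← hg f]
    exact (pairing_leray hγ J hJ f h).symm

/-! ### Duality for the range of an idempotent operator -/

-- A functional invariant under `L` is determined by its restriction to the range, and every
-- functional on the range extends to an invariant one by composing with `P`, the operator `L`
-- regarded as a map onto its range. As `J` is isometric, the norm of the inverse is that of `φ ↦ φ
-- ∘ P`.
set_option maxSynthPendingDepth 3 in
theorem exists_dual_equiv_range {E F : Type*} [NormedAddCommGroup E] [NormedSpace ℂ E]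
    [NormedAddCommGroup F] [NormedSpace ℂ F] (L : E →L[ℂ] E) (hL : ∀ x, L (L x) = L x)
    (J : F ≃ₗᵢ[ℂ] (E →L[ℂ] ℂ)) (S : Submodule ℂ F)
    (hS : ∀ g, g ∈ S ↔ ∀ x, J g (L x) = J g x) :
    ∃ χ : S ≃L[ℂ] (LinearMap.range L.toLinearMap →L[ℂ] ℂ),
      (∀ (g : S) (x : LinearMap.range L.toLinearMap), χ g x = J g x) ∧
        ‖(χ.symm : (LinearMap.range L.toLinearMap →L[ℂ] ℂ) →L[ℂ] S)‖ = ‖L‖ := by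
  set R := LinearMap.range L.toLinearMap with hR
  let P : E →L[ℂ] R := L.codRestrict R fun x => ⟨x, rfl⟩
  have hP : ∀ x, (P x : E) = L x := fun _ => rfl
  have hPR : ∀ x : R, P x = x := by
    rintro ⟨_, y, rfl⟩
    exact Subtype.ext (hL y)
  let f₁ : S →L[ℂ] (R →L[ℂ] ℂ) := (ContinuousLinearMap.precomp ℂ R.subtypeL).comp
    ((J : F →L[ℂ] (E →L[ℂ] ℂ)).comp S.subtypeL)
  let f₂ : (R →L[ℂ] ℂ) →L[ℂ] S := ((J.symm : (E →L[ℂ] ℂ) →L[ℂ] F).comp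
    (ContinuousLinearMap.precomp ℂ P)).codRestrict S fun φ => by
      refine (hS _).2 fun x => ?_
      change J (J.symm (φ.comp P)) (L x) = J (J.symm (φ.comp P)) x
      rw [LinearIsometryEquiv.apply_symm_apply]
      change φ (P (L x)) = φ (P x)
      rw [← hP x, hPR]
  have h₁ : ∀ (g : S) (x : R), f₁ g x = J g x := fun _ _ => rfl
  have h₂ : ∀ φ, (f₂ φ : F) = J.symm (φ.comp P) := fun _ => rfl
  refine ⟨ContinuousLinearEquiv.equivOfInverse f₁ f₂ (fun g => ?_) (fun φ => ?_), h₁, ?_⟩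
  · refine Subtype.ext (J.injective ?_)
    rw [h₂, LinearIsometryEquiv.apply_symm_apply]
    ext x
    exact (hS _).1 g.2 x
  · ext x
    rw [h₁, h₂, LinearIsometryEquiv.apply_symm_apply]
    change φ (P x) = φ x
    rw [hPR]
  · change ‖f₂‖ = ‖L‖
    have hn : ∀ φ, ‖f₂ φ‖ = ‖φ.comp P‖ := fun φ => by
      rw [← LinearIsometryEquiv.norm_map J.symm, ← h₂]; rfl
    refine le_antisymm (f₂.opNorm_le_bound (norm_nonneg _) fun φ => ?_)
      (L.opNorm_le_bound (norm_nonneg _) fun x => ?_)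
    · have hPL : ‖P‖ ≤ ‖L‖ := P.opNorm_le_bound (norm_nonneg _) fun x => L.le_opNorm x
      rw [hn, mul_comm]
      exact (φ.opNorm_comp_le P).trans (by gcongr)
    -- Hahn–Banach on the range: a functional of norm at most `1` recovers `‖P x‖`, which gives the
    -- lower bound for the norm.
    · obtain ⟨φ, hφ1, hφ⟩ := exists_dual_vector'' ℂ (P x)
      calc ‖L x‖ = ‖P x‖ := rfl
        _ = ‖(φ.comp P) x‖ := by
          rw [ContinuousLinearMap.comp_apply, hφ]; simp
        _ ≤ ‖φ.comp P‖ * ‖x‖ := ContinuousLinearMap.le_opNorm _ _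
        _ ≤ ‖f₂‖ * ‖x‖ := by
          gcongr
          rw [← hn]
          exact (f₂.le_opNorm φ).trans (mul_le_of_le_one_right (norm_nonneg _) hφ1)

end LerayDuality

end

/-! ### The duality theorem -/

open LerayDuality in
theorem theorem1p7 {γ : ℝ} (hγ : 1 < γ) :
    -- the Leray transforms of `M_γ` and of the dual `M_{γ*}` are bounded operators
    IsLerayTransform γ (preferredMeasure γ) (leray γ (preferredMeasure γ)) ∧
    IsLerayTransform γ.conjExponent (preferredMeasureOnDual γ)
      (leray γ.conjExponent (preferredMeasureOnDual γ)) ∧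
    -- the pairing converges absolutely
    (∀ (f : Lp ℂ 2 (preferredMeasure γ)) (g : Lp ℂ 2 (preferredDualMeasure hγ)),
      Integrable (fun ζ => f ζ * g ζ) (pairingMeasure γ)) ∧
    -- `χ` is given by the pairing, is boundedly invertible, and its inverse has norm `‖L‖`
    ∃ χ : DualHardySpace hγ ≃L[ℂ] (HardySpace γ (preferredMeasure γ) →L[ℂ] ℂ),
      (∀ (g : DualHardySpace hγ) (f : HardySpace γ (preferredMeasure γ)),
        χ g f = pairing γ f.toLp g.toLp) ∧
      ‖(χ.symm : (HardySpace γ (preferredMeasure γ) →L[ℂ] ℂ) →L[ℂ] DualHardySpace hγ)‖ =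
        ‖leray γ (preferredMeasure γ)‖ := by
  refine ⟨isLerayTransform_leray (normConst_pos hγ) hγ,
    isLerayTransform_leray (normConst_pos hγ) (one_lt_conjExponent hγ), integrable_pairing hγ, ?_⟩
  obtain ⟨J, hJ⟩ := exists_pairing_isometry hγ
  obtain ⟨χ, hχ, hnorm⟩ := exists_dual_equiv_range (leray γ (preferredMeasure γ))
    (leray_leray (normConst_pos hγ) hγ) J (dualHardySubspace hγ)
    (mem_dualHardySubspace_iff hγ J hJ)
  exact ⟨χ, fun g f => (hχ g f).trans (hJ _ _), hnorm⟩
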